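/- Let $\Lambda_F$ be the ring of symmetric functions in $x=(x_1,x_2,\dots)$ over $F=\mathbb{Q}(q,t)$, with power sums $p_k$ and $p_\lambda=\prod_j p_{\lambda_j}$, and let $\langle\cdot,\cdot\rangle_{q,t}$ be the $F$-bilinear form on $\Lambda_F$ with $$\langle p_\lambda,p_\mu\rangle_{q,t}=\delta_{\lambda\mu}\,\prod_{i\ge 1} m_i(\lambda)!\,i^{m_i(\lambda)}\ \prod_{j=1}^{\ell(\lambda)}\frac{1-q^{\lambda_j}}{1-t^{\lambda_j}},$$ where $m_i(\lambda)$ is the number of parts of $\lambda$ equal to $i$. Let $P_\lambda(x;q,t)$ be the Macdonald polynomials, that is, the family obtained by Gram–Schmidt orthogonalization (without rescaling) of the Schur functions $s_\lambda$ with respect to $\langle\cdot,\cdot\rangle_{q,t}$, the partitions of each fixed integer being taken in increasing lexicographic order. Put $$Q_\lambda(x;q,t)=\frac{P_\lambda(x;q,t)}{\langle P_\lambda,P_\lambda\rangle_{q,t}},\qquad Q'_\lambda(x;q,t)=Q_\lambda\!\left(\frac{1-q}{1-t}\,x;q,t\right),$$ where $f(x)\mapsto f\left(\frac{1-q}{1-t}x\right)$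 is the $F$-algebra endomorphism of $\Lambda_F$ that maps $p_k$ to $\frac{1-q^k}{1-t^k}\,p_k$ for every $k\ge 1$. **Theorem.** Let $l$ be a positive integer and $\zeta\in\mathbb{C}$ a primitive $l$-th root of unity. Let $\mu=(1^{m_1}2^{m_2}\cdots n^{m_n})$ be a partition of $n$. For each $i$ write $m_i=l\,q_i+r_i$ with integers $q_i\ge 0$ and $0\le r_i\le l-1$, and let $\bar\mu=(1^{r_1}2^{r_2}\cdots n^{r_n})$. Then the coefficients of $Q'_\mu(x;q,t)$, of $Q'_{(i^l)}(x;q,t)$ for $1\le i\le n$, and of $Q'_{\bar\mu}(x;q,t)$ have no pole at $t=\zeta$, and the specializations at $t=\zeta$ satisfy, in the ring of symmetric functions over $\mathbb{C}(q)$, $$Q'_\mu(x;q,\zeta)=\left(Q'_{(1^l)}(x;q,\zeta)\right)^{q_1}\left(Q'_{(2^l)}(x;q,\zeta)\right)^{q_2}\cdots\left(Q'_{(n^l)}(x;q,\zeta)\right)^{q_n}\;Q'_{\bar\mu}(x;q,\zeta),$$ where $(i^l)$ is the partition with $l$ parts equal to $i$. -/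

import Mathlib

/-! ### The ring of symmetric functions in the variables `x_0, x_1, x_2, …` -/

noncomputable section

namespace Macdonald

/-- The ring `Λ_R` of symmetric functions over `R`: the formal power series of bounded degree
in countably many variables that are invariant under all permutations of the variables. -/
def SymFun (R : Type*) [CommRing R] : Subalgebra R (MvPowerSeries ℕ R) where
  carrier := {f | (∃ D : ℕ, ∀ d : ℕ →₀ ℕ, D < d.degree → MvPowerSeries.coeff d f = 0) ∧
    ∀ σ : Equiv.Perm ℕ, MvPowerSeries.rename σ f = f}
  mul_mem' := by
    rintro f g ⟨⟨D, hD⟩, hf⟩ ⟨⟨E, hE⟩, hg⟩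
    refine ⟨⟨D + E, fun d hd => ?_⟩, fun σ => by rw [map_mul, hf, hg]⟩
    classical
    rw [MvPowerSeries.coeff_mul]
    refine Finset.sum_eq_zero fun a ha => ?_
    rw [Finset.HasAntidiagonal.mem_antidiagonal] at ha
    rw [← ha, map_add] at hd
    rcases lt_or_ge D a.1.degree with h | h
    · rw [hD _ h, zero_mul]
    · rw [hE _ (by omega), mul_zero]
  add_mem' := by
    rintro f g ⟨⟨D, hD⟩, hf⟩ ⟨⟨E, hE⟩, hg⟩
    refine ⟨⟨D + E, fun d hd => ?_⟩, fun σ => by rw [map_add, hf, hg]⟩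
    rw [map_add, hD _ (by omega), hE _ (by omega), add_zero]
  algebraMap_mem' := by
    intro r
    refine ⟨⟨0, fun d hd => ?_⟩, fun σ => AlgHom.commutes _ _⟩
    classical
    rw [MvPowerSeries.algebraMap_apply, MvPowerSeries.coeff_C, if_neg]
    rintro rfl
    simp at hd

section basics

variable {R : Type*} [CommRing R]

theorem coeff_embDomain_of_mem {f : MvPowerSeries ℕ R} (hf : f ∈ SymFun R) (σ : Equiv.Perm ℕ)
    (d : ℕ →₀ ℕ) :
    MvPowerSeries.coeff (d.embDomain σ.toEmbedding) f = MvPowerSeries.coeff d f := by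
  have h := MvPowerSeries.coeff_embDomain_rename σ.toEmbedding f d
  have h2 : MvPowerSeries.rename (σ.toEmbedding : ℕ → ℕ) f = f := hf.2 σ
  rwa [h2] at h

theorem degree_embDomain {α β : Type*} (e : α ↪ β) (d : α →₀ ℕ) :
    (d.embDomain e).degree = d.degree := by
  rw [Finsupp.degree_apply, Finsupp.degree_apply, Finsupp.support_embDomain, Finset.sum_map]
  exact Finset.sum_congr rfl fun i _ => Finsupp.embDomain_apply_self e d i

theorem mem_symFun {f : MvPowerSeries ℕ R} (D : ℕ)
    (h : ∀ d : ℕ →₀ ℕ, D < d.degree → MvPowerSeries.coeff d f = 0)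
    (h2 : ∀ (σ : Equiv.Perm ℕ) (d : ℕ →₀ ℕ),
      MvPowerSeries.coeff (d.embDomain σ.toEmbedding) f = MvPowerSeries.coeff d f) :
    f ∈ SymFun R := by
  refine ⟨⟨D, h⟩, fun σ => ?_⟩
  ext d
  have hd : d = (d.embDomain σ.symm.toEmbedding).embDomain σ.toEmbedding := by
    ext i
    obtain ⟨j, rfl⟩ := σ.surjective i
    have e1 := Finsupp.embDomain_apply_self σ.toEmbedding (d.embDomain σ.symm.toEmbedding) j
    have e2 := Finsupp.embDomain_apply_self σ.symm.toEmbedding d (σ j)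
    simp only [Equiv.coe_toEmbedding, Equiv.symm_apply_apply] at e1 e2
    rw [e1, e2]
  have h3 := MvPowerSeries.coeff_embDomain_rename σ.toEmbedding f
    (d.embDomain σ.symm.toEmbedding)
  rw [hd, h2]
  exact h3

end basics

/-- The power sum `p_k = ∑ i, x_i ^ k`, for `k ≥ 1`. -/
def powerSum (R : Type*) [CommRing R] (k : ℕ+) : SymFun R :=
  ⟨fun d => open Classical in if ∃ i : ℕ, d = Finsupp.single i (k : ℕ) then 1 else 0, by
    classical
    refine mem_symFun (k : ℕ) (fun d hd => ?_) (fun σ d => ?_)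
    · refine if_neg ?_
      rintro ⟨i, rfl⟩
      simp at hd
    · change (if _ then _ else _) = (if _ then _ else _)
      refine if_congr ⟨?_, ?_⟩ rfl rfl
      · rintro ⟨i, hi⟩
        refine ⟨σ.symm i, Finsupp.embDomain_injective σ.toEmbedding ?_⟩
        rw [hi, Finsupp.embDomain_single]
        simp
      · rintro ⟨i, rfl⟩
        exact ⟨σ i, by rw [Finsupp.embDomain_single]; rfl⟩⟩

/-- The complete homogeneous symmetric function `h_n`, the sum of all monomials of degree `n`. -/
def complete (R : Type*) [CommRing R] (n : ℕ) : SymFun R :=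
  ⟨fun d => if d.degree = n then 1 else 0, by
    refine mem_symFun n (fun d hd => ?_) (fun σ d => ?_)
    · exact if_neg (by omega)
    · change (if _ then _ else _) = (if _ then _ else _)
      rw [degree_embDomain]⟩

/-! ### The power sums are algebraically independent generators -/

section powerSumBasis

variable {K : Type*} [Field K]

/-- A surjective endomorphism of a Noetherian ring is injective. -/
theorem injective_of_surjective_ringEnd {A : Type*} [CommRing A] [IsNoetherianRing A]
    (f : A →+* A) (hf : Function.Surjective f) : Function.Injective f := by
  rw [injective_iff_map_eq_zero]
  intro x hx
  let c : ℕ →o Ideal A := ⟨fun n => RingHom.ker (f ^ n), by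
    refine monotone_nat_of_le_succ fun n y hy => ?_
    rw [RingHom.mem_ker] at hy ⊢
    rw [pow_succ', RingHom.mul_def, RingHom.comp_apply, hy, map_zero]⟩
  obtain ⟨n, hn⟩ := monotone_stabilizes_iff_noetherian.mpr ‹IsNoetherianRing A› c
  have hs : ∀ n : ℕ, Function.Surjective (f ^ n) := by
    intro n
    induction n with
    | zero => exact fun y => ⟨y, by simp⟩
    | succ m ih =>
      rw [pow_succ', RingHom.mul_def]
      exact hf.comp ih
  obtain ⟨y, rfl⟩ := hs n x
  have h1 : y ∈ c (n + 1) := by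
    change y ∈ RingHom.ker (f ^ (n + 1))
    rw [RingHom.mem_ker, pow_succ', RingHom.mul_def, RingHom.comp_apply, hx]
  rw [← hn (n + 1) (by omega)] at h1
  exact h1

/-- The substitution `X_i ↦ p_{i+1}(x_0, …, x_{N-1})`. -/
def finPsum (K : Type*) [Field K] (N : ℕ) :
    MvPolynomial (Fin N) K →ₐ[K] MvPolynomial.symmetricSubalgebra (Fin N) K :=
  MvPolynomial.aeval fun i =>
    ⟨MvPolynomial.psum (Fin N) K ((i : ℕ) + 1), MvPolynomial.psum_isSymmetric _ _ _⟩

theorem finPsum_apply (N : ℕ) (p : MvPolynomial (Fin N) K) :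
    ((finPsum K N p : MvPolynomial.symmetricSubalgebra (Fin N) K) : MvPolynomial (Fin N) K) =
      MvPolynomial.aeval (fun i : Fin N => MvPolynomial.psum (Fin N) K ((i : ℕ) + 1)) p :=
  (Subalgebra.mvPolynomial_aeval_coe _ _ _).symm

theorem finPsum_surjective [CharZero K] (N : ℕ) : Function.Surjective (finPsum K N) := by
  let B := MvPolynomial.esymmAlgEquiv (Fin N) K (Fintype.card_fin N)
  have key : ∀ k : ℕ, k ≤ N → (⟨MvPolynomial.esymm (Fin N) K k,
      MvPolynomial.esymm_isSymmetric _ _ _⟩ : MvPolynomial.symmetricSubalgebra (Fin N) K) ∈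
        (finPsum K N).range := by
    intro k
    induction k using Nat.strong_induction_on with
    | _ k ih =>
      intro hk
      rcases Nat.eq_zero_or_pos k with rfl | hpos
      · have : (⟨MvPolynomial.esymm (Fin N) K 0, MvPolynomial.esymm_isSymmetric _ _ _⟩ :
          MvPolynomial.symmetricSubalgebra (Fin N) K) = 1 := Subtype.ext (by simp)
        rw [this]
        exact one_mem _
      · have hps : ∀ j : ℕ, 0 < j → j ≤ N → (⟨MvPolynomial.psum (Fin N) K j,
          MvPolynomial.psum_isSymmetric _ _ _⟩ :
            MvPolynomial.symmetricSubalgebra (Fin N) K) ∈ (finPsum K N).range := by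
          intro j hj hjN
          refine ⟨MvPolynomial.X ⟨j - 1, by omega⟩, ?_⟩
          apply Subtype.ext
          change ((finPsum K N _ : MvPolynomial.symmetricSubalgebra (Fin N) K) :
            MvPolynomial (Fin N) K) = _
          rw [finPsum_apply, MvPolynomial.aeval_X]
          simp only
          rw [Nat.sub_add_cancel hj]
        have hnewton : ((k : K) • (⟨MvPolynomial.esymm (Fin N) K k,
            MvPolynomial.esymm_isSymmetric _ _ _⟩ :
              MvPolynomial.symmetricSubalgebra (Fin N) K)) =
            (-1) ^ (k + 1) * ∑ a ∈ (Finset.HasAntidiagonal.antidiagonal k).filter (fun a => a.1 < k),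
              (-1) ^ a.1 * (⟨MvPolynomial.esymm (Fin N) K a.1,
                MvPolynomial.esymm_isSymmetric _ _ _⟩ :
                  MvPolynomial.symmetricSubalgebra (Fin N) K) *
              (⟨MvPolynomial.psum (Fin N) K a.2, MvPolynomial.psum_isSymmetric _ _ _⟩ :
                MvPolynomial.symmetricSubalgebra (Fin N) K) := by
          apply Subtype.ext
          have h := MvPolynomial.mul_esymm_eq_sum (Fin N) K k
          push_cast
          rw [← h, MvPolynomial.smul_eq_C_mul]
          simp
        have hk0 : (k : K) ≠ 0 := by exact_mod_cast hpos.ne'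
        rw [← inv_smul_smul₀ hk0 (⟨MvPolynomial.esymm (Fin N) K k,
            MvPolynomial.esymm_isSymmetric _ _ _⟩ :
              MvPolynomial.symmetricSubalgebra (Fin N) K), hnewton]
        refine Subalgebra.smul_mem _ ?_ _
        refine mul_mem (pow_mem (neg_mem (one_mem _)) _) (sum_mem fun a ha => ?_)
        rw [Finset.mem_filter, Finset.HasAntidiagonal.mem_antidiagonal] at ha
        exact mul_mem (mul_mem (pow_mem (neg_mem (one_mem _)) _) (ih a.1 ha.2 (by omega)))
          (hps a.2 (by omega) (by omega))
  have hB : B.toAlgHom.range ≤ (finPsum K N).range := by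
    have : B.toAlgHom = MvPolynomial.aeval (fun i : Fin N =>
        (⟨MvPolynomial.esymm (Fin N) K ((i : ℕ) + 1), MvPolynomial.esymm_isSymmetric _ _ _⟩ :
          MvPolynomial.symmetricSubalgebra (Fin N) K)) := by
      apply MvPolynomial.algHom_ext
      intro i
      simp [B, MvPolynomial.esymmAlgHom]
    rw [this, ← Algebra.adjoin_range_eq_range_aeval, Algebra.adjoin_le_iff]
    rintro _ ⟨i, rfl⟩
    exact key _ i.2
  intro y
  obtain ⟨x, rfl⟩ := B.surjective y
  exact hB ⟨x, rfl⟩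

theorem finPsum_injective [CharZero K] (N : ℕ) : Function.Injective (finPsum K N) := by
  let B := MvPolynomial.esymmAlgEquiv (Fin N) K (Fintype.card_fin N)
  have h := injective_of_surjective_ringEnd
    ((B.symm.toAlgHom.comp (finPsum K N)).toRingHom)
    (B.symm.surjective.comp (finPsum_surjective N))
  exact Function.Injective.of_comp (f := B.symm) h

/-- The substitution `X_k ↦ p_k`. -/
def powerSumHom (K : Type*) [Field K] : MvPolynomial ℕ+ K →ₐ[K] SymFun K :=
  MvPolynomial.aeval (powerSum K)

/-- Setting `x_i = 0` for `i ≥ N`. -/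
def restrict (K : Type*) [Field K] (N : ℕ) : MvPowerSeries ℕ K →ₐ[K] MvPowerSeries (Fin N) K :=
  MvPowerSeries.killCompl Fin.valEmbedding

theorem restrict_powerSum (N : ℕ) (k : ℕ+) :
    restrict K N (powerSum K k) = (MvPolynomial.psum (Fin N) K k : MvPolynomial (Fin N) K) := by
  classical
  ext d
  rw [restrict, MvPowerSeries.coeff_killCompl, MvPolynomial.coeff_coe, MvPolynomial.psum,
    MvPolynomial.coeff_sum]
  simp only [MvPolynomial.coeff_X_pow]
  change (if _ then _ else _) = _
  split_ifs with h
  · obtain ⟨i, hi⟩ := h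
    have hiN : i < N := by
      by_contra hcon
      have h1 := DFunLike.congr_fun hi i
      rw [Finsupp.embDomain_of_notMem_range _ _ _ (by simpa using hcon)] at h1
      rw [Finsupp.single_eq_same] at h1
      exact k.ne_zero h1.symm
    have hd : d = Finsupp.single ⟨i, hiN⟩ (k : ℕ) := by
      apply Finsupp.embDomain_injective Fin.valEmbedding
      rw [hi, Finsupp.embDomain_single]
      rfl
    rw [Finset.sum_eq_single ⟨i, hiN⟩]
    · rw [if_pos hd.symm]
    · intro j _ hj
      rw [if_neg]
      rw [hd]
      intro hcon
      exact hj ((Finsupp.single_left_inj (by simp)).mp hcon)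
    · simp
  · symm
    refine Finset.sum_eq_zero fun j _ => if_neg fun hj => h ⟨j, ?_⟩
    rw [← hj, Finsupp.embDomain_single]
    rfl

/-- The index `i + 1`, as a positive number. -/
def finToPNat (N : ℕ) (i : Fin N) : ℕ+ := ⟨(i : ℕ) + 1, Nat.succ_pos _⟩

theorem restrict_powerSumHom (N : ℕ) (p : MvPolynomial (Fin N) K) :
    restrict K N (powerSumHom K (MvPolynomial.rename (finToPNat N) p)) =
      ((finPsum K N p : MvPolynomial (Fin N) K) : MvPowerSeries (Fin N) K) := by
  have h : (((restrict K N).comp (SymFun K).val).comp (powerSumHom K)).comp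
      (MvPolynomial.rename (finToPNat N)) =
      ((MvPolynomial.coeToMvPowerSeries.algHom K).comp
        (MvPolynomial.symmetricSubalgebra (Fin N) K).val).comp (finPsum K N) := by
    apply MvPolynomial.algHom_ext
    intro i
    simp only [AlgHom.comp_apply, MvPolynomial.rename_X, powerSumHom, MvPolynomial.aeval_X,
      finPsum, Subalgebra.coe_val, restrict_powerSum, MvPolynomial.coeToMvPowerSeries.algHom_apply]
    simp [finToPNat]
  have := DFunLike.congr_fun h p
  simpa [AlgHom.comp_apply] using this

theorem powerSumHom_injective [CharZero K] : Function.Injective (powerSumHom K) := by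
  rw [injective_iff_map_eq_zero]
  intro f hf
  obtain ⟨N, hN⟩ : ∃ N : ℕ, ∀ k ∈ f.vars, (k : ℕ) ≤ N :=
    ⟨f.vars.sup (fun k => (k : ℕ)), fun k hk => Finset.le_sup (f := fun k : ℕ+ => (k : ℕ)) hk⟩
  have hinj : Function.Injective (finToPNat N) := by
    intro i j hij
    have := congrArg PNat.val hij
    simp only [finToPNat, PNat.mk_coe] at this
    exact Fin.ext (by omega)
  obtain ⟨g, rfl⟩ := MvPolynomial.exists_rename_eq_of_vars_subset_range f (finToPNat N) hinj (by
    intro k hk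
    have h1 := hN k hk
    have h2 := k.pos
    exact ⟨⟨(k : ℕ) - 1, by omega⟩, PNat.eq (by simp only [finToPNat, PNat.mk_coe]; omega)⟩)
  have h := restrict_powerSumHom N g
  rw [hf] at h
  have h0 : ((finPsum K N g : MvPolynomial (Fin N) K) : MvPowerSeries (Fin N) K) =
      ((0 : MvPolynomial (Fin N) K) : MvPowerSeries (Fin N) K) := by
    rw [← h]; simp
  have h1 : finPsum K N g = 0 := Subtype.ext (MvPolynomial.coe_injective _ _ h0)
  rw [(map_eq_zero_iff _ (finPsum_injective N)).mp h1, map_zero]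

/-- All monomials of `f` have degree `n`. -/
def IsHomog (f : MvPowerSeries ℕ K) (n : ℕ) : Prop :=
  ∀ d : ℕ →₀ ℕ, d.degree ≠ n → MvPowerSeries.coeff d f = 0

theorem IsHomog.mul {f g : MvPowerSeries ℕ K} {a b : ℕ} (hf : IsHomog f a) (hg : IsHomog g b) :
    IsHomog (f * g) (a + b) := by
  classical
  intro d hd
  rw [MvPowerSeries.coeff_mul]
  refine Finset.sum_eq_zero fun c hc => ?_
  rw [Finset.HasAntidiagonal.mem_antidiagonal] at hc
  rw [← hc, map_add] at hd
  by_cases h : c.1.degree = a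
  · rw [hg _ (by omega), mul_zero]
  · rw [hf _ h, zero_mul]

theorem isHomog_one : IsHomog (1 : MvPowerSeries ℕ K) 0 := by
  classical
  intro d hd
  rw [MvPowerSeries.coeff_one, if_neg]
  rintro rfl
  simp at hd

theorem isHomog_powerSum (k : ℕ+) : IsHomog (powerSum K k : MvPowerSeries ℕ K) k := by
  intro d hd
  refine if_neg ?_
  rintro ⟨i, rfl⟩
  simp at hd

theorem isHomog_pow {f : MvPowerSeries ℕ K} {a : ℕ} (hf : IsHomog f a) (m : ℕ) :
    IsHomog (f ^ m) (m * a) := by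
  induction m with
  | zero => simpa using isHomog_one
  | succ m ih => rw [pow_succ, Nat.succ_mul]; exact ih.mul hf

/-- The weight `∑ k, k * m_k` of a multiplicity function. -/
def weight (m : ℕ+ →₀ ℕ) : ℕ := m.sum fun k e => e * k

theorem isHomog_monomial (m : ℕ+ →₀ ℕ) (c : K) :
    IsHomog (powerSumHom K (MvPolynomial.monomial m c) : MvPowerSeries ℕ K) (weight m) := by
  have key : ∀ s : Finset ℕ+, IsHomog ((∏ k ∈ s, powerSum K k ^ m k : SymFun K) :
      MvPowerSeries ℕ K) (∑ k ∈ s, m k * k) := by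
    classical
    intro s
    induction s using Finset.induction_on with
    | empty => simpa using isHomog_one
    | insert k s hk ih =>
      rw [Finset.prod_insert hk, Finset.sum_insert hk]
      exact (isHomog_pow (isHomog_powerSum k) _).mul ih
  intro d hd
  rw [powerSumHom, MvPolynomial.aeval_monomial, ← Algebra.smul_def]
  change MvPowerSeries.coeff d (c • ((m.prod fun k e => powerSum K k ^ e : SymFun K) :
    MvPowerSeries ℕ K)) = 0
  rw [map_smul, Finsupp.prod, key m.support d hd, smul_zero]

/-- The part of weight at most `D` of a polynomial in the power sums. -/
def truncWeight (D : ℕ) (p : MvPolynomial ℕ+ K) : MvPolynomial ℕ+ K :=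
  ∑ m ∈ p.support.filter (fun m => weight m ≤ D), MvPolynomial.monomial m (p.coeff m)

theorem coeff_truncWeight_of_le (D : ℕ) (p : MvPolynomial ℕ+ K) (d : ℕ →₀ ℕ) (hd : d.degree ≤ D) :
    MvPowerSeries.coeff d (powerSumHom K (truncWeight D p) : MvPowerSeries ℕ K) =
      MvPowerSeries.coeff d (powerSumHom K p : MvPowerSeries ℕ K) := by
  conv_rhs => rw [MvPolynomial.as_sum p]
  rw [truncWeight, map_sum, map_sum, AddSubmonoidClass.coe_finsetSum,
    AddSubmonoidClass.coe_finsetSum, map_sum, map_sum]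
  refine Finset.sum_subset (Finset.filter_subset _ _) fun m hm hm2 => ?_
  refine isHomog_monomial m _ d ?_
  rw [Finset.mem_filter, not_and] at hm2
  have := hm2 hm
  omega

theorem coeff_truncWeight_of_lt (D : ℕ) (p : MvPolynomial ℕ+ K) (d : ℕ →₀ ℕ) (hd : D < d.degree) :
    MvPowerSeries.coeff d (powerSumHom K (truncWeight D p) : MvPowerSeries ℕ K) = 0 := by
  rw [truncWeight, map_sum, AddSubmonoidClass.coe_finsetSum, map_sum]
  refine Finset.sum_eq_zero fun m hm => isHomog_monomial m _ d ?_
  rw [Finset.mem_filter] at hm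
  omega

/-- A monomial of degree at most `D` can be moved into the first `D` variables. -/
theorem exists_perm_embDomain (D : ℕ) (d : ℕ →₀ ℕ) (hd : d.degree ≤ D) :
    ∃ (σ : Equiv.Perm ℕ) (c : Fin D →₀ ℕ),
      d.embDomain σ.toEmbedding = c.embDomain Fin.valEmbedding := by
  classical
  have hcard : d.support.card ≤ D := by
    refine le_trans ?_ hd
    rw [Finsupp.degree_apply, Finset.card_eq_sum_ones]
    exact Finset.sum_le_sum fun i hi => Nat.one_le_iff_ne_zero.mpr (Finsupp.mem_support_iff.mp hi)
  let x : Fin d.support.card ↪ ℕ :=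
    d.support.equivFin.symm.toEmbedding.trans (Function.Embedding.subtype _)
  have := Equiv.Perm.isMultiplyPretransitive ℕ d.support.card
  obtain ⟨σ, hσ⟩ := MulAction.exists_smul_eq (Equiv.Perm ℕ) x Fin.valEmbedding
  have hlt : ∀ i ∈ d.support, σ i < D := by
    intro i hi
    have h := DFunLike.congr_fun hσ (d.support.equivFin ⟨i, hi⟩)
    simp [x] at h
    omega
  refine ⟨σ, (d.embDomain σ.toEmbedding).comapDomain Fin.val
    Fin.val_injective.injOn, ?_⟩
  ext j
  by_cases hj : j < D
  · have := Finsupp.embDomain_apply_self Fin.valEmbedding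
      ((d.embDomain σ.toEmbedding).comapDomain Fin.val Fin.val_injective.injOn) ⟨j, hj⟩
    simp only [Fin.valEmbedding_apply] at this
    rw [this, Finsupp.comapDomain_apply]
  · rw [Finsupp.embDomain_of_notMem_range Fin.valEmbedding _ j (by simpa using hj)]
    obtain ⟨i, rfl⟩ := σ.surjective j
    have h := Finsupp.embDomain_apply_self σ.toEmbedding d i
    simp only [Equiv.coe_toEmbedding] at h
    rw [h]
    by_contra hne
    exact hj (hlt i (Finsupp.mem_support_iff.mpr hne))

/-- A permutation of the first `N` variables, extended to all variables. -/
theorem exists_extend_perm (N : ℕ) (τ : Equiv.Perm (Fin N)) :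
    ∃ σ : Equiv.Perm ℕ, ∀ i : Fin N, σ i = τ i := by
  classical
  refine ⟨τ.viaFintypeEmbedding Fin.valEmbedding, fun i => ?_⟩
  exact Equiv.Perm.viaFintypeEmbedding_apply_image τ Fin.valEmbedding i

theorem powerSumHom_surjective [CharZero K] : Function.Surjective (powerSumHom K) := by
  classical
  rintro ⟨f, hf⟩
  obtain ⟨D, hD⟩ := hf.1
  have hfin : (Function.support fun c : Fin D →₀ ℕ =>
      MvPowerSeries.coeff c (restrict K D f)).Finite := by
    refine (Finsupp.finite_of_degree_le D).subset fun c hc => ?_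
    rw [Function.mem_support, restrict, MvPowerSeries.coeff_killCompl] at hc
    by_contra hcon
    refine hc (hD _ ?_)
    rw [degree_embDomain]
    simpa using hcon
  let P : MvPolynomial (Fin D) K := AddMonoidAlgebra.ofCoeff (Finsupp.ofSupportFinite _ hfin)
  have hP : ∀ c : Fin D →₀ ℕ,
      P.coeff c = MvPowerSeries.coeff (c.embDomain Fin.valEmbedding) f := fun c => rfl
  have hsym : P.IsSymmetric := by
    intro τ
    obtain ⟨σ, hσ⟩ := exists_extend_perm D τ
    ext c
    have hc : c = Finsupp.mapDomain τ (Finsupp.mapDomain τ.symm c) := by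
      rw [← Finsupp.mapDomain_comp]; simp
    rw [hc, MvPolynomial.coeff_rename_mapDomain _ τ.injective, hP, hP,
      ← coeff_embDomain_of_mem hf σ]
    congr 2
    simp only [Finsupp.embDomain_eq_mapDomain, ← Finsupp.mapDomain_comp]
    congr 1
    ext i
    simp [hσ]
  obtain ⟨G, hG⟩ := finPsum_surjective D ⟨P, hsym⟩
  have hres := restrict_powerSumHom D G
  rw [hG] at hres
  refine ⟨truncWeight D (MvPolynomial.rename (finToPNat D) G), Subtype.ext ?_⟩
  ext d
  rcases lt_or_ge D d.degree with h | h
  · rw [coeff_truncWeight_of_lt _ _ _ h, hD _ h]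
  · rw [coeff_truncWeight_of_le _ _ _ h]
    obtain ⟨σ, c, hc⟩ := exists_perm_embDomain D d h
    rw [← coeff_embDomain_of_mem (SetLike.coe_mem _) σ d, ← coeff_embDomain_of_mem hf σ d, hc,
      ← hP]
    have := congrArg (MvPowerSeries.coeff c) hres
    rw [restrict, MvPowerSeries.coeff_killCompl, MvPolynomial.coeff_coe] at this
    exact this

end powerSumBasis

/-- In characteristic zero `Λ_K` is the polynomial ring in the power sums `p_1, p_2, …`. -/
def powerSumEquiv (K : Type*) [Field K] [CharZero K] : MvPolynomial ℕ+ K ≃ₐ[K] SymFun K :=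
  AlgEquiv.ofBijective (powerSumHom K) ⟨powerSumHom_injective, powerSumHom_surjective⟩

/-- The basis `p_λ` of `Λ_K`; the partition `λ = (1^{m_1} 2^{m_2} …)` is given by its
multiplicities `m`, so that `p_λ = ∏ k, p_k ^ m_k`. -/
def powerSumBasis (K : Type*) [Field K] [CharZero K] : Module.Basis (ℕ+ →₀ ℕ) K (SymFun K) :=
  (MvPolynomial.basisMonomials ℕ+ K).map (powerSumEquiv K).toLinearEquiv

theorem powerSumEquiv_X (K : Type*) [Field K] [CharZero K] (k : ℕ+) :
    powerSumEquiv K (MvPolynomial.X k) = powerSum K k :=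
  MvPolynomial.aeval_X _ _

theorem powerSumBasis_apply (K : Type*) [Field K] [CharZero K] (m : ℕ+ →₀ ℕ) :
    powerSumBasis K m = m.prod fun k e => powerSum K k ^ e := by
  change MvPolynomial.aeval (powerSum K) (MvPolynomial.monomial m (1 : K)) = _
  rw [MvPolynomial.aeval_monomial, map_one, one_mul]

/-! ### Macdonald polynomials -/

/-- The field `F = ℚ(q, t)`, as the field of rational functions in `t` over `ℚ(q)`. -/
abbrev QT : Type := RatFunc (RatFunc ℚ)

def q : QT := RatFunc.C RatFunc.X

def t : QT := RatFunc.X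

/-- `z_λ(q,t) = ∏_i m_i! i^{m_i} · ∏_j (1 - q^{λ_j}) / (1 - t^{λ_j})`
for `λ = (1^{m_1} 2^{m_2} …)`. -/
def zQT (m : ℕ+ →₀ ℕ) : QT :=
  m.prod fun i e =>
    (e.factorial : QT) * ((i : ℕ) : QT) ^ e * ((1 - q ^ (i : ℕ)) / (1 - t ^ (i : ℕ))) ^ e

/-- The inner product on `Λ_F` with `⟨p_λ, p_μ⟩_{q,t} = δ_{λμ} z_λ(q,t)`. -/
def innerQT (f g : SymFun QT) : QT :=
  ((powerSumBasis QT).repr f).sum fun m a => a * (powerSumBasis QT).repr g m * zQT m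

theorem innerQT_powerSumBasis (m m' : ℕ+ →₀ ℕ) :
    innerQT (powerSumBasis QT m) (powerSumBasis QT m') = if m = m' then zQT m else 0 := by
  classical
  rw [innerQT, Module.Basis.repr_self, Module.Basis.repr_self, Finsupp.sum_single_index (by simp),
    Finsupp.single_apply]
  by_cases h : m = m'
  · simp [h]
  · simp [h, Ne.symm h]

/-- The parts of a partition in weakly decreasing order. -/
def partsList {n : ℕ} (lam : n.Partition) : List ℕ := lam.parts.sort (· ≥ ·)

/-- The complete homogeneous symmetric function with integer index, `h_k = 0` for `k < 0`. -/
def completeInt (R : Type*) [CommRing R] (k : ℤ) : SymFun R :=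
  if 0 ≤ k then complete R k.toNat else 0

/-- The Schur function `s_λ = det (h_{λ_i - i + j})_{1 ≤ i, j ≤ ℓ(λ)}`. -/
def schur (R : Type*) [CommRing R] {n : ℕ} (lam : n.Partition) : SymFun R :=
  Matrix.det (Matrix.of fun i j : Fin (partsList lam).length =>
    completeInt R (((partsList lam).get i : ℤ) - (i : ℤ) + (j : ℤ)))

/-- The lexicographic order on the partitions of `n`; it is total and refines the dominance
order. -/
def lexLT {n : ℕ} (mu lam : n.Partition) : Prop := partsList mu < partsList lam

theorem lexLT_wf (n : ℕ) : WellFounded (lexLT (n := n)) := by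
  have : IsTrans n.Partition lexLT := ⟨fun a b c => lt_trans (a := partsList a)⟩
  have : Std.Irrefl (lexLT (n := n)) := ⟨fun a => lt_irrefl (partsList a)⟩
  exact Finite.wellFounded_of_trans_of_irrefl _

open Classical in
/-- The Macdonald polynomial `P_λ(x; q, t)`: the Gram–Schmidt orthogonalization of the Schur
functions with respect to `⟨·,·⟩_{q,t}`,
`P_λ = s_λ - ∑_{μ < λ} (⟨s_λ, P_μ⟩ / ⟨P_μ, P_μ⟩) P_μ`. -/
def macdonaldP {n : ℕ} (lam : n.Partition) : SymFun QT :=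
  schur QT lam - ∑ mu : {mu : n.Partition // lexLT mu lam},
    (innerQT (schur QT lam) (macdonaldP mu.1) / innerQT (macdonaldP mu.1) (macdonaldP mu.1)) •
      macdonaldP mu.1
termination_by (lexLT_wf n).wrap lam
decreasing_by all_goals exact mu.2

/-- `Q_λ = P_λ / ⟨P_λ, P_λ⟩_{q,t}`. -/
def macdonaldQ {n : ℕ} (lam : n.Partition) : SymFun QT :=
  (innerQT (macdonaldP lam) (macdonaldP lam))⁻¹ • macdonaldP lam

/-- The algebra endomorphism `f(x) ↦ f((1 - q) / (1 - t) x)` of `Λ_F`, which maps `p_k` to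
`(1 - q^k) / (1 - t^k) p_k`. -/
def primeHom : SymFun QT →ₐ[QT] SymFun QT :=
  (MvPolynomial.aeval fun k : ℕ+ =>
    ((1 - q ^ (k : ℕ)) / (1 - t ^ (k : ℕ)) : QT) • powerSum QT k).comp
      (powerSumEquiv QT).symm.toAlgHom

/-- `Q'_λ(x; q, t) = Q_λ((1 - q) / (1 - t) x; q, t)`. -/
def macdonaldQ' {n : ℕ} (lam : n.Partition) : SymFun QT := primeHom (macdonaldQ lam)

/-! ### Specialization at `t = ζ` -/

/-- The inclusion `ℚ(q) → ℂ(q)`. -/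
def scalarHom : RatFunc ℚ →+* RatFunc ℂ :=
  RatFunc.mapRingHom (Polynomial.mapRingHom (algebraMap ℚ ℂ))
    (nonZeroDivisors_le_comap_nonZeroDivisors_of_injective _
      (Polynomial.map_injective _ (algebraMap ℚ ℂ).injective))

/-- The coefficients of `f` have no pole at `t = ζ`: their reduced denominators do not vanish
there. -/
def RegularAt (ζ : ℂ) (f : SymFun QT) : Prop :=
  ∀ d : ℕ →₀ ℕ, Polynomial.eval₂ scalarHom (RatFunc.C ζ)
    (RatFunc.denom (MvPowerSeries.coeff d (f : MvPowerSeries ℕ QT))) ≠ 0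

/-- The specialization `f(x; q, ζ) ∈ Λ_{ℂ(q)}`, taken coefficient by coefficient
(meaningful when `RegularAt ζ f`). -/
def specialize (ζ : ℂ) (f : SymFun QT) : SymFun (RatFunc ℂ) :=
  ⟨fun d => RatFunc.eval scalarHom (RatFunc.C ζ)
    (MvPowerSeries.coeff d (f : MvPowerSeries ℕ QT)), by
    obtain ⟨D, hD⟩ := f.2.1
    refine mem_symFun D (fun d hd => ?_) (fun σ d => ?_)
    · change RatFunc.eval _ _ _ = 0
      rw [hD d hd, RatFunc.eval_zero]
    · change RatFunc.eval _ _ _ = RatFunc.eval _ _ _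
      rw [coeff_embDomain_of_mem f.2]⟩

/-! ### The partitions in the factorization formula -/

/-- The rectangular partition `(i^l)`, with `l` parts equal to `i`. -/
def rectangle (i l : ℕ) : Nat.Partition (Multiset.replicate l i).sum :=
  Nat.Partition.ofMultiset (Multiset.replicate l i)

/-- The partition `(1^{r_1} 2^{r_2} … n^{r_n})`, where `r_i` is the remainder modulo `l` of the
multiplicity `m_i` of `i` in `μ`. -/
def reduceMod (l : ℕ) {n : ℕ} (mu : n.Partition) :
    Nat.Partition (∑ i ∈ Finset.Icc 1 n, Multiset.replicate (mu.parts.count i % l) i).sum :=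
  Nat.Partition.ofMultiset
    (∑ i ∈ Finset.Icc 1 n, Multiset.replicate (mu.parts.count i % l) i)

end Macdonald

end

/-!
# Factorization of the functions `Q'_μ` at a root of unity

Symmetric functions are written as polynomials in the power sums (`PSumRing`), with the Hall inner
product `hallForm`. The substitution defining `Q'` turns `⟨·, ·⟩_{q,t}` into the Hall inner
product, so that the `Q'_μ` are the basis dual to the `P_λ` (`hallForm_macQ'_sum`). Identities
among the `Q'_μ` are thus dual to statements about the `P_λ`.

The `P_λ` are the joint eigenfunctions of Macdonald's operators `D_N(x; q, t)`, with eigenvalues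
`∏ i, (1 + x t ^ (N - 1 - i) q ^ λ_i)` (`macOp_macP`): in `N` variables `D_N` is the
`q`-difference operator `f ↦ V(a)⁻¹ ∑ I, x ^ |I| V(t^I a) f(q^I a)`, which is lexicographically
triangular (`lexBounded_macOp`), and it is self-adjoint for `⟨·, ·⟩_{q,t}` by a Cauchy determinant
(`psForm_macOp`). At `t = ζ` the eigenvalues for varying `x` still determine the partition, by
unique factorization in `x` and comparison of the degrees in `q`. Hence all denominators in the
projection of a Schur function to `P_λ` are regular at `t = ζ`, the `P_λ` specialize to a
unitriangular basis of eigenfunctions (`exists_map_eq_macP`, `macOp_macPSpec`), and the dual basis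
is regular as well (`exists_map_eq_macQ'`).

The root of unity enters as follows. Evaluate `D_{l+N}` at a point `(z, ζ z, …, ζ ^ (l-1) z, b)`.
If `I` contains some but not all coordinates of the string, two coordinates of `ζ^I a` coincide and
`V(ζ^I a) = 0`. The remaining terms show that the coefficient of `z ^ j` intertwines `D_{l+N}`
with `(1 - (-x) ^ l q ^ j) D_N` (`stringCoeff_macOp`). For `j = l i` the factor is
`∏ k < l, (1 + x ζ ^ k q ^ i)`, the contribution of `l` parts equal to `i` to an eigenvalue.
Therefore the coefficient of `z ^ (l i)` in `P_λ` is zero unless `λ` is the union of a partition `ν`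
and `(i^l)`, and is then a multiple of `P_ν`, where the factor `ζ ^ (i (0 + 1 + ⋯ + (l - 1)))` does
not depend on `ν` (`parts_eq_of_hallForm_ne_zero`, `hallForm_stringCoeff_macPSpec`).

Adjoining the string is the substitution `p_k ↦ p_k + l z ^ k` for `l ∣ k`, and its adjoint for the
Hall inner product is the multiplication by `exp (∑ l p_k z ^ k / k)`
(`hallForm_stringPoly_mul`). By duality, multiplication by the coefficient of `z ^ (l i)` in this
series maps `Q'_ν` to a constant multiple of `Q'_{ν ∪ (i^l)}`; the case of empty `ν` identifies
that coefficient with the same multiple of `Q'_{(i^l)}`. So `Q'_{ν ∪ (i^l)} = Q'_{(i^l)} Q'_ν` at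
`t = ζ` (`macQSpec_add_replicate`), and the factorization follows by splitting off `l` equal parts
repeatedly.
-/

noncomputable section

namespace Macdonald

open MvPolynomial

/-! ### Polynomials in the power sums -/

/-- The ring `R[p_1, p_2, …]`, in which the variable `X k` stands for the power sum `p_k`. -/
abbrev PSumRing (R : Type*) [CommRing R] : Type _ := MvPolynomial ℕ+ R

/-- The weight `∑ k, k * m_k` of an exponent vector, as an additive map. -/
def wt : (ℕ+ →₀ ℕ) →+ ℕ := Finsupp.weight fun k : ℕ+ => (k : ℕ)

/-- Homogeneity for the grading in which `p_k` has degree `k`. -/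
abbrev IsWt {R : Type*} [CommRing R] (f : PSumRing R) (n : ℕ) : Prop :=
  IsWeightedHomogeneous (fun k : ℕ+ => (k : ℕ)) f n

theorem wt_single (k : ℕ+) (e : ℕ) : wt (Finsupp.single k e) = e * k := by
  simp [wt, Finsupp.weight_single]

theorem wt_eq_sum (m : ℕ+ →₀ ℕ) : wt m = m.sum fun k e => e * k := rfl

theorem IsWt.coeff_eq_zero {R : Type*} [CommRing R] {f : PSumRing R} {n : ℕ} (hf : IsWt f n)
    {m : ℕ+ →₀ ℕ} (hm : wt m ≠ n) : coeff m f = 0 :=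
  IsWeightedHomogeneous.coeff_eq_zero hf m hm

theorem isWt_of_coeff {R : Type*} [CommRing R] {f : PSumRing R} {n : ℕ}
    (h : ∀ m, wt m ≠ n → coeff m f = 0) : IsWt f n := by
  intro m hm
  by_contra hcon
  exact hm (h m hcon)

theorem IsWt.smul {R : Type*} [CommRing R] {f : PSumRing R} {n : ℕ} (hf : IsWt f n) (c : R) :
    IsWt (c • f) n := by
  refine isWt_of_coeff fun m hm => ?_
  rw [coeff_smul, hf.coeff_eq_zero hm, smul_zero]

theorem IsWt.map {R S : Type*} [CommRing R] [CommRing S] {f : PSumRing R} {n : ℕ}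
    (hf : IsWt f n) (g : R →+* S) : IsWt (MvPolynomial.map g f) n := by
  refine isWt_of_coeff fun m hm => ?_
  rw [coeff_map, hf.coeff_eq_zero hm, map_zero]

theorem le_wt {m : ℕ+ →₀ ℕ} {k : ℕ+} (hk : m k ≠ 0) : m k * k ≤ wt m := by
  rw [wt_eq_sum, Finsupp.sum]
  exact Finset.single_le_sum (f := fun k : ℕ+ => m k * (k : ℕ)) (fun _ _ => Nat.zero_le _)
    (Finsupp.mem_support_iff.mpr hk)

theorem le_wt_of_ne_zero {m : ℕ+ →₀ ℕ} {k : ℕ+} (hk : m k ≠ 0) : (k : ℕ) ≤ wt m :=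
  le_trans (Nat.le_mul_of_pos_left _ (Nat.pos_of_ne_zero hk)) (le_wt hk)

theorem finite_wt_eq (n : ℕ) : {m : ℕ+ →₀ ℕ | wt m = n}.Finite := by
  refine Set.Finite.subset
    ((Finset.Icc (1 : ℕ+) n.succPNat).finsupp fun _ => Finset.range (n + 1)).finite_toSet
    fun m hm => ?_
  rw [Finset.mem_coe, Finset.mem_finsupp_iff]
  have hm : wt m = n := hm
  constructor
  · intro k hk
    have h := le_wt_of_ne_zero (Finsupp.mem_support_iff.mp hk)
    rw [Finset.mem_Icc]
    refine ⟨one_le, ?_⟩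
    rw [← PNat.coe_le_coe, Nat.succPNat_coe]
    omega
  · intro k _
    rw [Finset.mem_range]
    by_cases hk : m k = 0
    · omega
    · have h := le_wt hk
      have h2 := Nat.le_mul_of_pos_right (m k) k.pos
      omega

/-- The exponent vectors of weight `n`, i.e. the partitions of `n` given by multiplicities. -/
def wtFinset (n : ℕ) : Finset (ℕ+ →₀ ℕ) := (finite_wt_eq n).toFinset

@[simp] theorem mem_wtFinset {n : ℕ} {m : ℕ+ →₀ ℕ} : m ∈ wtFinset n ↔ wt m = n := by
  simp [wtFinset]

theorem IsWt.as_sum {R : Type*} [CommRing R] {f : PSumRing R} {n : ℕ} (hf : IsWt f n) :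
    f = ∑ m ∈ wtFinset n, monomial m (coeff m f) := by
  ext m
  rw [coeff_sum]
  simp only [coeff_monomial]
  rw [Finset.sum_ite_eq']
  split_ifs with h
  · rfl
  · exact hf.coeff_eq_zero (by simpa using h)

/-! ### The exponential series `exp (∑ k, u_k p_k s^k / k)` -/

/-- `1 / z_m`, where `z_m = ∏ k, m_k! k ^ m_k`. -/
def zInv (m : ℕ+ →₀ ℕ) : ℚ := m.prod fun k e => ((e.factorial : ℚ) * (k : ℚ) ^ e)⁻¹

theorem zInv_ne_zero (m : ℕ+ →₀ ℕ) : zInv m ≠ 0 := by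
  refine Finset.prod_ne_zero_iff.mpr fun k _ => inv_ne_zero (mul_ne_zero ?_ (pow_ne_zero _ ?_))
  · exact_mod_cast Nat.factorial_ne_zero _
  · exact_mod_cast k.ne_zero

theorem prod_add_single {M : Type*} [CommMonoid M] (m : ℕ+ →₀ ℕ) (k : ℕ+) (f : ℕ+ → ℕ → M)
    (hf : ∀ k, f k 0 = 1) (c : M) (hc : f k (m k + 1) * c = f k (m k)) :
    (m + Finsupp.single k 1).prod f * c = m.prod f := by
  classical
  have h1 : (m + Finsupp.single k 1).support ⊆ insert k m.support := by
    refine Finsupp.support_add.trans (Finset.union_subset (Finset.subset_insert _ _) ?_)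
    refine Finsupp.support_single_subset.trans ?_
    simp
  rw [Finsupp.prod_of_support_subset _ h1 _ fun i _ => hf i,
    Finsupp.prod_of_support_subset m (Finset.subset_insert k m.support) _ fun i _ => hf i,
    ← Finset.mul_prod_erase _ _ (Finset.mem_insert_self k _),
    ← Finset.mul_prod_erase _ _ (Finset.mem_insert_self k _), mul_right_comm]
  congr 1
  · simpa using hc
  · refine Finset.prod_congr rfl fun j hj => ?_
    rw [Finsupp.add_apply, Finsupp.single_eq_of_ne (Finset.ne_of_mem_erase hj), add_zero]

theorem zInv_add_single (m : ℕ+ →₀ ℕ) (k : ℕ+) :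
    zInv (m + Finsupp.single k 1) * ((k : ℚ) * (m k + 1)) = zInv m := by
  refine prod_add_single m k (fun k e => ((e.factorial : ℚ) * (k : ℚ) ^ e)⁻¹) (by simp) _ ?_
  have h1 : ((m k).factorial : ℚ) ≠ 0 := by exact_mod_cast Nat.factorial_ne_zero _
  have h2 : (k : ℚ) ≠ 0 := by exact_mod_cast k.ne_zero
  have h3 : (m k + 1 : ℚ) ≠ 0 := by positivity
  simp only [Nat.factorial_succ]
  push_cast
  field_simp
  rw [pow_succ']

section expPoly

variable {R : Type*} [CommRing R] [Algebra ℚ R]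

/-- `∏ k, u_k ^ m_k / z_m`. -/
def expCoeff (u : ℕ+ → R) (m : ℕ+ →₀ ℕ) : R :=
  algebraMap ℚ R (zInv m) * m.prod fun k e => u k ^ e

/-- The coefficient of `s ^ n` in `exp (∑ k, u_k p_k s ^ k / k)`. -/
def expPoly (u : ℕ+ → R) (n : ℕ) : PSumRing R := ∑ m ∈ wtFinset n, monomial m (expCoeff u m)

theorem coeff_expPoly (u : ℕ+ → R) (n : ℕ) (m : ℕ+ →₀ ℕ) :
    coeff m (expPoly u n) = if wt m = n then expCoeff u m else 0 := by
  rw [expPoly, coeff_sum]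
  simp only [coeff_monomial]
  rw [Finset.sum_ite_eq']
  simp

theorem isWt_expPoly (u : ℕ+ → R) (n : ℕ) : IsWt (expPoly u n) n :=
  isWt_of_coeff fun m hm => by rw [coeff_expPoly, if_neg hm]

theorem expCoeff_add_single (u : ℕ+ → R) (m : ℕ+ →₀ ℕ) (k : ℕ+) :
    expCoeff u (m + Finsupp.single k 1) * ((k : ℕ) * ((m k : ℕ) + 1)) = expCoeff u m * u k := by
  have h1 : ((m + Finsupp.single k 1).prod fun k e => u k ^ e) =
      (m.prod fun k e => u k ^ e) * u k := by
    rw [Finsupp.prod_add_index' (by simp) (fun _ _ _ => pow_add _ _ _)]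
    simp
  have h2 := congrArg (algebraMap ℚ R) (zInv_add_single m k)
  rw [map_mul] at h2
  have h3 : algebraMap ℚ R ((k : ℚ) * (m k + 1)) = (((k : ℕ) : R) * ((m k : ℕ) + 1)) := by
    simp
  rw [h3] at h2
  rw [expCoeff, expCoeff, h1, ← h2]
  ring

theorem expPoly_zero (u : ℕ+ → R) : expPoly u 0 = 1 := by
  ext m
  rw [coeff_expPoly, coeff_one]
  by_cases h : m = 0
  · subst h
    simp [expCoeff, zInv]
  · rw [if_neg (Ne.symm h), if_neg]
    intro h0
    obtain ⟨k, hk⟩ := Finsupp.ne_iff.mp h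
    have := le_wt_of_ne_zero hk
    have := k.pos
    omega

/-- `k ∂/∂p_k` acts on the exponential series as multiplication by `u_k s ^ k`. -/
theorem pderiv_expPoly (u : ℕ+ → R) (n : ℕ) (k : ℕ+) :
    ((k : ℕ) : R) • pderiv k (expPoly u (n + k)) = u k • expPoly u n := by
  ext m
  rw [coeff_smul, coeff_smul, coeff_pderiv, coeff_expPoly, coeff_expPoly, map_add, wt_single,
    one_mul]
  by_cases h : wt m = n
  · rw [if_pos (by omega), if_pos h, smul_eq_mul, smul_eq_mul, mul_comm (u k),
      ← expCoeff_add_single]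
    ring
  · rw [if_neg (by omega), if_neg h]
    simp

theorem pderiv_expPoly_of_lt (u : ℕ+ → R) (n : ℕ) (k : ℕ+) (h : n < k) :
    pderiv k (expPoly u n) = 0 := by
  ext m
  rw [coeff_pderiv, coeff_expPoly, map_add, wt_single, if_neg (by omega), zero_mul, coeff_zero]

/-- Euler's identity for the grading by weight. -/
theorem IsWt.euler {T : Type*} [CommRing T] {f : PSumRing T} {n : ℕ} (hf : IsWt f (n + 1)) :
    ((n + 1 : ℕ) : T) • f = ∑ k ∈ Finset.range (n + 1),
      ((k + 1 : ℕ) : T) • (X k.succPNat * pderiv k.succPNat f) := by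
  ext m
  rw [coeff_smul, coeff_sum]
  have key : ∀ k : ℕ, coeff m (((k + 1 : ℕ) : T) • (X k.succPNat * pderiv k.succPNat f)) =
      (((k + 1) * m k.succPNat : ℕ) : T) * coeff m f := by
    intro k
    rw [coeff_smul, coeff_X_mul']
    split_ifs with hk
    · have hk : m k.succPNat ≠ 0 := Finsupp.mem_support_iff.mp hk
      have hle : Finsupp.single k.succPNat 1 ≤ m := by
        rw [Finsupp.single_le_iff]
        omega
      rw [coeff_pderiv, tsub_add_cancel_of_le hle, Finsupp.tsub_apply, Finsupp.single_eq_same,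
        smul_eq_mul]
      have : ((m k.succPNat - 1 : ℕ) : T) + 1 = (m k.succPNat : ℕ) := by
        rw [← Nat.cast_succ]
        congr 1
        omega
      rw [this]
      push_cast
      ring
    · rw [Finsupp.notMem_support_iff.mp hk]
      simp
  rw [Finset.sum_congr rfl fun k _ => key k, ← Finset.sum_mul, ← Nat.cast_sum, smul_eq_mul]
  by_cases h : wt m = n + 1
  · have hs : wt m = ∑ k ∈ Finset.range (n + 1), (k + 1) * m k.succPNat := ?_
    · rw [← hs, h]
    rw [wt_eq_sum, Finsupp.sum]
    refine Finset.sum_bij_ne_zero (fun k _ _ => (k : ℕ) - 1) ?_ ?_ ?_ ?_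
    · intro k hk _
      have := le_wt_of_ne_zero (Finsupp.mem_support_iff.mp hk)
      have := k.pos
      rw [Finset.mem_range]
      omega
    · intro a _ _ b _ _ hab
      have := a.pos
      have := b.pos
      exact PNat.eq (by omega)
    · intro b _ hb
      refine ⟨b.succPNat, ?_, ?_, ?_⟩
      · rw [Finsupp.mem_support_iff]
        rintro h0
        simp [h0] at hb
      · rw [Nat.succPNat_coe, Nat.succ_eq_add_one, mul_comm]
        exact hb
      · simp
    · intro k _ _
      have := k.pos
      have h2 : ((k : ℕ) - 1).succPNat = k := PNat.eq (by rw [Nat.succPNat_coe]; omega)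
      rw [h2, mul_comm]
      congr 1
      omega
  · rw [hf.coeff_eq_zero h]
    simp

/-- The Newton-type recursion for the exponential series. -/
theorem smul_expPoly_succ (u : ℕ+ → R) (n : ℕ) :
    ((n + 1 : ℕ) : R) • expPoly u (n + 1) =
      ∑ k ∈ Finset.range (n + 1), u k.succPNat • (X k.succPNat * expPoly u (n - k)) := by
  rw [(isWt_expPoly u (n + 1)).euler]
  refine Finset.sum_congr rfl fun k hk => ?_
  rw [Finset.mem_range] at hk
  have h := pderiv_expPoly u (n - k) k.succPNat
  rw [show n - k + (k.succPNat : ℕ) = n + 1 by rw [Nat.succPNat_coe]; omega,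
    Nat.succPNat_coe] at h
  rw [← mul_smul_comm, ← mul_smul_comm, ← h]

end expPoly

section powerSeries

variable {S : Type*} [CommRing S]

/-- A power series is determined by its constant coefficient and its logarithmic derivative. -/
theorem powerSeries_eq_of_logDeriv [Algebra ℚ S] {A B C : PowerSeries S}
    (hA : PowerSeries.derivative S A = A * C)
    (hB : PowerSeries.derivative S B = B * C)
    (h0 : PowerSeries.constantCoeff A = PowerSeries.constantCoeff B) : A = B := by
  ext n
  induction n using Nat.strong_induction_on with
  | _ n ih =>
    cases n with
    | zero => simpa using h0
    | succ n =>
      have hA' := congrArg (PowerSeries.coeff n) hA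
      have hB' := congrArg (PowerSeries.coeff n) hB
      rw [PowerSeries.coeff_derivative, PowerSeries.coeff_mul] at hA' hB'
      have h : PowerSeries.coeff (n + 1) A * ((n : S) + 1) =
          PowerSeries.coeff (n + 1) B * ((n : S) + 1) := by
        rw [hA', hB']
        refine Finset.sum_congr rfl fun a ha => ?_
        rw [Finset.HasAntidiagonal.mem_antidiagonal] at ha
        rw [ih a.1 (by omega)]
      have hu : IsUnit ((n : S) + 1) := by
        have : ((n : S) + 1) = algebraMap ℚ S ((n : ℚ) + 1) := by simp
        rw [this]
        exact (IsUnit.mk0 _ (by positivity)).map _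
      exact hu.mul_left_injective h

variable {R : Type*} [CommRing R] [Algebra ℚ R] [Algebra R S]

/-- The generating series of the values of the exponential polynomials at a point. -/
def expSeries (φ : PSumRing R →ₐ[R] S) (u : ℕ+ → R) : PowerSeries S :=
  PowerSeries.mk fun n => φ (expPoly u n)

theorem constantCoeff_expSeries (φ : PSumRing R →ₐ[R] S) (u : ℕ+ → R) :
    PowerSeries.constantCoeff (expSeries φ u) = 1 := by
  rw [← PowerSeries.coeff_zero_eq_constantCoeff_apply, expSeries, PowerSeries.coeff_mk,
    expPoly_zero, map_one]

theorem derivative_expSeries (φ : PSumRing R →ₐ[R] S) (u : ℕ+ → R) :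
    PowerSeries.derivative S (expSeries φ u) = expSeries φ u *
      PowerSeries.mk fun k => u k.succPNat • φ (X k.succPNat) := by
  ext n
  rw [PowerSeries.coeff_derivative, PowerSeries.coeff_mul, expSeries, PowerSeries.coeff_mk]
  have h := congrArg φ (smul_expPoly_succ u n)
  rw [map_smul, map_sum] at h
  rw [Finset.Nat.sum_antidiagonal_eq_sum_range_succ_mk, ← Finset.sum_range_reflect]
  have h2 : φ (expPoly u (n + 1)) * ((n : S) + 1) = ((n + 1 : ℕ) : R) • φ (expPoly u (n + 1)) := by
    rw [Algebra.smul_def]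
    simp [mul_comm]
  rw [h2, h]
  refine Finset.sum_congr rfl fun k hk => ?_
  rw [Finset.mem_range] at hk
  rw [PowerSeries.coeff_mk, PowerSeries.coeff_mk, map_smul, map_mul,
    show n + 1 - 1 - k = n - k by omega, show n - (n - k) = k by omega, mul_smul_comm, mul_comm]

/-- The factor `1 - c s` has logarithmic derivative `-∑ k, c ^ (k + 1) s ^ k`. -/
theorem derivative_one_sub_mul (c : S) :
    PowerSeries.derivative S (1 - PowerSeries.C c * PowerSeries.X) =
      (1 - PowerSeries.C c * PowerSeries.X) * PowerSeries.mk fun k => -c ^ (k + 1) := by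
  have h : (1 - PowerSeries.C c * PowerSeries.X) * PowerSeries.mk (fun k => -c ^ (k + 1)) =
      - PowerSeries.C c := by
    ext n
    rw [sub_mul, one_mul, mul_assoc, map_sub, PowerSeries.coeff_mk, PowerSeries.coeff_C_mul]
    cases n with
    | zero => simp
    | succ n =>
      rw [PowerSeries.coeff_succ_X_mul, PowerSeries.coeff_mk]
      simp
      ring
  rw [h, map_sub, Derivation.leibniz, PowerSeries.derivative_C, PowerSeries.derivative_X,
    PowerSeries.derivative_one]
  simp

theorem derivative_mul_of_logDeriv {A B C D : PowerSeries S}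
    (hA : PowerSeries.derivative S A = A * C)
    (hB : PowerSeries.derivative S B = B * D) :
    PowerSeries.derivative S (A * B) = A * B * (C + D) := by
  rw [Derivation.leibniz, hA, hB, smul_eq_mul, smul_eq_mul]
  ring

theorem derivative_prod_of_logDeriv {ι : Type*} (s : Finset ι) (A C : ι → PowerSeries S)
    (hA : ∀ i ∈ s, PowerSeries.derivative S (A i) = A i * C i) :
    PowerSeries.derivative S (∏ i ∈ s, A i) = (∏ i ∈ s, A i) * ∑ i ∈ s, C i := by
  classical
  induction s using Finset.induction_on with
  | empty => simp
  | insert i s hi ih =>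
    rw [Finset.prod_insert hi, Finset.sum_insert hi]
    exact derivative_mul_of_logDeriv (hA i (Finset.mem_insert_self i s))
      (ih fun j hj => hA j (Finset.mem_insert_of_mem hj))

end powerSeries

/-! ### Alternants and the Jacobi–Trudi identity -/

section eval

variable {R S : Type*} [CommRing R] [CommRing S] [Algebra R S] {N : ℕ}

/-- The value of a polynomial in the power sums at the point `a`, i.e. at
`x_0 = a_0, …, x_{N-1} = a_{N-1}` and `x_i = 0` for `i ≥ N`. -/
def evalAt (a : Fin N → S) : PSumRing R →ₐ[R] S := aeval fun k => ∑ i, a i ^ (k : ℕ)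

@[simp] theorem evalAt_X (a : Fin N → S) (k : ℕ+) :
    evalAt (R := R) a (X k) = ∑ i, a i ^ (k : ℕ) := aeval_X _ _

/-- The complete homogeneous symmetric function `h_n` as a polynomial in the power sums. -/
def hPoly (R : Type*) [CommRing R] [Algebra ℚ R] (n : ℕ) : PSumRing R := expPoly (fun _ => 1) n

/-- `h_k` for an integer `k`, with `h_k = 0` for `k < 0`. -/
def hPolyInt (R : Type*) [CommRing R] [Algebra ℚ R] (k : ℤ) : PSumRing R :=
  if 0 ≤ k then hPoly R k.toNat else 0

/-- The Schur function `det (h_{α_i - i + j})` attached to an arbitrary vector `α`. -/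
def schurPoly (R : Type*) [CommRing R] [Algebra ℚ R] (α : Fin N → ℕ) : PSumRing R :=
  Matrix.det (Matrix.of fun i j : Fin N => hPolyInt R ((α i : ℤ) - (i : ℤ) + (j : ℤ)))

/-- The alternant `det (a_k ^ β_i)`. -/
def alternant (a : Fin N → S) (β : Fin N → ℕ) : S :=
  Matrix.det (Matrix.of fun i k : Fin N => a k ^ β i)

/-- The exponent vector `δ = (N - 1, N - 2, …, 0)`. -/
def staircase (N : ℕ) : Fin N → ℕ := fun i => N - 1 - i

/-- The Vandermonde determinant `det (a_k ^ (N - 1 - i))`. -/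
def vandermondeDet (a : Fin N → S) : S := alternant a (staircase N)

/-- `H(s) ∏ (1 - a_i s) = 1`, where `H` is the generating series of the `h_n`. -/
theorem expSeries_one_mul_prod [Algebra ℚ R] [Algebra ℚ S] (a : Fin N → S) :
    expSeries (evalAt (R := R) a) (fun _ => 1) *
      ∏ i, (1 - PowerSeries.C (a i) * PowerSeries.X) = 1 := by
  have h1 := derivative_mul_of_logDeriv
    (derivative_expSeries (evalAt (R := R) a) (fun _ => 1))
    (derivative_prod_of_logDeriv Finset.univ
      (fun i => 1 - PowerSeries.C (a i) * PowerSeries.X)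
      (fun i => PowerSeries.mk fun k => -a i ^ (k + 1))
      (fun i _ => derivative_one_sub_mul (a i)))
  have h2 : (PowerSeries.mk fun k : ℕ => (1 : R) • evalAt (R := R) a (X k.succPNat)) +
      ∑ i, (PowerSeries.mk fun k => -a i ^ (k + 1)) = 0 := by
    ext k
    rw [map_add, map_sum]
    simp
  rw [h2, mul_zero] at h1
  refine powerSeries_eq_of_logDeriv (C := 0) ?_ ?_ ?_
  · rw [h1, mul_zero]
  · simp
  · rw [map_mul, constantCoeff_expSeries, map_prod]
    simp

/-- The polynomial `∏_{r ≠ k} (1 - b_r u)` in `u`. -/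
def puncturedProd (b : Fin N → S) (k : Fin N) : Polynomial S :=
  ∏ r ∈ Finset.univ.erase k, (1 - Polynomial.C (b r) * Polynomial.X)

theorem coeff_puncturedProd_of_le (b : Fin N → S) (k : Fin N) {n : ℕ} (h : N ≤ n) :
    (puncturedProd b k).coeff n = 0 := by
  refine Polynomial.coeff_eq_zero_of_natDegree_lt (lt_of_le_of_lt
    (Polynomial.natDegree_prod_le _ _) ?_)
  have h1 : ∑ r ∈ Finset.univ.erase k,
      (1 - Polynomial.C (b r) * Polynomial.X : Polynomial S).natDegree ≤
        ∑ r ∈ Finset.univ.erase k, 1 := by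
    refine Finset.sum_le_sum fun r _ => ?_
    refine (Polynomial.natDegree_sub_le _ _).trans ?_
    refine max_le (by simp) ?_
    exact (Polynomial.natDegree_C_mul_le _ _).trans Polynomial.natDegree_X_le
  have h2 := k.pos
  simp at h1
  omega

/-- The matrix of coefficients of the polynomials `∏_{r ≠ k} (1 - b_r u)`, in decreasing order. -/
def puncturedMatrix (b : Fin N → S) : Matrix (Fin N) (Fin N) S :=
  Matrix.of fun j k => (puncturedProd b k).coeff (N - 1 - j)

theorem sum_fin_rev_eq_sum_range (f : ℕ → S) :
    ∑ j : Fin N, f (N - 1 - j) = ∑ r ∈ Finset.range N, f r := by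
  rw [← Finset.sum_range_reflect]
  exact (Finset.sum_range fun i => f (N - 1 - i)).symm

/-- Cancelling all factors but one of `H(s) = ∏ (1 - b_r s)⁻¹` leaves a geometric series. -/
theorem expSeries_one_mul_puncturedProd [Algebra ℚ R] [Algebra ℚ S] (b : Fin N → S)
    (k : Fin N) : expSeries (evalAt (R := R) b) (fun _ => 1) * (puncturedProd b k : PowerSeries S) =
      PowerSeries.mk fun n => b k ^ n := by
  have h1 : (puncturedProd b k : PowerSeries S) * (1 - PowerSeries.C (b k) * PowerSeries.X) =
      ∏ i, (1 - PowerSeries.C (b i) * PowerSeries.X) := by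
    rw [puncturedProd, ← Finset.prod_erase_mul _ _ (Finset.mem_univ k)]
    congr 1
    rw [← Polynomial.coeToPowerSeries.ringHom_apply, map_prod]
    simp
  have h2 : (1 - PowerSeries.C (b k) * PowerSeries.X) * PowerSeries.mk (fun n => b k ^ n) = 1 := by
    ext n
    rw [sub_mul, one_mul, mul_assoc, map_sub, PowerSeries.coeff_mk, PowerSeries.coeff_C_mul]
    cases n with
    | zero => simp
    | succ n =>
      rw [PowerSeries.coeff_succ_X_mul, PowerSeries.coeff_mk, PowerSeries.coeff_one]
      simp [pow_succ']
  rw [← mul_one (_ * _), ← h2, ← mul_assoc, mul_assoc (expSeries _ _), h1,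
    expSeries_one_mul_prod, one_mul]

/-- The Jacobi–Trudi matrix, times a matrix depending only on the point, is an alternant: its
entries are the coefficients of geometric series. -/
theorem jacobiTrudi_matrix [Algebra ℚ R] [Algebra ℚ S] (b : Fin N → S) (α : Fin N → ℕ) :
    (Matrix.of fun i j : Fin N => evalAt b (hPolyInt R ((α i : ℤ) - (i : ℤ) + (j : ℤ)))) *
      puncturedMatrix b = Matrix.of fun i k => b k ^ (α i + staircase N i) := by
  ext i k
  rw [Matrix.mul_apply]
  have h := congrArg (PowerSeries.coeff (α i + staircase N i))
    (expSeries_one_mul_puncturedProd (R := R) b k)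
  rw [PowerSeries.coeff_mk, PowerSeries.coeff_mul] at h
  rw [Matrix.of_apply, ← h, ← Finset.Nat.sum_antidiagonal_swap,
    Finset.Nat.sum_antidiagonal_eq_sum_range_succ_mk]
  set n := α i + staircase N i with hn
  have h1 : ∀ j : Fin N, evalAt b (hPolyInt R ((α i : ℤ) - (i : ℤ) + (j : ℤ))) *
      (puncturedProd b k).coeff (N - 1 - j) =
        (fun r : ℕ => evalAt b (hPolyInt R ((n : ℤ) - r)) * (puncturedProd b k).coeff r)
          (N - 1 - j) := by
    intro j
    simp only
    congr 3
    have := i.2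
    have := j.2
    have hs : staircase N i = N - 1 - i := rfl
    omega
  simp only [Matrix.of_apply, puncturedMatrix]
  rw [Finset.sum_congr rfl fun j _ => h1 j,
    sum_fin_rev_eq_sum_range (fun r : ℕ => evalAt b (hPolyInt R ((n : ℤ) - r)) *
      (puncturedProd b k).coeff r)]
  have h2 : ∀ r ∈ Finset.range (n + 1), (PowerSeries.coeff (r, n - r).swap.1)
        (expSeries (evalAt (R := R) b) fun _ => 1) *
      (PowerSeries.coeff (r, n - r).swap.2) (puncturedProd b k : PowerSeries S) =
        evalAt b (hPolyInt R ((n : ℤ) - r)) * (puncturedProd b k).coeff r := by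
    intro r hr
    rw [Finset.mem_range] at hr
    rw [Prod.swap_prod_mk, Polynomial.coeff_coe, expSeries, PowerSeries.coeff_mk, hPolyInt,
      if_pos (by omega), hPoly]
    congr 4
    omega
  rw [Finset.sum_congr rfl h2]
  rcases le_total N (n + 1) with hle | hle
  · refine Finset.sum_subset (Finset.range_mono hle) fun r _ hr => ?_
    rw [coeff_puncturedProd_of_le b k (by simpa using hr), mul_zero]
  · refine (Finset.sum_subset (Finset.range_mono hle) fun r _ hr => ?_).symm
    rw [Finset.mem_range] at hr
    rw [hPolyInt, if_neg (by omega), map_zero, zero_mul]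

theorem evalAt_schurPoly [Algebra ℚ R] (b : Fin N → S) (α : Fin N → ℕ) :
    evalAt b (schurPoly R α) =
      (Matrix.of fun i j : Fin N => evalAt b (hPolyInt R ((α i : ℤ) - (i : ℤ) + (j : ℤ)))).det := by
  rw [schurPoly, AlgHom.map_det]
  rfl

/-- The case `α = 0` of `jacobiTrudi_matrix`, where the Jacobi–Trudi matrix is unitriangular. -/
theorem det_puncturedMatrix [Algebra ℚ S] (b : Fin N → S) :
    (puncturedMatrix b).det = vandermondeDet b := by
  have h := congrArg Matrix.det (jacobiTrudi_matrix (R := S) b (fun _ => 0))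
  rw [Matrix.det_mul, Matrix.det_of_isUpperTriangular] at h
  · have h1 : ∀ i : Fin N, evalAt b (hPolyInt S (((0 : ℕ) : ℤ) - (i : ℤ) + (i : ℤ))) = 1 := by
      intro i
      rw [hPolyInt, if_pos (by simp)]
      simp [hPoly, expPoly_zero]
    simp only [Matrix.of_apply, h1, Finset.prod_const_one, one_mul] at h
    rw [h]
    simp [vandermondeDet, alternant]
  · intro i j hij
    have hij : j < i := hij
    rw [Matrix.of_apply, hPolyInt, if_neg, map_zero]
    have : (j : ℕ) < i := hij
    push_cast
    omega

/-- The bialternant formula for Schur functions. -/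
theorem vandermondeDet_mul_evalAt_schurPoly [Algebra ℚ R] [Algebra ℚ S] (b : Fin N → S)
    (α : Fin N → ℕ) : vandermondeDet b * evalAt b (schurPoly R α) =
      alternant b fun i => α i + staircase N i := by
  rw [evalAt_schurPoly, ← det_puncturedMatrix, mul_comm, ← Matrix.det_mul, jacobiTrudi_matrix]
  rfl

theorem eval_puncturedProd (b : Fin N → S) (k : Fin N) (c : S) :
    (puncturedProd b k).eval c = ∏ r ∈ Finset.univ.erase k, (1 - c * b r) := by
  rw [puncturedProd, Polynomial.eval_prod]
  refine Finset.prod_congr rfl fun r _ => ?_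
  rw [Polynomial.eval_sub, Polynomial.eval_one, Polynomial.eval_mul, Polynomial.eval_C,
    Polynomial.eval_X, mul_comm]

/-- A denominator-free form of Cauchy's determinant. -/
theorem det_puncturedProd [Algebra ℚ S] (a b : Fin N → S) :
    (Matrix.of fun i k : Fin N => ∏ r ∈ Finset.univ.erase k, (1 - a i * b r)).det =
      vandermondeDet a * vandermondeDet b := by
  have h : (Matrix.of fun i j : Fin N => a j ^ staircase N i).transpose * puncturedMatrix b =
      Matrix.of fun i k : Fin N => ∏ r ∈ Finset.univ.erase k, (1 - a i * b r) := by
    ext i k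
    rw [Matrix.mul_apply, Matrix.of_apply, ← eval_puncturedProd,
      Polynomial.eval_eq_sum_range' (n := N), ← sum_fin_rev_eq_sum_range]
    · refine Finset.sum_congr rfl fun j _ => ?_
      simp [puncturedMatrix, staircase, mul_comm]
    · by_contra hcon
      refine absurd (coeff_puncturedProd_of_le b k (not_lt.mp hcon)) ?_
      rw [Polynomial.coeff_natDegree, ← ne_eq, Polynomial.leadingCoeff_ne_zero]
      intro h0
      rw [h0, Polynomial.natDegree_zero] at hcon
      exact hcon k.pos
  rw [← h, Matrix.det_mul, Matrix.det_transpose, det_puncturedMatrix]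
  rfl

end eval

/-! ### Macdonald's difference operator -/

section operator

variable {R : Type*} [CommRing R] {N : ℕ}

/-- Restriction of a symmetric function to the variables `x_0, …, x_{N-1}`. -/
def toFin (R : Type*) [CommRing R] (N : ℕ) : PSumRing R →ₐ[R] MvPolynomial (Fin N) R :=
  evalAt fun i => X i

theorem eval_toFin (a : Fin N → R) (f : PSumRing R) : eval a (toFin R N f) = evalAt a f := by
  have h : (aeval a).comp (toFin R N) = evalAt (R := R) (S := R) a := by
    apply MvPolynomial.algHom_ext
    intro k
    simp [toFin]
  have h2 := DFunLike.congr_fun h f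
  rw [← h2, AlgHom.comp_apply, aeval_eq_eval]

theorem toFin_isSymmetric (f : PSumRing R) : (toFin R N f).IsSymmetric := by
  intro e
  have h : (rename (R := R) e).comp (toFin R N) = toFin R N := by
    apply MvPolynomial.algHom_ext
    intro k
    simp only [toFin, AlgHom.comp_apply, evalAt_X, map_sum, map_pow, rename_X]
    exact Equiv.sum_comp e fun i => (X i : MvPolynomial (Fin N) R) ^ (k : ℕ)
  exact DFunLike.congr_fun h f

theorem coeff_toFin_equivMapDomain (f : PSumRing R) (e : Equiv.Perm (Fin N)) (α : Fin N →₀ ℕ) :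
    coeff (α.equivMapDomain e) (toFin R N f) = coeff α (toFin R N f) := by
  conv_lhs => rw [← toFin_isSymmetric f e]
  rw [Finsupp.equivMapDomain_eq_mapDomain, coeff_rename_mapDomain _ e.injective]

/-- The eigenvalue `∏ i, (1 + x t ^ (N - 1 - i) q ^ α_i)`. -/
def macEig (q t x : R) (α : Fin N → ℕ) : R := ∏ i, (1 + x * t ^ staircase N i * q ^ α i)

/-- Macdonald's operator `D_N(x; q, t)`, lifted to symmetric functions: it maps a symmetric
function with monomial expansion `∑ α, c_α x ^ α` in `N` variables to
`∑ α, c_α ∏ i, (1 + x t ^ (N - 1 - i) q ^ α_i) s_α`. -/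
def macOp [Algebra ℚ R] (N : ℕ) (q t x : R) : PSumRing R →ₗ[R] PSumRing R :=
  ((basisMonomials (Fin N) R).constr R fun α => macEig q t x α • schurPoly R α) ∘ₗ
    (toFin R N).toLinearMap

variable [Algebra ℚ R]

theorem macOp_apply (q t x : R) (f : PSumRing R) :
    macOp N q t x f = ∑ α ∈ (toFin R N f).support,
      coeff α (toFin R N f) • macEig q t x α • schurPoly R α := by
  rw [macOp, LinearMap.comp_apply, AlgHom.toLinearMap_apply]
  conv_lhs => rw [MvPolynomial.as_sum (toFin R N f)]
  rw [map_sum]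
  refine Finset.sum_congr rfl fun α _ => ?_
  have h : monomial α (coeff α (toFin R N f)) =
      coeff α (toFin R N f) • basisMonomials (Fin N) R α := by
    simp [smul_monomial]
  rw [h, map_smul, Module.Basis.constr_basis]

theorem vandermondeDet_mul_evalAt_macOp_eq_sum {S : Type*} [CommRing S] [Algebra R S]
    [Algebra ℚ S] (a : Fin N → S) (q t x : R) (f : PSumRing R) :
    vandermondeDet a * evalAt a (macOp N q t x f) = ∑ α ∈ (toFin R N f).support,
      (coeff α (toFin R N f) * macEig q t x α) • alternant a fun i => α i + staircase N i := by
  rw [macOp_apply, map_sum, Finset.mul_sum]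
  refine Finset.sum_congr rfl fun α _ => ?_
  rw [map_smul, map_smul, mul_smul_comm, mul_smul_comm, vandermondeDet_mul_evalAt_schurPoly,
    mul_smul]

/-- The point obtained from `a` by multiplying the coordinates in `I` by `c`. -/
def scaleOn (I : Finset (Fin N)) (c : R) (a : Fin N → R) : Fin N → R :=
  fun i => if i ∈ I then c * a i else a i

omit [Algebra ℚ R] in
theorem alternant_eq_sum (a : Fin N → R) (β : Fin N → ℕ) :
    alternant a β = ∑ σ : Equiv.Perm (Fin N), (Equiv.Perm.sign σ : ℤ) * ∏ k, a k ^ β (σ k) := by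
  rw [alternant, Matrix.det_apply']
  rfl

/-- Macdonald's operator as a `q`-difference operator:
`V(a) (D f)(a) = ∑ I, x ^ |I| V(t^I a) f(q^I a)`, with `V` the Vandermonde determinant. -/
theorem vandermondeDet_mul_evalAt_macOp (a : Fin N → R) (q t x : R) (f : PSumRing R) :
    vandermondeDet a * evalAt a (macOp N q t x f) = ∑ I : Finset (Fin N),
      x ^ I.card * (vandermondeDet (scaleOn I t a) * evalAt (scaleOn I q a) f) := by
  classical
  rw [vandermondeDet_mul_evalAt_macOp_eq_sum]
  set P := toFin R N f with hP
  let T : Equiv.Perm (Fin N) → (Fin N → ℕ) → R := fun σ α =>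
    ∏ k, (a k ^ (staircase N (σ k) + α k) +
      x * t ^ staircase N (σ k) * q ^ α k * a k ^ (staircase N (σ k) + α k))
  have hL : ∀ α : Fin N →₀ ℕ, (coeff α P * macEig q t x α) •
      (alternant a fun i => α i + staircase N i) =
        ∑ σ : Equiv.Perm (Fin N), (Equiv.Perm.sign σ : ℤ) * (coeff α P * T σ fun k => α (σ k)) := by
    intro α
    rw [alternant_eq_sum, smul_eq_mul, Finset.mul_sum]
    refine Finset.sum_congr rfl fun σ _ => ?_
    rw [macEig, ← Equiv.prod_comp σ, mul_left_comm]
    congr 1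
    rw [mul_assoc, ← Finset.prod_mul_distrib]
    congr 1
    refine Finset.prod_congr rfl fun k _ => ?_
    rw [add_comm (α (σ k))]
    ring
  have hI : ∀ I : Finset (Fin N),
      x ^ I.card * (vandermondeDet (scaleOn I t a) * evalAt (scaleOn I q a) f) =
        ∑ σ : Equiv.Perm (Fin N), (Equiv.Perm.sign σ : ℤ) * ∑ α ∈ P.support, coeff α P *
          ((∏ k ∈ Finset.univ \ I, a k ^ (staircase N (σ k) + α k)) *
          ∏ k ∈ I, (x * t ^ staircase N (σ k) * q ^ α k * a k ^ (staircase N (σ k) + α k))) := by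
    intro I
    rw [← eval_toFin, ← hP, eval_eq', vandermondeDet, alternant_eq_sum, Finset.sum_mul,
      Finset.mul_sum]
    refine Finset.sum_congr rfl fun σ _ => ?_
    rw [mul_assoc, mul_left_comm, Finset.mul_sum, Finset.mul_sum]
    congr 1
    refine Finset.sum_congr rfl fun α _ => ?_
    rw [mul_left_comm (∏ k, _), mul_left_comm (x ^ I.card)]
    congr 1
    rw [← Finset.prod_mul_distrib, ← Finset.prod_sdiff (Finset.subset_univ I), mul_left_comm,
      ← Finset.prod_const, ← Finset.prod_mul_distrib]
    congr 1
    · refine Finset.prod_congr rfl fun k hk => ?_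
      rw [Finset.mem_sdiff] at hk
      rw [scaleOn, if_neg hk.2, scaleOn, if_neg hk.2, pow_add]
    · refine Finset.prod_congr rfl fun k hk => ?_
      rw [scaleOn, if_pos hk, scaleOn, if_pos hk, pow_add]
      ring
  rw [Finset.sum_congr rfl fun α _ => hL α, Finset.sum_congr rfl fun I _ => hI I,
    Finset.sum_comm, Finset.sum_comm (s := Finset.univ (α := Finset (Fin N)))]
  refine Finset.sum_congr rfl fun σ _ => ?_
  rw [← Finset.mul_sum, ← Finset.mul_sum, Finset.sum_comm]
  congr 1
  have hT : ∀ α : Fin N →₀ ℕ, ∑ I : Finset (Fin N), coeff α P *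
      ((∏ k ∈ Finset.univ \ I, a k ^ (staircase N (σ k) + α k)) *
        ∏ k ∈ I, (x * t ^ staircase N (σ k) * q ^ α k * a k ^ (staircase N (σ k) + α k))) =
      coeff α P * T σ α := by
    intro α
    rw [← Finset.mul_sum]
    congr 1
    simp only [T]
    rw [Finset.prod_congr rfl fun k _ => add_comm (a k ^ (staircase N (σ k) + α k)) _,
      Finset.prod_add, Finset.powerset_univ]
    exact Finset.sum_congr rfl fun I _ => mul_comm _ _
  rw [Finset.sum_congr rfl fun α _ => hT α]
  -- the coefficients are symmetric, so the monomials may be permuted by `σ`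
  refine Finset.sum_equiv (Finsupp.equivCongrLeft σ.symm) ?_ ?_
  · intro α
    rw [mem_support_iff, mem_support_iff, Finsupp.equivCongrLeft_apply, hP,
      coeff_toFin_equivMapDomain]
  · intro α _
    rw [Finsupp.equivCongrLeft_apply, hP, coeff_toFin_equivMapDomain]
    congr 2

end operator

section naturality

variable {R S : Type*} [CommRing R] [CommRing S] (g : R →+* S) {N : ℕ}

theorem toFin_map (f : PSumRing R) : toFin S N (map g f) = map g (toFin R N f) := by
  induction f using MvPolynomial.induction_on with
  | C r => simp [toFin, evalAt]
  | add a b ha hb => simp only [map_add, ha, hb]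
  | mul_X a k ha =>
    rw [map_mul, map_mul, map_mul, map_mul, ha, map_X]
    congr 1
    simp [toFin]

variable [Algebra ℚ R] [Algebra ℚ S]

theorem map_expPoly (u : ℕ+ → R) (n : ℕ) :
    map g (expPoly u n) = expPoly (fun k => g (u k)) n := by
  ext m
  rw [coeff_map, coeff_expPoly, coeff_expPoly]
  split_ifs with h
  · rw [expCoeff, expCoeff, map_mul, RingHom.map_rat_algebraMap, Finsupp.prod, map_prod,
      Finsupp.prod]
    simp only [map_pow]
  · exact map_zero g

theorem map_hPolyInt (k : ℤ) : map g (hPolyInt R k) = hPolyInt S k := by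
  rw [hPolyInt, hPolyInt]
  split_ifs
  · rw [hPoly, map_expPoly, hPoly, map_one]
  · exact map_zero _

theorem map_schurPoly (α : Fin N → ℕ) : map g (schurPoly R α) = schurPoly S α := by
  rw [schurPoly, schurPoly, RingHom.map_det]
  congr 1
  ext i j
  simp [map_hPolyInt]

omit [Algebra ℚ R] [Algebra ℚ S] in
theorem map_macEig (q t x : R) (α : Fin N → ℕ) :
    g (macEig q t x α) = macEig (g q) (g t) (g x) α := by
  simp [macEig]

theorem map_macOp (q t x : R) (f : PSumRing R) :
    map g (macOp N q t x f) = macOp N (g q) (g t) (g x) (map g f) := by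
  rw [macOp_apply, macOp_apply, toFin_map, map_sum]
  have h : ∀ α, map g (coeff α (toFin R N f) • macEig q t x α • schurPoly R α) =
      coeff α (map g (toFin R N f)) • macEig (g q) (g t) (g x) α • schurPoly S α := by
    intro α
    rw [smul_eq_C_mul, smul_eq_C_mul, smul_eq_C_mul, smul_eq_C_mul, map_mul, map_mul, map_C, map_C,
      map_schurPoly, map_macEig, coeff_map]
  rw [Finset.sum_congr rfl fun α _ => h α]
  refine (Finset.sum_subset (support_map_subset _ _) fun α _ hα => ?_).symm
  rw [notMem_support_iff.mp hα, zero_smul]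

end naturality

section homogeneous

variable {R : Type*} [CommRing R] [Algebra ℚ R] {N : ℕ}

theorem isWt_schurPoly (α : Fin N → ℕ) : IsWt (schurPoly R α) (∑ i, α i) := by
  rw [schurPoly, Matrix.det_apply]
  refine IsWeightedHomogeneous.sum _ _ _ fun σ _ => ?_
  have h : IsWt (∏ i, Matrix.of (fun i j : Fin N =>
      hPolyInt R ((α i : ℤ) - (i : ℤ) + (j : ℤ))) (σ i) i) (∑ i, α i) := by
    by_cases hneg : ∃ i, ((α (σ i) : ℤ) - ((σ i : Fin N) : ℤ) + (i : ℤ)) < 0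
    · obtain ⟨i, hi⟩ := hneg
      rw [Finset.prod_eq_zero (Finset.mem_univ i)]
      · exact isWeightedHomogeneous_zero _ _ _
      · rw [Matrix.of_apply, hPolyInt, if_neg (by omega)]
    · push Not at hneg
      have hsum : ∑ i, α i = ∑ i, ((α (σ i) : ℤ) - ((σ i : Fin N) : ℤ) + (i : ℤ)).toNat := by
        zify
        rw [Finset.sum_congr rfl fun i _ => Int.toNat_of_nonneg (hneg i), Finset.sum_add_distrib,
          Finset.sum_sub_distrib, Equiv.sum_comp σ (fun i => (α i : ℤ)),
          Equiv.sum_comp σ (fun i => ((i : Fin N) : ℤ))]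
        ring
      rw [hsum]
      refine IsWeightedHomogeneous.prod _ _ _ fun i _ => ?_
      rw [Matrix.of_apply, hPolyInt, if_pos (hneg i)]
      exact isWt_expPoly _ _
  rcases Int.units_eq_one_or (Equiv.Perm.sign σ) with h1 | h1
  · rwa [h1, one_smul]
  · rw [h1, Units.neg_smul, one_smul]
    exact h.neg

omit [Algebra ℚ R] in
/-- Restriction to finitely many variables turns the weight into the degree. -/
theorem IsWt.coeff_toFin {f : PSumRing R} {n : ℕ} (hf : IsWt f n) {α : Fin N →₀ ℕ}
    (hα : coeff α (toFin R N f) ≠ 0) : ∑ i, α i = n := by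
  have key : (toFin R N f).IsHomogeneous n := by
    rw [MvPolynomial.as_sum f, map_sum]
    refine IsHomogeneous.sum _ _ _ fun m hm => ?_
    have hm : wt m = n := hf (mem_support_iff.mp hm)
    rw [toFin, evalAt, aeval_monomial, ← hm, wt_eq_sum, algebraMap_eq]
    have h1 : (m.prod fun k e => (∑ i : Fin N, (X i : MvPolynomial (Fin N) R) ^ (k : ℕ)) ^ e :
        MvPolynomial (Fin N) R).IsHomogeneous (m.sum fun k e => e * (k : ℕ)) := by
      refine IsHomogeneous.prod _ _ _ fun k _ => ?_
      simp only
      rw [mul_comm]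
      refine IsHomogeneous.pow (IsHomogeneous.sum _ _ _ fun i _ => ?_) _
      exact isHomogeneous_X_pow i _
    simpa using (isHomogeneous_C (Fin N) _).mul h1
  have h := key hα
  rw [← h, Finsupp.weight_apply, Finsupp.sum_fintype _ _ (by simp)]
  simp

theorem isWt_macOp {f : PSumRing R} {n : ℕ} (hf : IsWt f n) (q t x : R) :
    IsWt (macOp N q t x f) n := by
  rw [macOp_apply]
  refine IsWeightedHomogeneous.sum _ _ _ fun α hα => ?_
  rw [← hf.coeff_toFin (mem_support_iff.mp hα)]
  exact ((isWt_schurPoly _).smul _).smul _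

end homogeneous

section injectivity

variable {K : Type*} [Field K] [CharZero K] {N : ℕ}

/-- A symmetric function of degree `n ≤ N` is determined by its restriction to `N` variables. -/
theorem IsWt.eq_zero_of_toFin {f : PSumRing K} {n : ℕ} (hf : IsWt f n) (hn : n ≤ N)
    (h : toFin K N f = 0) : f = 0 := by
  have hinj : Function.Injective (finToPNat N) := by
    intro i j hij
    have := congrArg PNat.val hij
    simp only [finToPNat, PNat.mk_coe] at this
    exact Fin.ext (by omega)
  obtain ⟨g, rfl⟩ := exists_rename_eq_of_vars_subset_range f (finToPNat N) hinj (by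
    intro k hk
    obtain ⟨m, hm, hkm⟩ := (mem_vars_iff_mem_support k).mp hk
    have h1 : (k : ℕ) ≤ wt m := le_wt_of_ne_zero (Finsupp.mem_support_iff.mp hkm)
    have h2 : wt m = n := hf (mem_support_iff.mp hm)
    have h3 := k.pos
    exact ⟨⟨(k : ℕ) - 1, by omega⟩, PNat.eq (by simp only [finToPNat, PNat.mk_coe]; omega)⟩)
  have h2 : toFin K N (rename (finToPNat N) g) =
      (finPsum K N g : MvPolynomial (Fin N) K) := by
    rw [finPsum_apply, toFin, evalAt, aeval_rename]
    rfl
  rw [h2] at h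
  have h3 : finPsum K N g = 0 := Subtype.ext h
  rw [(map_eq_zero_iff _ (finPsum_injective N)).mp h3, map_zero]

/-- A symmetric function of degree `n ≤ N` vanishes if it vanishes at all points with `N` distinct
coordinates. -/
theorem IsWt.eq_zero_of_evalAt {f : PSumRing K} {n : ℕ} (hf : IsWt f n) (hn : n ≤ N)
    (h : ∀ a : Fin N → K, Function.Injective a → evalAt a f = 0) : f = 0 := by
  refine hf.eq_zero_of_toFin hn ?_
  have h1 : toFin K N f * ∏ i, ∏ j, (if i = j then 1 else (X i - X j : MvPolynomial (Fin N) K)) =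
      0 := by
    refine MvPolynomial.funext fun a => ?_
    rw [map_mul, map_zero, eval_toFin]
    by_cases ha : Function.Injective a
    · rw [h a ha, zero_mul]
    · obtain ⟨i, j, hij, hne⟩ := Function.not_injective_iff.mp ha
      rw [map_prod, Finset.prod_eq_zero (Finset.mem_univ i), mul_zero]
      rw [map_prod, Finset.prod_eq_zero (Finset.mem_univ j)]
      simp [hne, hij]
  rcases mul_eq_zero.mp h1 with h2 | h2
  · exact h2
  · exfalso
    rw [Finset.prod_eq_zero_iff] at h2
    obtain ⟨i, _, h3⟩ := h2
    rw [Finset.prod_eq_zero_iff] at h3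
    obtain ⟨j, _, h4⟩ := h3
    split_ifs at h4 with hij
    · exact one_ne_zero h4
    · exact hij (X_injective (sub_eq_zero.mp h4))

end injectivity

/-! ### The Vandermonde determinant -/

section vandermonde

variable {R : Type*} [CommRing R] {N : ℕ}

theorem vandermondeDet_eq_prod (a : Fin N → R) :
    vandermondeDet a = ∏ i, ∏ j, if i < j then a i - a j else 1 := by
  have h1 : vandermondeDet a =
      ((Matrix.vandermonde (a ∘ Fin.revPerm)).submatrix Fin.revPerm Fin.revPerm).det := by
    rw [vandermondeDet, alternant, ← Matrix.det_transpose]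
    congr 1
    ext i k
    have : N - (k + 1) = N - 1 - k := by omega
    simp [Matrix.vandermonde_apply, staircase, Fin.val_rev, this]
  have h2 : ∀ i : Fin N, ∏ j ∈ Finset.Ioi (Fin.revPerm i),
      ((a ∘ Fin.revPerm) j - (a ∘ Fin.revPerm) (Fin.revPerm i)) =
        ∏ j, if j < i then a j - a i else 1 := by
    intro i
    rw [← Finset.prod_filter]
    refine Finset.prod_equiv Fin.revPerm (fun j => ?_) fun j _ => ?_
    · simp only [Finset.mem_Ioi, Finset.mem_filter, Finset.mem_univ, true_and,
        Fin.revPerm_apply]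
      exact Fin.rev_lt_iff
    · simp
  rw [h1, Matrix.det_submatrix_equiv_self, Matrix.det_vandermonde, ← Equiv.prod_comp Fin.revPerm,
    Finset.prod_congr rfl fun i _ => h2 i, Finset.prod_comm]

theorem vandermondeDet_ne_zero {K : Type*} [Field K] {a : Fin N → K} (ha : Function.Injective a) :
    vandermondeDet a ≠ 0 := by
  rw [vandermondeDet_eq_prod]
  refine Finset.prod_ne_zero_iff.mpr fun i _ => Finset.prod_ne_zero_iff.mpr fun j _ => ?_
  split_ifs with h
  · exact sub_ne_zero.mpr fun h2 => h.ne (ha h2)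
  · exact one_ne_zero

theorem vandermondeDet_eq_zero {a : Fin N → R} {i j : Fin N} (hij : i ≠ j) (h : a i = a j) :
    vandermondeDet a = 0 := by
  rw [vandermondeDet, alternant]
  refine Matrix.det_zero_of_column_eq hij fun k => ?_
  simp [h]

theorem map_vandermondeDet {S : Type*} [CommRing S] (g : R →+* S) (a : Fin N → R) :
    g (vandermondeDet a) = vandermondeDet fun i => g (a i) := by
  rw [vandermondeDet_eq_prod, vandermondeDet_eq_prod, map_prod]
  refine Finset.prod_congr rfl fun i _ => ?_
  rw [map_prod]
  refine Finset.prod_congr rfl fun j _ => ?_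
  split_ifs <;> simp

theorem vandermondeDet_mul (a : Fin N → R) (c : R) :
    (vandermondeDet fun i => a i * c) =
      vandermondeDet a * ∏ i : Fin N, ∏ j : Fin N, if i < j then c else 1 := by
  rw [vandermondeDet_eq_prod, vandermondeDet_eq_prod, ← Finset.prod_mul_distrib]
  refine Finset.prod_congr rfl fun i _ => ?_
  rw [← Finset.prod_mul_distrib]
  refine Finset.prod_congr rfl fun j _ => ?_
  split_ifs <;> ring

end vandermonde

/-! ### Self-adjointness of Macdonald's operator -/

section kernel

variable {K : Type*} [Field K] [Algebra ℚ K] {N : ℕ}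

/-- Expanding the determinant `det (1 / (1 - a_i b_k) + x / (1 - t a_i b_k))` by rows. -/
theorem prod_mul_det_cauchy (a b : Fin N → K) (t x : K) (hc : ∀ i j, 1 - a i * b j ≠ 0)
    (hd : ∀ i j, 1 - t * a i * b j ≠ 0) :
    (∏ i, ∏ j, (1 - a i * b j)) * (Matrix.of fun i k : Fin N =>
        (1 - a i * b k)⁻¹ + x * (1 - t * a i * b k)⁻¹).det =
      ∑ I : Finset (Fin N), x ^ I.card * (vandermondeDet (scaleOn I t a) * vandermondeDet b) *
        ∏ i ∈ I, ∏ j, ((1 - a i * b j) / (1 - t * a i * b j)) := by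
  classical
  have h1 : (Matrix.of fun i k : Fin N =>
        (1 - a i * b k)⁻¹ + x * (1 - t * a i * b k)⁻¹).det =
      ∑ I : Finset (Fin N), (Matrix.of (I.piecewise
        (fun i k : Fin N => x * (1 - t * a i * b k)⁻¹)
        (fun i k : Fin N => (1 - a i * b k)⁻¹))).det := by
    have := (Matrix.detRowAlternating (R := K) (n := Fin N)).toMultilinearMap.map_add_univ
      (fun i k : Fin N => x * (1 - t * a i * b k)⁻¹) (fun i k : Fin N => (1 - a i * b k)⁻¹)
    rw [add_comm] at this
    exact this
  rw [h1, Finset.mul_sum]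
  refine Finset.sum_congr rfl fun I _ => ?_
  have hne : ∀ i j, 1 - scaleOn I t a i * b j ≠ 0 := by
    intro i j
    rw [scaleOn]
    split_ifs
    · exact hd i j
    · exact hc i j
  have h2 : Matrix.of (I.piecewise
        (fun i k : Fin N => x * (1 - t * a i * b k)⁻¹)
        (fun i k : Fin N => (1 - a i * b k)⁻¹)) =
      Matrix.of fun i k => ((if i ∈ I then x else 1) * (∏ r, (1 - scaleOn I t a i * b r))⁻¹) *
        (Matrix.of fun i k : Fin N =>
          ∏ r ∈ Finset.univ.erase k, (1 - scaleOn I t a i * b r)) i k := by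
    ext i k
    have h3 : (∏ r, (1 - scaleOn I t a i * b r))⁻¹ *
        ∏ r ∈ Finset.univ.erase k, (1 - scaleOn I t a i * b r) =
          (1 - scaleOn I t a i * b k)⁻¹ := by
      rw [← Finset.mul_prod_erase _ _ (Finset.mem_univ k), mul_inv, mul_assoc, inv_mul_cancel₀,
        mul_one]
      exact Finset.prod_ne_zero_iff.mpr fun r _ => hne i r
    rw [Matrix.of_apply, Matrix.of_apply, Matrix.of_apply, mul_assoc, h3, scaleOn]
    by_cases hi : i ∈ I
    · rw [Finset.piecewise_eq_of_mem _ _ _ hi, if_pos hi, if_pos hi]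
    · rw [Finset.piecewise_eq_of_notMem _ _ _ hi, if_neg hi, if_neg hi, one_mul]
  rw [h2, Matrix.det_mul_column, det_puncturedProd, Finset.prod_mul_distrib, Finset.prod_ite_mem,
    Finset.univ_inter, Finset.prod_const]
  have h4 : (∏ i, ∏ j, (1 - a i * b j)) * ∏ i, (∏ r, (1 - scaleOn I t a i * b r))⁻¹ =
      ∏ i ∈ I, ∏ j, ((1 - a i * b j) / (1 - t * a i * b j)) := by
    rw [← Finset.prod_mul_distrib, ← Finset.prod_subset (Finset.subset_univ I)]
    · refine Finset.prod_congr rfl fun i hi => ?_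
      rw [Finset.prod_div_distrib, div_eq_mul_inv, scaleOn, if_pos hi]
    · intro i _ hi
      rw [scaleOn, if_neg hi, mul_inv_cancel₀]
      exact Finset.prod_ne_zero_iff.mpr fun r _ => hc i r
  rw [← h4]
  ring

/-- `(1 - t ^ k) / (1 - q ^ k)`. -/
def macRatio (q t : K) (k : ℕ+) : K := (1 - t ^ (k : ℕ)) / (1 - q ^ (k : ℕ))

/-- The reproducing kernel in degree `n`: the degree `n` part of
`∏ i j, (t x_i b_j; q)_∞ / (x_i b_j; q)_∞`. -/
def macKernel (q t : K) (b : Fin N → K) (n : ℕ) : PSumRing K :=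
  expPoly (fun k => macRatio q t k * ∑ j, b j ^ (k : ℕ)) n

theorem evalAt_macKernel (q t : K) (a b : Fin N → K) (n : ℕ) :
    evalAt a (macKernel q t b n) = ∑ m ∈ wtFinset n, algebraMap ℚ K (zInv m) *
      m.prod fun k e => (macRatio q t k * ((∑ j, a j ^ (k : ℕ)) * ∑ j, b j ^ (k : ℕ))) ^ e := by
  rw [macKernel, expPoly, map_sum]
  refine Finset.sum_congr rfl fun m _ => ?_
  rw [evalAt, aeval_monomial, expCoeff, Algebra.algebraMap_self, RingHom.id_apply, mul_assoc,
    ← Finsupp.prod_mul]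
  congr 1
  refine Finset.prod_congr rfl fun k _ => ?_
  simp only
  rw [← mul_pow]
  congr 1
  ring

theorem evalAt_macKernel_comm (q t : K) (a b : Fin N → K) (n : ℕ) :
    evalAt a (macKernel q t b n) = evalAt b (macKernel q t a n) := by
  rw [evalAt_macKernel, evalAt_macKernel]
  simp only [mul_comm (∑ j, a j ^ _)]

/-- The effect of `a_i ↦ q a_i`, `i ∈ I`, on the kernel. -/
theorem expSeries_scaleOn {q t : K} (hq : ∀ k : ℕ, 0 < k → q ^ k ≠ 1) (a b : Fin N → K)
    (I : Finset (Fin N)) :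
    expSeries (evalAt (R := K) (scaleOn I q a)) (fun k => macRatio q t k * ∑ j, b j ^ (k : ℕ)) *
        ∏ i ∈ I, ∏ j, (1 - PowerSeries.C (t * a i * b j) * PowerSeries.X) =
      expSeries (evalAt (R := K) a) (fun k => macRatio q t k * ∑ j, b j ^ (k : ℕ)) *
        ∏ i ∈ I, ∏ j, (1 - PowerSeries.C (a i * b j) * PowerSeries.X) := by
  have hl : ∀ c : Fin N → Fin N → K, PowerSeries.derivative K
      (∏ i ∈ I, ∏ j, (1 - PowerSeries.C (c i j) * PowerSeries.X)) =
        (∏ i ∈ I, ∏ j, (1 - PowerSeries.C (c i j) * PowerSeries.X)) *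
          ∑ i ∈ I, ∑ j, PowerSeries.mk fun k => -(c i j) ^ (k + 1) := by
    intro c
    refine derivative_prod_of_logDeriv _ _ _ fun i _ => ?_
    exact derivative_prod_of_logDeriv _ _ _ fun j _ => derivative_one_sub_mul _
  refine powerSeries_eq_of_logDeriv
    (derivative_mul_of_logDeriv (derivative_expSeries _ _) (hl fun i j => t * a i * b j)) ?_ ?_
  · rw [derivative_mul_of_logDeriv (derivative_expSeries _ _) (hl fun i j => a i * b j)]
    congr 1
    ext n
    have hps : ∀ c : Fin N → Fin N → K, PowerSeries.coeff n
        (∑ i ∈ I, ∑ j, PowerSeries.mk fun k => -(c i j) ^ (k + 1)) =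
          - ∑ i ∈ I, ∑ j, c i j ^ (n + 1) := by
      intro c
      simp
    rw [map_add, map_add, hps, hps, PowerSeries.coeff_mk, PowerSeries.coeff_mk, evalAt_X, evalAt_X]
    have h1 : ∑ i, scaleOn I q a i ^ (n + 1) =
        ∑ i, a i ^ (n + 1) + (q ^ (n + 1) - 1) * ∑ i ∈ I, a i ^ (n + 1) := by
      rw [← Finset.sum_sdiff (Finset.subset_univ I),
        ← Finset.sum_sdiff (f := fun i => a i ^ (n + 1)) (Finset.subset_univ I),
        Finset.mul_sum, add_assoc, ← Finset.sum_add_distrib]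
      congr 1
      · refine Finset.sum_congr rfl fun i hi => ?_
        rw [scaleOn, if_neg (Finset.mem_sdiff.mp hi).2]
      · refine Finset.sum_congr rfl fun i hi => ?_
        rw [scaleOn, if_pos hi]
        ring
    have h2 : ∑ i ∈ I, ∑ j, (a i * b j) ^ (n + 1) =
        (∑ i ∈ I, a i ^ (n + 1)) * ∑ j, b j ^ (n + 1) := by
      rw [Finset.sum_mul_sum]
      simp only [mul_pow]
    have h3 : ∑ i ∈ I, ∑ j, (t * a i * b j) ^ (n + 1) =
        t ^ (n + 1) * ((∑ i ∈ I, a i ^ (n + 1)) * ∑ j, b j ^ (n + 1)) := by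
      rw [← h2, Finset.mul_sum]
      refine Finset.sum_congr rfl fun i _ => ?_
      rw [Finset.mul_sum]
      refine Finset.sum_congr rfl fun j _ => ?_
      ring
    have h4 : macRatio q t n.succPNat * (q ^ (n + 1) - 1) = t ^ (n + 1) - 1 := by
      have := sub_ne_zero.mpr (hq (n + 1) n.succ_pos).symm
      rw [macRatio, Nat.succPNat_coe, Nat.succ_eq_add_one]
      field_simp
      ring
    rw [Nat.succPNat_coe, Nat.succ_eq_add_one, h1, h2, h3, smul_eq_mul, smul_eq_mul]
    linear_combination (-(∑ i ∈ I, a i ^ (n + 1)) * ∑ j, b j ^ (n + 1)) * h4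
  · simp [constantCoeff_expSeries]

/-- The generating series of the values of Macdonald's operator on the exponential polynomials. -/
theorem coeff_sum_expSeries (a : Fin N → K) (q t x : K) (u : ℕ+ → K) (n : ℕ) :
    PowerSeries.coeff n (∑ I : Finset (Fin N),
      PowerSeries.C (x ^ I.card * vandermondeDet (scaleOn I t a)) *
        expSeries (evalAt (R := K) (scaleOn I q a)) u) =
      vandermondeDet a * evalAt a (macOp N q t x (expPoly u n)) := by
  rw [vandermondeDet_mul_evalAt_macOp, map_sum]
  refine Finset.sum_congr rfl fun I _ => ?_
  rw [PowerSeries.coeff_C_mul, expSeries, PowerSeries.coeff_mk, mul_assoc]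

/-- Applying Macdonald's operator to the kernel, in either set of variables, gives the product of
the kernel with a determinant that is symmetric in the two sets of variables. -/
theorem sum_expSeries_eq_det {q t : K} (hq : ∀ k : ℕ, 0 < k → q ^ k ≠ 1) (x : K)
    (a b : Fin N → K) {W : Type*} [Field W] [Algebra ℚ W] (e : PowerSeries K →+* W)
    (he : Function.Injective e) :
    e (PowerSeries.C (vandermondeDet b) * ∑ I : Finset (Fin N),
      PowerSeries.C (x ^ I.card * vandermondeDet (scaleOn I t a)) *
        expSeries (evalAt (R := K) (scaleOn I q a))
          (fun k => macRatio q t k * ∑ j, b j ^ (k : ℕ))) *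
      (∏ i : Fin N, ∏ j : Fin N, if i < j then e PowerSeries.X else 1) =
    e (expSeries (evalAt (R := K) a) fun k => macRatio q t k * ∑ j, b j ^ (k : ℕ)) *
      ((∏ i, ∏ j, e (1 - PowerSeries.C (a i * b j) * PowerSeries.X)) *
        (Matrix.of fun i k : Fin N => (e (1 - PowerSeries.C (a i * b k) * PowerSeries.X))⁻¹ +
          e (PowerSeries.C x) *
            (e (1 - PowerSeries.C (t * a i * b k) * PowerSeries.X))⁻¹).det) := by
  have hne : ∀ c : K, e (1 - PowerSeries.C c * PowerSeries.X) ≠ 0 := by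
    intro c h
    have h1 := (map_eq_zero_iff e he).mp h
    have h2 := congrArg PowerSeries.constantCoeff h1
    simp at h2
  have hA : ∀ i j, e (1 - PowerSeries.C (a i * b j) * PowerSeries.X) =
      1 - (e (PowerSeries.C (a i)) * e PowerSeries.X) * e (PowerSeries.C (b j)) := by
    intro i j
    simp only [map_sub, map_mul, map_one]
    ring
  have hB : ∀ i j, e (1 - PowerSeries.C (t * a i * b j) * PowerSeries.X) =
      1 - e (PowerSeries.C t) * (e (PowerSeries.C (a i)) * e PowerSeries.X) *
        e (PowerSeries.C (b j)) := by
    intro i j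
    simp only [map_sub, map_mul, map_one]
    ring
  simp only [hA, hB]
  rw [prod_mul_det_cauchy (fun i => e (PowerSeries.C (a i)) * e PowerSeries.X)
    (fun j => e (PowerSeries.C (b j))) (e (PowerSeries.C t)) (e (PowerSeries.C x))
    (fun i j => by rw [← hA]; exact hne _) (fun i j => by rw [← hB]; exact hne _)]
  rw [map_mul, map_sum, Finset.mul_sum, Finset.mul_sum, Finset.sum_mul]
  refine Finset.sum_congr rfl fun I _ => ?_
  have hV : vandermondeDet (scaleOn I (e (PowerSeries.C t))
      fun i => e (PowerSeries.C (a i)) * e PowerSeries.X) =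
        e (PowerSeries.C (vandermondeDet (scaleOn I t a))) *
          ∏ i : Fin N, ∏ j : Fin N, if i < j then e PowerSeries.X else 1 := by
    have := map_vandermondeDet (e.comp PowerSeries.C) (scaleOn I t a)
    rw [RingHom.comp_apply] at this
    rw [this, ← vandermondeDet_mul]
    congr 1
    ext i
    simp only [scaleOn, RingHom.comp_apply]
    split_ifs
    · rw [map_mul, map_mul, mul_assoc]
    · rfl
  have hb : (vandermondeDet fun j => e (PowerSeries.C (b j))) =
      e (PowerSeries.C (vandermondeDet b)) := by
    exact (map_vandermondeDet (e.comp PowerSeries.C) b).symm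
  have hS := congrArg e (expSeries_scaleOn (t := t) hq a b I)
  rw [map_mul, map_mul, map_prod, map_prod] at hS
  simp only [map_prod] at hS
  have hQ : e (expSeries (evalAt (R := K) (scaleOn I q a))
      (fun k => macRatio q t k * ∑ j, b j ^ (k : ℕ))) =
      e (expSeries (evalAt (R := K) a) fun k => macRatio q t k * ∑ j, b j ^ (k : ℕ)) *
        ∏ i ∈ I, ∏ j, (e (1 - PowerSeries.C (a i * b j) * PowerSeries.X) /
          e (1 - PowerSeries.C (t * a i * b j) * PowerSeries.X)) := by
    simp only [Finset.prod_div_distrib]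
    rw [← mul_div_assoc, eq_div_iff]
    · exact hS
    · exact Finset.prod_ne_zero_iff.mpr fun i _ => Finset.prod_ne_zero_iff.mpr fun j _ => hne _
  simp only [hA, hB] at hQ
  rw [hV, hb, map_mul, hQ, map_mul, map_mul, map_pow, map_pow]
  ring

/-- Macdonald's operator may be applied to the kernel in either of the two sets of variables. -/
theorem evalAt_macOp_macKernel_comm {q t : K} (hq : ∀ k : ℕ, 0 < k → q ^ k ≠ 1) (x : K)
    {a b : Fin N → K} (ha : Function.Injective a) (hb : Function.Injective b) (n : ℕ) :
    evalAt a (macOp N q t x (macKernel q t b n)) =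
      evalAt b (macOp N q t x (macKernel q t a n)) := by
  -- the determinant has inverses of power series as entries, hence the fraction field
  let e := algebraMap (PowerSeries K) (FractionRing (PowerSeries K))
  have he : Function.Injective e := IsFractionRing.injective _ _
  have : CharZero K := algebraRat.charZero K
  have : CharZero (FractionRing (PowerSeries K)) :=
    charZero_of_injective_ringHom (f := e.comp PowerSeries.C)
      (he.comp PowerSeries.C_injective)
  have h1 := sum_expSeries_eq_det (t := t) hq x a b e he
  have h2 := sum_expSeries_eq_det (t := t) hq x b a e he
  have hX : (∏ i : Fin N, ∏ j : Fin N, if i < j then e PowerSeries.X else 1) ≠ 0 := by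
    refine Finset.prod_ne_zero_iff.mpr fun i _ => Finset.prod_ne_zero_iff.mpr fun j _ => ?_
    split_ifs
    · exact (map_ne_zero_iff e he).mpr PowerSeries.X_ne_zero
    · exact one_ne_zero
  have hK : (expSeries (evalAt (R := K) a) fun k => macRatio q t k * ∑ j, b j ^ (k : ℕ)) =
      expSeries (evalAt (R := K) b) fun k => macRatio q t k * ∑ j, a j ^ (k : ℕ) := by
    ext n
    rw [expSeries, expSeries, PowerSeries.coeff_mk, PowerSeries.coeff_mk]
    exact evalAt_macKernel_comm q t a b n
  have h3 : (∏ i, ∏ j, e (1 - PowerSeries.C (b i * a j) * PowerSeries.X)) =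
      ∏ i, ∏ j, e (1 - PowerSeries.C (a i * b j) * PowerSeries.X) := by
    rw [Finset.prod_comm]
    simp only [mul_comm (b _)]
  have h4 : (Matrix.of fun i k : Fin N => (e (1 - PowerSeries.C (b i * a k) * PowerSeries.X))⁻¹ +
      e (PowerSeries.C x) * (e (1 - PowerSeries.C (t * b i * a k) * PowerSeries.X))⁻¹).det =
      (Matrix.of fun i k : Fin N => (e (1 - PowerSeries.C (a i * b k) * PowerSeries.X))⁻¹ +
        e (PowerSeries.C x) * (e (1 - PowerSeries.C (t * a i * b k) * PowerSeries.X))⁻¹).det := by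
    rw [← Matrix.det_transpose]
    congr 1
    ext i k
    simp only [Matrix.transpose_apply, Matrix.of_apply]
    rw [mul_comm (b k), mul_right_comm t]
  rw [h3, h4, ← hK, ← h1] at h2
  have h5 := congrArg (PowerSeries.coeff n) (he (mul_right_cancel₀ hX h2))
  rw [PowerSeries.coeff_C_mul, PowerSeries.coeff_C_mul, coeff_sum_expSeries, coeff_sum_expSeries,
    mul_left_comm] at h5
  exact (mul_left_cancel₀ (vandermondeDet_ne_zero ha)
    (mul_left_cancel₀ (vandermondeDet_ne_zero hb) h5)).symm

end kernel

section form

variable {R : Type*} [CommRing R]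

/-- The symmetric bilinear form with `⟨p_m, p_m'⟩ = δ_{m m'} z_m`. -/
def psForm (z : (ℕ+ →₀ ℕ) → R) : PSumRing R →ₗ[R] PSumRing R →ₗ[R] R :=
  (basisMonomials ℕ+ R).constr R fun m => z m • lcoeff R m

theorem psForm_monomial (z : (ℕ+ →₀ ℕ) → R) (m : ℕ+ →₀ ℕ) (c : R) (g : PSumRing R) :
    psForm z (monomial m c) g = c * z m * coeff m g := by
  have h : monomial m c = c • basisMonomials ℕ+ R m := by simp [smul_monomial]
  rw [h, map_smul, psForm, Module.Basis.constr_basis]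
  simp [mul_assoc]

theorem psForm_apply (z : (ℕ+ →₀ ℕ) → R) (f g : PSumRing R) :
    psForm z f g = ∑ m ∈ f.support, coeff m f * z m * coeff m g := by
  conv_lhs => rw [MvPolynomial.as_sum f, map_sum, LinearMap.sum_apply]
  exact Finset.sum_congr rfl fun m _ => psForm_monomial z m _ g

theorem psForm_apply_monomial (z : (ℕ+ →₀ ℕ) → R) (m : ℕ+ →₀ ℕ) (c : R) (f : PSumRing R) :
    psForm z f (monomial m c) = coeff m f * z m * c := by
  rw [psForm_apply]
  simp only [coeff_monomial, mul_ite, mul_zero, Finset.sum_ite_eq]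
  split_ifs with h
  · rfl
  · rw [notMem_support_iff.mp h]
    ring

theorem psForm_comm (z : (ℕ+ →₀ ℕ) → R) (f g : PSumRing R) : psForm z f g = psForm z g f := by
  conv_rhs => rw [MvPolynomial.as_sum f, map_sum]
  rw [psForm_apply]
  refine Finset.sum_congr rfl fun m _ => ?_
  rw [psForm_apply_monomial]
  ring

end form

section selfAdjoint

variable {K : Type*} [Field K] [Algebra ℚ K] {N : ℕ}

/-- `z_m(q, t) = ∏ k, m_k! k ^ m_k ((1 - q ^ k) / (1 - t ^ k)) ^ m_k`. -/
def macZ (q t : K) (m : ℕ+ →₀ ℕ) : K :=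
  (algebraMap ℚ K (zInv m) * m.prod fun k e => macRatio q t k ^ e)⁻¹

omit [Algebra ℚ K] in
theorem macRatio_ne_zero {q t : K} (hq : ∀ k : ℕ, 0 < k → q ^ k ≠ 1)
    (ht : ∀ k : ℕ, 0 < k → t ^ k ≠ 1) (k : ℕ+) : macRatio q t k ≠ 0 :=
  div_ne_zero (sub_ne_zero.mpr (ht k k.pos).symm) (sub_ne_zero.mpr (hq k k.pos).symm)

theorem macZ_ne_zero {q t : K} (hq : ∀ k : ℕ, 0 < k → q ^ k ≠ 1)
    (ht : ∀ k : ℕ, 0 < k → t ^ k ≠ 1) (m : ℕ+ →₀ ℕ) : macZ q t m ≠ 0 := by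
  refine inv_ne_zero (mul_ne_zero ?_ ?_)
  · exact (map_ne_zero (algebraMap ℚ K)).mpr (zInv_ne_zero m)
  · exact Finset.prod_ne_zero_iff.mpr fun k _ => pow_ne_zero _ (macRatio_ne_zero hq ht k)

theorem macKernel_eq_sum (q t : K) (b : Fin N → K) (n : ℕ) :
    macKernel q t b n = ∑ m ∈ wtFinset n,
      ((macZ q t m)⁻¹ * evalAt b (monomial m (1 : K))) • monomial m (1 : K) := by
  rw [macKernel, expPoly]
  refine Finset.sum_congr rfl fun m _ => ?_
  rw [smul_monomial, smul_eq_mul, mul_one]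
  congr 1
  rw [expCoeff, macZ, inv_inv, evalAt, aeval_monomial, map_one, one_mul, mul_assoc]
  congr 1
  rw [← Finsupp.prod_mul]
  simp only [mul_pow]

/-- The matrix of Macdonald's operator in the basis of power sums is symmetric up to the weights
`z_m(q, t)`. -/
theorem coeff_macOp_monomial {q t : K} (hq : ∀ k : ℕ, 0 < k → q ^ k ≠ 1) (x : K) {n : ℕ}
    (hn : n ≤ N) {m m' : ℕ+ →₀ ℕ} (hm : wt m = n) (hm' : wt m' = n) :
    (macZ q t m)⁻¹ * coeff m' (macOp N q t x (monomial m 1)) =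
      (macZ q t m')⁻¹ * coeff m (macOp N q t x (monomial m' 1)) := by
  have : CharZero K := algebraRat.charZero K
  have hmon : ∀ m ∈ wtFinset n, IsWt (monomial m (1 : K)) n := fun m hm =>
    isWeightedHomogeneous_monomial _ _ _ (mem_wtFinset.mp hm)
  have hop : ∀ m ∈ wtFinset n, IsWt (macOp N q t x (monomial m (1 : K))) n := fun m hm =>
    isWt_macOp (hmon m hm) q t x
  -- compare coefficients in the variables `a`, then in the variables `b`, of the kernel identity
  have h1 : ∀ b : Fin N → K, Function.Injective b →
      ∑ m ∈ wtFinset n, (((macZ q t m)⁻¹ * evalAt b (monomial m (1 : K))) •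
          macOp N q t x (monomial m (1 : K)) -
        ((macZ q t m)⁻¹ * evalAt b (macOp N q t x (monomial m (1 : K)))) •
          monomial m (1 : K)) = 0 := by
    intro b hb
    refine IsWt.eq_zero_of_evalAt (N := N) (n := n) ?_ hn fun a ha => ?_
    · exact IsWeightedHomogeneous.sum _ _ _ fun m hm =>
        ((hop m hm).smul _).sub ((hmon m hm).smul _)
    · have h := evalAt_macOp_macKernel_comm (t := t) hq x ha hb n
      rw [macKernel_eq_sum, macKernel_eq_sum, map_sum, map_sum, map_sum, map_sum] at h
      rw [map_sum]
      simp only [map_sub, Finset.sum_sub_distrib, map_smul, smul_eq_mul] at h ⊢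
      rw [sub_eq_zero, h]
      refine Finset.sum_congr rfl fun m _ => ?_
      ring
  have h2 : ∑ m ∈ wtFinset n, ((macZ q t m)⁻¹ * coeff m' (macOp N q t x (monomial m 1))) •
        monomial m (1 : K) - (macZ q t m')⁻¹ • macOp N q t x (monomial m' (1 : K)) = 0 := by
    refine IsWt.eq_zero_of_evalAt (N := N) (n := n) ?_ hn fun b hb => ?_
    · refine IsWeightedHomogeneous.sub ?_ ((hop m' (mem_wtFinset.mpr hm')).smul _)
      exact IsWeightedHomogeneous.sum _ _ _ fun m hm => (hmon m hm).smul _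
    · have h := congrArg (coeff m') (h1 b hb)
      rw [coeff_sum] at h
      simp only [coeff_sub, coeff_smul, coeff_monomial, Finset.sum_sub_distrib, smul_eq_mul,
        mul_ite, mul_one, mul_zero, Finset.sum_ite_eq', mem_wtFinset, if_pos hm', coeff_zero] at h
      rw [map_sub, map_sum, map_smul, smul_eq_mul, ← h]
      congr 1
      refine Finset.sum_congr rfl fun m _ => ?_
      rw [map_smul, smul_eq_mul]
      ring
  have h := congrArg (coeff m) h2
  rw [coeff_sub, coeff_sum] at h
  simp only [coeff_smul, coeff_monomial, smul_eq_mul, mul_ite, mul_one, mul_zero,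
    Finset.sum_ite_eq', mem_wtFinset, if_pos hm, coeff_zero] at h
  exact sub_eq_zero.mp h

/-- Macdonald's operator is self-adjoint for `⟨·, ·⟩_{q,t}`. -/
theorem psForm_macOp {q t : K} (hq : ∀ k : ℕ, 0 < k → q ^ k ≠ 1)
    (ht : ∀ k : ℕ, 0 < k → t ^ k ≠ 1) (x : K) {n : ℕ} (hn : n ≤ N) {f g : PSumRing K}
    (hf : IsWt f n) (hg : IsWt g n) :
    psForm (macZ q t) (macOp N q t x f) g = psForm (macZ q t) f (macOp N q t x g) := by
  have h1 : ∀ (m : ℕ+ →₀ ℕ) (c : K), monomial m c = c • monomial m (1 : K) := by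
    intro m c
    simp [smul_monomial]
  rw [hf.as_sum, hg.as_sum]
  simp only [map_sum, LinearMap.sum_apply]
  refine Finset.sum_congr rfl fun m hm => Finset.sum_congr rfl fun m' hm' => ?_
  rw [h1 m, h1 m', map_smul, map_smul, map_smul, map_smul, map_smul, LinearMap.smul_apply,
    map_smul, LinearMap.smul_apply, psForm_apply_monomial, psForm_monomial, mul_one, one_mul]
  have h := coeff_macOp_monomial (t := t) hq x hn (mem_wtFinset.mp hm') (mem_wtFinset.mp hm)
  have hz := macZ_ne_zero hq ht m
  have hz' := macZ_ne_zero hq ht m'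
  field_simp at h
  rw [h]

end selfAdjoint

/-! ### The lexicographic order on exponent vectors and on partitions -/

section lexOrder

variable {N : ℕ}

theorem toLex_lt_iff {α β : Fin N →₀ ℕ} :
    toLex α < toLex β ↔ ∃ i, (∀ j < i, α j = β j) ∧ α i < β i := Finsupp.Lex.lt_iff

/-- Among the rearrangements of a vector the weakly decreasing one is lexicographically largest. -/
theorem toLex_equivMapDomain_le {α : Fin N →₀ ℕ} (hα : Antitone α) (σ : Equiv.Perm (Fin N)) :
    toLex (α.equivMapDomain σ) ≤ toLex α := by
  by_contra hcon
  rw [not_le, toLex_lt_iff] at hcon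
  obtain ⟨i, hi, hlt⟩ := hcon
  set β := α.equivMapDomain σ with hβ
  -- compare the numbers of entries that are at least `β i`
  have h1 : (Finset.univ.filter fun j => β i ≤ α j).card =
      (Finset.univ.filter fun j => β i ≤ β j).card := by
    refine Finset.card_equiv σ fun j => ?_
    simp [hβ, Finsupp.equivMapDomain_apply]
  have h2 : (Finset.univ.filter fun j => β i ≤ α j) ⊂ Finset.univ.filter fun j => β i ≤ β j := by
    rw [Finset.ssubset_iff_of_subset]
    · refine ⟨i, by simp, ?_⟩
      simpa using hlt
    · intro j hj
      rw [Finset.mem_filter] at hj ⊢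
      refine ⟨Finset.mem_univ j, ?_⟩
      rcases lt_or_ge j i with h | h
      · rw [← hi j h]
        exact hj.2
      · exact absurd (lt_of_lt_of_le hlt hj.2) (not_lt.mpr (hα h))
  exact (Finset.card_lt_card h2).ne h1

theorem eq_of_antitone_of_map_eq {f g : Fin N → ℕ} (hf : Antitone f) (hg : Antitone g)
    (h : Finset.univ.val.map f = Finset.univ.val.map g) : f = g := by
  have h1 : ∀ f : Fin N → ℕ, Finset.univ.val.map f = (List.ofFn f : Multiset ℕ) := by
    intro f
    rw [List.ofFn_eq_map]
    rfl
  have h2 : ∀ {f : Fin N → ℕ}, Antitone f → (List.ofFn f).Pairwise (· ≥ ·) := by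
    intro f hf
    rw [List.pairwise_ofFn]
    exact fun i j hij => hf hij.le
  rw [h1, h1, Multiset.coe_eq_coe] at h
  exact List.ofFn_injective (h.eq_of_pairwise' (h2 hf) (h2 hg))

theorem exists_perm_antitone (f : Fin N → ℕ) : ∃ σ : Equiv.Perm (Fin N), Antitone (f ∘ σ) :=
  ⟨Tuple.sort (OrderDual.toDual ∘ f), Tuple.monotone_sort (OrderDual.toDual ∘ f)⟩

theorem exists_perm_of_map_eq {f g : Fin N → ℕ}
    (h : Finset.univ.val.map f = Finset.univ.val.map g) :
    ∃ σ : Equiv.Perm (Fin N), f = g ∘ σ := by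
  obtain ⟨σ, hσ⟩ := exists_perm_antitone f
  obtain ⟨τ, hτ⟩ := exists_perm_antitone g
  have key : ∀ (f : Fin N → ℕ) (σ : Equiv.Perm (Fin N)),
      Finset.univ.val.map (f ∘ σ) = Finset.univ.val.map f := by
    intro f σ
    rw [← Multiset.map_map, Multiset.map_univ_val_equiv]
  have h2 := eq_of_antitone_of_map_eq hσ hτ (by rw [key, key, h])
  refine ⟨σ.symm.trans τ, ?_⟩
  ext i
  have := congrFun h2 (σ.symm i)
  simpa using this

end lexOrder

section partVec

variable {n : ℕ} (N : ℕ)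

/-- The parts of a partition in decreasing order, padded by zeros to a vector of length `N`. -/
def partVec (lam : n.Partition) : Fin N →₀ ℕ :=
  Finsupp.equivFunOnFinite.symm fun i => (partsList lam).getD i 0

theorem partVec_apply (lam : n.Partition) (i : Fin N) :
    partVec N lam i = (partsList lam).getD i 0 := rfl

theorem coe_partsList (lam : n.Partition) : (partsList lam : Multiset ℕ) = lam.parts :=
  Multiset.sort_eq _ _

theorem pos_of_mem_partsList {lam : n.Partition} {a : ℕ} (ha : a ∈ partsList lam) : 0 < a :=
  lam.parts_pos (by rwa [partsList, Multiset.mem_sort] at ha)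

theorem length_partsList_le (lam : n.Partition) : (partsList lam).length ≤ n := by
  have h1 : (partsList lam).sum = n := by
    rw [← Multiset.sum_coe, coe_partsList, lam.parts_sum]
  conv_rhs => rw [← h1]
  exact List.length_le_sum_of_one_le _ fun a ha => pos_of_mem_partsList ha

theorem antitone_partVec (lam : n.Partition) : Antitone (partVec N lam) := by
  intro i j hij
  have hs : (partsList lam).Pairwise (· ≥ ·) := Multiset.pairwise_sort _ _
  rw [partVec_apply, partVec_apply, List.getD_eq_getElem?_getD, List.getD_eq_getElem?_getD]
  by_cases hj : (j : ℕ) < (partsList lam).length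
  · have hi : (i : ℕ) < (partsList lam).length := lt_of_le_of_lt hij hj
    rw [List.getElem?_eq_getElem hj, List.getElem?_eq_getElem hi]
    rcases eq_or_lt_of_le hij with rfl | h
    · exact le_rfl
    · exact List.pairwise_iff_getElem.mp hs _ _ hi hj h
  · rw [List.getElem?_eq_none (by omega)]
    exact Nat.zero_le _

variable {N}

theorem map_partVec (hn : n ≤ N) (lam : n.Partition) :
    Finset.univ.val.map (partVec N lam) =
      lam.parts + Multiset.replicate (N - lam.parts.card) 0 := by
  have h1 : List.ofFn (fun i : Fin N => (partsList lam).getD i 0) =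
      partsList lam ++ List.replicate (N - (partsList lam).length) 0 := by
    have := length_partsList_le lam
    refine List.ext_getElem (by simp; omega) fun i h1 h2 => ?_
    rw [List.getElem_ofFn, List.getD_eq_getElem?_getD, List.getElem_append]
    split_ifs with h
    · rw [List.getElem?_eq_getElem h]
      rfl
    · rw [List.getElem?_eq_none (by simpa using h)]
      simp
  have h2 : (Finset.univ.val.map (partVec N lam) : Multiset ℕ) =
      (List.ofFn (fun i : Fin N => (partsList lam).getD i 0) : Multiset ℕ) := by
    rw [List.ofFn_eq_map]
    rfl
  have h3 : (partsList lam).length = lam.parts.card := by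
    rw [← coe_partsList, Multiset.coe_card]
  rw [h2, h1, ← Multiset.coe_add, coe_partsList, h3, Multiset.coe_replicate]

theorem sum_partVec (hn : n ≤ N) (lam : n.Partition) : ∑ i, partVec N lam i = n := by
  have : ∑ i, partVec N lam i = (Finset.univ.val.map (partVec N lam)).sum := rfl
  rw [this, map_partVec hn, Multiset.sum_add, lam.parts_sum]
  simp

theorem filter_map_partVec (hn : n ≤ N) (lam : n.Partition) :
    (Finset.univ.val.map (partVec N lam)).filter (· ≠ 0) = lam.parts := by
  rw [map_partVec hn, Multiset.filter_add, Multiset.filter_eq_self.mpr, Multiset.filter_eq_nil.mpr,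
    add_zero]
  · intro a ha
    simp [Multiset.eq_of_mem_replicate ha]
  · exact fun a ha => (lam.parts_pos ha).ne'

theorem partVec_injective (hn : n ≤ N) : Function.Injective (partVec N (n := n)) := by
  intro lam mu h
  refine Nat.Partition.ext ?_
  rw [← filter_map_partVec hn lam, h, filter_map_partVec hn mu]

/-- Every exponent vector of degree `n ≤ N` is a rearrangement of a partition of `n`. -/
theorem exists_equivMapDomain_partVec (hn : n ≤ N) (α : Fin N →₀ ℕ) (hα : ∑ i, α i = n) :
    ∃ (lam : n.Partition) (σ : Equiv.Perm (Fin N)), α = (partVec N lam).equivMapDomain σ := by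
  let lam : n.Partition := Nat.Partition.ofSums n (Finset.univ.val.map α) hα
  have h : (Finset.univ.val.map α : Multiset ℕ) = Finset.univ.val.map (partVec N lam) := by
    rw [map_partVec hn]
    have h1 : lam.parts = (Finset.univ.val.map α).filter (· ≠ 0) := rfl
    have h2 : (Finset.univ.val.map α).filter (· = 0) =
        Multiset.replicate (N - lam.parts.card) 0 := by
      rw [Multiset.eq_replicate]
      refine ⟨?_, fun b hb => (Multiset.mem_filter.mp hb).2⟩
      have h3 := congrArg Multiset.card (Multiset.filter_add_not (· = 0) (Finset.univ.val.map α))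
      rw [Multiset.card_add] at h3
      have h4 : (Finset.univ.val.map α).card = N := by simp
      rw [h1]
      have h5 : (Finset.univ.val.map α).filter (fun a => ¬ a = 0) =
        (Finset.univ.val.map α).filter (· ≠ 0) := rfl
      rw [h5] at h3
      omega
    rw [h1] at h2 ⊢
    rw [← h2, add_comm]
    exact (Multiset.filter_add_not _ _).symm
  obtain ⟨σ, hσ⟩ := exists_perm_of_map_eq h
  refine ⟨lam, σ.symm, ?_⟩
  ext i
  rw [Finsupp.equivMapDomain_apply, hσ]
  rfl

theorem toLex_partVec_lt (hn : n ≤ N) {mu lam : n.Partition} (h : lexLT mu lam) :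
    toLex (partVec N mu) < toLex (partVec N lam) := by
  have hl := length_partsList_le lam
  rw [toLex_lt_iff]
  rcases List.lt_iff_exists.mp h with ⟨h1, h2⟩ | ⟨i, hi1, hi2, h1, h2⟩
  · refine ⟨⟨(partsList mu).length, by omega⟩, fun j hj => ?_, ?_⟩
    · have hj : (j : ℕ) < (partsList mu).length := hj
      rw [partVec_apply, partVec_apply, List.getD_eq_getElem?_getD, List.getD_eq_getElem?_getD]
      conv_lhs => rw [h1]
      rw [List.getElem?_take_of_lt hj]
    · rw [partVec_apply, partVec_apply, List.getD_eq_getElem?_getD, List.getD_eq_getElem?_getD,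
        List.getElem?_eq_none le_rfl, List.getElem?_eq_getElem h2]
      exact pos_of_mem_partsList (List.getElem_mem h2)
  · refine ⟨⟨i, by omega⟩, fun j hj => ?_, ?_⟩
    · have hj : (j : ℕ) < i := hj
      rw [partVec_apply, partVec_apply, List.getD_eq_getElem?_getD, List.getD_eq_getElem?_getD,
        List.getElem?_eq_getElem (hj.trans hi1), List.getElem?_eq_getElem (hj.trans hi2)]
      exact h1 j hj
    · rw [partVec_apply, partVec_apply, List.getD_eq_getElem?_getD, List.getD_eq_getElem?_getD,
        List.getElem?_eq_getElem hi1, List.getElem?_eq_getElem hi2]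
      exact h2

theorem lexLT_trichotomy (mu lam : n.Partition) : lexLT mu lam ∨ mu = lam ∨ lexLT lam mu := by
  rcases lt_trichotomy (partsList mu) (partsList lam) with h | h | h
  · exact Or.inl h
  · refine Or.inr (Or.inl (Nat.Partition.ext ?_))
    rw [← coe_partsList, h, coe_partsList]
  · exact Or.inr (Or.inr h)

theorem toLex_partVec_lt_iff (hn : n ≤ N) {mu lam : n.Partition} :
    toLex (partVec N mu) < toLex (partVec N lam) ↔ lexLT mu lam := by
  refine ⟨fun h => ?_, toLex_partVec_lt hn⟩
  rcases lexLT_trichotomy mu lam with h1 | rfl | h1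
  · exact h1
  · exact absurd h (lt_irrefl _)
  · exact absurd h (lt_asymm (toLex_partVec_lt hn h1))

end partVec

/-! ### Triangularity -/

section triangular

variable {R : Type*} [CommRing R] {N : ℕ}

/-- All exponents of the restriction of `f` to `N` variables are lexicographically at most `v`. -/
def LexBounded (f : PSumRing R) (v : Fin N →₀ ℕ) : Prop :=
  ∀ α, coeff α (toFin R N f) ≠ 0 → toLex α ≤ toLex v

/-- The exponent vector `δ`, as a finitely supported function. -/
def staircaseVec (N : ℕ) : Fin N →₀ ℕ := Finsupp.equivFunOnFinite.symm (staircase N)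

theorem coe_add_staircaseVec (v : Fin N →₀ ℕ) :
    ⇑(v + staircaseVec N) = fun i => v i + staircase N i := rfl

theorem staircase_strictAnti : StrictAnti (staircase N) := by
  intro i j hij
  have : (i : ℕ) < j := hij
  have := j.2
  simp only [staircase]
  omega

theorem eq_one_of_staircaseVec {σ : Equiv.Perm (Fin N)} {v : Fin N →₀ ℕ} (hv : Antitone v)
    (h : (v + staircaseVec N).equivMapDomain σ = v + staircaseVec N) : σ = 1 := by
  have hinj : Function.Injective fun i => v i + staircase N i :=
    StrictAnti.injective fun i j hij => add_lt_add_of_le_of_lt (hv hij.le)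
      (staircase_strictAnti hij)
  ext i
  have h1 := DFunLike.congr_fun h (σ i)
  rw [Finsupp.equivMapDomain_apply, Equiv.symm_apply_apply] at h1
  have h2 := hinj h1
  rw [← h2]
  rfl

theorem alternant_X_eq_sum (β : Fin N →₀ ℕ) :
    alternant (fun i => (X i : MvPolynomial (Fin N) R)) β =
      ∑ σ : Equiv.Perm (Fin N), monomial (β.equivMapDomain σ) ((Equiv.Perm.sign σ : ℤ) : R) := by
  rw [alternant_eq_sum]
  refine Fintype.sum_equiv (Equiv.inv _) _ _ fun σ => ?_
  rw [monomial_eq, Finsupp.prod_fintype _ _ (by simp), Equiv.inv_apply, Equiv.Perm.sign_inv]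
  congr 1

theorem coeff_alternant_X {β γ : Fin N →₀ ℕ}
    (h : ∀ σ : Equiv.Perm (Fin N), β.equivMapDomain σ = γ → σ = 1) :
    coeff γ (alternant (fun i => (X i : MvPolynomial (Fin N) R)) β) = if β = γ then 1 else 0 := by
  rw [alternant_X_eq_sum, coeff_sum, Finset.sum_eq_single 1]
  · rw [coeff_monomial]
    have : β.equivMapDomain (1 : Equiv.Perm (Fin N)) = β := by
      ext i
      rfl
    rw [this]
    simp
  · intro σ _ hσ
    rw [coeff_monomial, if_neg]
    exact fun h1 => hσ (h σ h1)
  · simp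

theorem coeff_alternant_X_ne_zero {β γ : Fin N →₀ ℕ}
    (h : coeff γ (alternant (fun i => (X i : MvPolynomial (Fin N) R)) β) ≠ 0) :
    ∃ σ : Equiv.Perm (Fin N), β.equivMapDomain σ = γ := by
  by_contra hcon
  push Not at hcon
  refine h ?_
  rw [alternant_X_eq_sum, coeff_sum]
  exact Finset.sum_eq_zero fun σ _ => by rw [coeff_monomial, if_neg (hcon σ)]

/-- Division by the Vandermonde determinant shifts the leading exponent by `δ`. -/
theorem lex_of_vandermondeDet_mul [IsDomain R] {g : MvPolynomial (Fin N) R} {v : Fin N →₀ ℕ}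
    (h : ∀ γ, coeff γ (vandermondeDet (fun i => (X i : MvPolynomial (Fin N) R)) * g) ≠ 0 →
      toLex γ ≤ toLex (v + staircaseVec N)) :
    (∀ α, coeff α g ≠ 0 → toLex α ≤ toLex v) ∧
      coeff v g = coeff (v + staircaseVec N)
        (vandermondeDet (fun i => (X i : MvPolynomial (Fin N) R)) * g) := by
  set V := vandermondeDet (fun i => (X i : MvPolynomial (Fin N) R)) with hV
  have hVδ : coeff (staircaseVec N) V = 1 := by
    have h1 := coeff_alternant_X (R := R) (β := staircaseVec N) (γ := staircaseVec N)
      fun σ hσ => eq_one_of_staircaseVec (v := 0) (fun _ _ _ => le_rfl) (by simpa using hσ)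
    rw [if_pos rfl] at h1
    exact h1
  have hVdeg : MonomialOrder.lex.degree V = staircaseVec N := by
    apply MonomialOrder.lex.toSyn.injective
    refine le_antisymm ?_ (MonomialOrder.le_degree (by rw [mem_support_iff, hVδ]; simp))
    rw [MonomialOrder.degree_le_iff]
    intro γ hγ
    obtain ⟨σ, rfl⟩ := coeff_alternant_X_ne_zero (β := staircaseVec N) (mem_support_iff.mp hγ)
    exact toLex_equivMapDomain_le staircase_strictAnti.antitone σ
  have hg : MonomialOrder.lex.toSyn (MonomialOrder.lex.degree g) ≤ MonomialOrder.lex.toSyn v := by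
    by_cases hg0 : g = 0
    · rw [hg0, MonomialOrder.degree_zero, map_zero]
      exact MonomialOrder.lex.zero_le _
    have hV0 : V ≠ 0 := by
      rintro h0
      rw [h0, coeff_zero] at hVδ
      exact zero_ne_one hVδ
    have h2 := MonomialOrder.degree_mul (m := MonomialOrder.lex) hV0 hg0
    have h3 := h _ (mem_support_iff.mp
      (MonomialOrder.degree_mem_support (m := MonomialOrder.lex) (mul_ne_zero hV0 hg0)))
    rw [h2, hVdeg, add_comm] at h3
    exact le_of_add_le_add_right h3
  refine ⟨fun α hα => ?_, ?_⟩
  · exact (MonomialOrder.le_degree (mem_support_iff.mpr hα)).trans hg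
  · rw [add_comm, MonomialOrder.coeff_mul_of_add_of_degree_le (m := MonomialOrder.lex)
      (le_of_eq (congrArg _ hVdeg)) hg, hVδ, one_mul]

theorem equivMapDomain_add (a b : Fin N →₀ ℕ) (σ : Equiv.Perm (Fin N)) :
    (a + b).equivMapDomain σ = a.equivMapDomain σ + b.equivMapDomain σ := by
  ext i
  rfl

variable [IsDomain R] [Algebra ℚ R]

/-- The Schur function `s_v` has leading monomial `x ^ v`. -/
theorem lexBounded_schurPoly {v : Fin N →₀ ℕ} (hv : Antitone v) :
    LexBounded (schurPoly R v) v ∧ coeff v (toFin R N (schurPoly R v)) = 1 := by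
  have h1 : vandermondeDet (fun i => (X i : MvPolynomial (Fin N) R)) *
      toFin R N (schurPoly R v) = alternant (fun i => X i) ⇑(v + staircaseVec N) := by
    rw [coe_add_staircaseVec]
    exact vandermondeDet_mul_evalAt_schurPoly _ _
  have h2 := lex_of_vandermondeDet_mul (g := toFin R N (schurPoly R v)) (v := v) (by
    intro γ hγ
    rw [h1] at hγ
    obtain ⟨σ, rfl⟩ := coeff_alternant_X_ne_zero hγ
    exact toLex_equivMapDomain_le (hv.add staircase_strictAnti.antitone) σ)
  refine ⟨h2.1, ?_⟩
  rw [h2.2, h1, coeff_alternant_X fun σ => eq_one_of_staircaseVec hv, if_pos rfl]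

/-- Macdonald's operator is triangular for the lexicographic order. -/
theorem lexBounded_macOp {f : PSumRing R} {v : Fin N →₀ ℕ} (hf : LexBounded f v) (q t x : R) :
    LexBounded (macOp N q t x f) v ∧ coeff v (toFin R N (macOp N q t x f)) =
      macEig q t x v * coeff v (toFin R N f) := by
  have h1 : vandermondeDet (fun i => (X i : MvPolynomial (Fin N) R)) *
      toFin R N (macOp N q t x f) = ∑ α ∈ (toFin R N f).support,
        (coeff α (toFin R N f) * macEig q t x α) •
          alternant (fun i => (X i : MvPolynomial (Fin N) R)) ⇑(α + staircaseVec N) := by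
    simp only [coe_add_staircaseVec]
    exact vandermondeDet_mul_evalAt_macOp_eq_sum _ q t x f
  have hle : ∀ α ∈ (toFin R N f).support, ∀ σ : Equiv.Perm (Fin N),
      toLex (α.equivMapDomain σ) ≤ toLex v := by
    intro α hα σ
    refine hf _ ?_
    rw [coeff_toFin_equivMapDomain]
    exact mem_support_iff.mp hα
  have hδ : ∀ σ : Equiv.Perm (Fin N),
      toLex ((staircaseVec N).equivMapDomain σ) ≤ toLex (staircaseVec N) :=
    toLex_equivMapDomain_le staircase_strictAnti.antitone
  have h2 := lex_of_vandermondeDet_mul (g := toFin R N (macOp N q t x f)) (v := v) (by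
    intro γ hγ
    rw [h1, coeff_sum] at hγ
    obtain ⟨α, hα, hne⟩ := Finset.exists_ne_zero_of_sum_ne_zero hγ
    rw [coeff_smul] at hne
    obtain ⟨σ, rfl⟩ := coeff_alternant_X_ne_zero (right_ne_zero_of_smul hne)
    rw [equivMapDomain_add, toLex_add, toLex_add]
    exact add_le_add (hle α hα σ) (hδ σ))
  refine ⟨h2.1, ?_⟩
  have h3 : ∀ α ∈ (toFin R N f).support, ∀ σ : Equiv.Perm (Fin N),
      (α + staircaseVec N).equivMapDomain σ = v + staircaseVec N → σ = 1 := by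
    intro α hα σ hσ
    rw [equivMapDomain_add] at hσ
    have h4 : (staircaseVec N).equivMapDomain σ = staircaseVec N := by
      by_contra hne
      have h5 : toLex ((staircaseVec N).equivMapDomain σ) < toLex (staircaseVec N) :=
        lt_of_le_of_ne (hδ σ) fun h => hne (toLex.injective h)
      have h6 := add_lt_add_of_le_of_lt (hle α hα σ) h5
      rw [← toLex_add, ← toLex_add, hσ] at h6
      exact lt_irrefl _ h6
    exact eq_one_of_staircaseVec (v := 0) (fun _ _ _ => le_rfl) (by simpa using h4)
  rw [h2.2, h1, coeff_sum]
  have h4 : ∀ α ∈ (toFin R N f).support, coeff (v + staircaseVec N)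
      ((coeff α (toFin R N f) * macEig q t x α) •
        alternant (fun i => (X i : MvPolynomial (Fin N) R)) ⇑(α + staircaseVec N)) =
      if v = α then coeff α (toFin R N f) * macEig q t x α else 0 := by
    intro α hα
    rw [coeff_smul, coeff_alternant_X (h3 α hα)]
    simp [eq_comm]
  rw [Finset.sum_congr rfl h4, Finset.sum_ite_eq]
  split_ifs with h5
  · exact mul_comm _ _
  · rw [notMem_support_iff.mp h5, mul_zero]

end triangular

/-! ### Comparison with symmetric power series -/

section complete

variable {K : Type*} [Field K]

theorem coeff_powerSum_mul_complete (k : ℕ+) (j : ℕ) (d : ℕ →₀ ℕ) :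
    MvPowerSeries.coeff d ((powerSum K k * complete K j : SymFun K) : MvPowerSeries ℕ K) =
      if d.degree = k + j then ((d.support.filter fun i => (k : ℕ) ≤ d i).card : K) else 0 := by
  classical
  rw [MulMemClass.coe_mul, MvPowerSeries.coeff_mul, Finset.card_eq_sum_ones, Nat.cast_sum]
  have h1 : ∀ a, MvPowerSeries.coeff a (powerSum K k : MvPowerSeries ℕ K) =
      if ∃ i : ℕ, a = Finsupp.single i (k : ℕ) then 1 else 0 := fun a => rfl
  have h2 : ∀ b, MvPowerSeries.coeff b (complete K j : MvPowerSeries ℕ K) =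
      if b.degree = j then 1 else 0 := fun a => rfl
  simp only [h1, h2]
  split_ifs with hd
  · symm
    refine Finset.sum_bij_ne_zero
      (fun i _ _ => (Finsupp.single i (k : ℕ), d - Finsupp.single i (k : ℕ))) ?_ ?_ ?_ ?_
    · intro i hi _
      rw [Finset.mem_filter] at hi
      rw [Finset.HasAntidiagonal.mem_antidiagonal]
      exact add_tsub_cancel_of_le (Finsupp.single_le_iff.mpr hi.2)
    · intro i _ _ i' _ _ h
      exact (Finsupp.single_left_inj k.ne_zero).mp (Prod.ext_iff.mp h).1
    · rintro ⟨a, b⟩ hab hne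
      rw [Finset.HasAntidiagonal.mem_antidiagonal] at hab
      have h3 := left_ne_zero_of_mul hne
      simp only [ne_eq, ite_eq_right_iff, not_forall] at h3
      obtain ⟨⟨i, rfl⟩, _⟩ := h3
      simp only at hab
      have hle : (k : ℕ) ≤ d i := by
        rw [← hab]
        simp
      refine ⟨i, ?_, by simp, ?_⟩
      · rw [Finset.mem_filter, Finsupp.mem_support_iff]
        have := k.pos
        exact ⟨by omega, hle⟩
      · rw [← hab, add_tsub_cancel_left]
    · intro i hi _
      rw [Finset.mem_filter] at hi
      have h3 : (Finsupp.single i (k : ℕ) + (d - Finsupp.single i (k : ℕ))).degree = d.degree := by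
        rw [add_tsub_cancel_of_le (Finsupp.single_le_iff.mpr hi.2)]
      rw [map_add, Finsupp.degree_single, hd] at h3
      rw [if_pos ⟨i, rfl⟩, if_pos (by simpa using h3)]
      simp
  · refine Finset.sum_eq_zero fun a ha => ?_
    rw [Finset.HasAntidiagonal.mem_antidiagonal] at ha
    split_ifs with h3 h4
    · obtain ⟨i, hi⟩ := h3
      exfalso
      apply hd
      rw [← ha, map_add, h4, hi, Finsupp.degree_single]
    all_goals simp

/-- Newton's identity `(n + 1) h_{n+1} = ∑ p_{k+1} h_{n-k}`. -/
theorem smul_complete_succ (n : ℕ) : ((n + 1 : ℕ) : K) • complete K (n + 1) =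
    ∑ k ∈ Finset.range (n + 1), powerSum K k.succPNat * complete K (n - k) := by
  classical
  apply Subtype.ext
  ext d
  rw [AddSubmonoidClass.coe_finsetSum, map_sum, SetLike.val_smul, map_smul]
  have h2 : MvPowerSeries.coeff d (complete K (n + 1) : MvPowerSeries ℕ K) =
      if d.degree = n + 1 then 1 else 0 := rfl
  rw [h2, Finset.sum_congr rfl fun k _ => coeff_powerSum_mul_complete _ _ _]
  by_cases hd : d.degree = n + 1
  · rw [if_pos hd, smul_eq_mul, mul_one]
    have h3 : ∀ k ∈ Finset.range (n + 1),
        (if d.degree = (k.succPNat : ℕ) + (n - k) then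
          ((d.support.filter fun i => (k.succPNat : ℕ) ≤ d i).card : K) else 0) =
        ((d.support.filter fun i => k + 1 ≤ d i).card : K) := by
      intro k hk
      rw [Finset.mem_range] at hk
      rw [if_pos]
      · rfl
      · rw [hd, Nat.succPNat_coe]
        omega
    rw [Finset.sum_congr rfl h3, ← Nat.cast_sum]
    congr 1
    have h4 := Finset.sum_card_bipartiteAbove_eq_sum_card_bipartiteBelow
      (s := Finset.range (n + 1)) (t := d.support) (fun k i => k + 1 ≤ d i)
    simp only [Finset.bipartiteAbove, Finset.bipartiteBelow] at h4
    have h5 : ∀ i ∈ d.support,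
        ((Finset.range (n + 1)).filter fun k => k + 1 ≤ d i).card = d i := by
      intro i _
      have h6 : d i ≤ d.degree := Finsupp.le_degree i d
      have h7 : (Finset.range (n + 1)).filter (fun k => k + 1 ≤ d i) = Finset.range (d i) := by
        ext k
        simp only [Finset.mem_filter, Finset.mem_range]
        omega
      rw [h7, Finset.card_range]
    rw [h4, Finset.sum_congr rfl h5, ← hd, Finsupp.degree_apply]
  · rw [if_neg hd, smul_zero]
    symm
    refine Finset.sum_eq_zero fun k hk => if_neg ?_
    rw [Finset.mem_range] at hk
    rw [Nat.succPNat_coe]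
    omega

variable [CharZero K]

theorem powerSumEquiv_hPoly (n : ℕ) : powerSumEquiv K (hPoly K n) = complete K n := by
  induction n using Nat.strong_induction_on with
  | _ n ih =>
    cases n with
    | zero =>
      rw [hPoly, expPoly_zero, map_one]
      apply Subtype.ext
      ext d
      classical
      have h2 : MvPowerSeries.coeff d (complete K 0 : MvPowerSeries ℕ K) =
        if d.degree = 0 then 1 else 0 := rfl
      rw [h2, OneMemClass.coe_one, MvPowerSeries.coeff_one]
      simp [Finsupp.degree_eq_zero_iff]
    | succ n =>
      have h0 : ((n + 1 : ℕ) : K) ≠ 0 := by exact_mod_cast n.succ_ne_zero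
      have h := congrArg (powerSumEquiv K) (smul_expPoly_succ (R := K) (fun _ => 1) n)
      rw [map_smul, map_sum] at h
      have h2 : ∀ k ∈ Finset.range (n + 1), powerSumEquiv K
          ((1 : K) • (X k.succPNat * expPoly (fun _ => 1) (n - k))) =
            powerSum K k.succPNat * complete K (n - k) := by
        intro k hk
        rw [Finset.mem_range] at hk
        rw [one_smul, map_mul, powerSumEquiv_X, ← ih (n - k) (by omega)]
        rfl
      rw [Finset.sum_congr rfl h2, ← smul_complete_succ] at h
      exact smul_right_injective _ h0 h

theorem powerSumEquiv_hPolyInt (k : ℤ) : powerSumEquiv K (hPolyInt K k) = completeInt K k := by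
  rw [hPolyInt, completeInt]
  split_ifs
  · exact powerSumEquiv_hPoly _
  · exact map_zero _

end complete

section schur

/-- Trailing zeros do not change a Schur function. -/
theorem schurPoly_of_natAdd_eq_zero {R : Type*} [CommRing R] [Algebra ℚ R] {l r : ℕ}
    (α : Fin (l + r) → ℕ) (hα : ∀ i, α (Fin.natAdd l i) = 0) :
    schurPoly R α = schurPoly R fun i => α (Fin.castAdd r i) := by
  rw [schurPoly, ← Matrix.det_submatrix_equiv_self finSumFinEquiv,
    ← Matrix.fromBlocks_toBlocks (Matrix.submatrix _ _ _)]
  have h1 : (Matrix.submatrix (Matrix.of fun i j : Fin (l + r) =>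
      hPolyInt R ((α i : ℤ) - (i : ℤ) + (j : ℤ))) finSumFinEquiv
        finSumFinEquiv).toBlocks₂₁ = 0 := by
    ext i j
    simp only [Matrix.toBlocks₂₁, Matrix.of_apply, Matrix.submatrix_apply,
      finSumFinEquiv_apply_left, finSumFinEquiv_apply_right, hα, Matrix.zero_apply]
    rw [hPolyInt, if_neg]
    have := j.2
    simp only [Fin.val_natAdd, Fin.val_castAdd]
    push_cast
    omega
  rw [h1, Matrix.det_fromBlocks_zero₂₁]
  have h2 : (Matrix.submatrix (Matrix.of fun i j : Fin (l + r) =>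
      hPolyInt R ((α i : ℤ) - (i : ℤ) + (j : ℤ)))
        finSumFinEquiv finSumFinEquiv).toBlocks₂₂.det = 1 := by
    rw [Matrix.det_of_isUpperTriangular]
    · refine Finset.prod_eq_one fun i _ => ?_
      simp only [Matrix.toBlocks₂₂, Matrix.of_apply, Matrix.submatrix_apply,
        finSumFinEquiv_apply_right, hα]
      rw [hPolyInt, if_pos (by simp)]
      simp [hPoly, expPoly_zero]
    · intro i j hij
      have hij : (j : ℕ) < i := hij
      simp only [Matrix.toBlocks₂₂, Matrix.of_apply, Matrix.submatrix_apply,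
        finSumFinEquiv_apply_right, hα]
      rw [hPolyInt, if_neg]
      simp only [Fin.val_natAdd]
      push_cast
      omega
  rw [h2, mul_one, schurPoly]
  congr 1

/-- The Schur function of the definition, whose determinant has as many rows as the partition has
parts, is the one attached to the padded partition. -/
theorem schur_eq {K : Type*} [Field K] [CharZero K] {n N : ℕ} (hn : n ≤ N) (lam : n.Partition) :
    schur K lam = powerSumEquiv K (schurPoly K (partVec N lam)) := by
  obtain ⟨r, rfl⟩ := Nat.exists_eq_add_of_le ((length_partsList_le lam).trans hn)
  rw [schurPoly_of_natAdd_eq_zero]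
  · rw [schur, schurPoly, AlgEquiv.map_det]
    congr 1
    ext i j : 2
    simp only [Matrix.of_apply, AlgEquiv.mapMatrix_apply, Matrix.map_apply, powerSumEquiv_hPolyInt,
      partVec_apply, Fin.val_castAdd]
    congr 3
    rw [List.getD_eq_getElem _ _ i.2]
    rfl
  · intro i
    rw [partVec_apply, Fin.val_natAdd, List.getD_eq_getElem?_getD,
      List.getElem?_eq_none (by omega)]
    rfl

end schur

/-! ### Unitriangular families -/

section unitriangular

variable {K : Type*} [Field K] [CharZero K] {N n : ℕ}

/-- A family of symmetric functions of degree `n`, indexed by the partitions of `n`, that is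
lexicographically unitriangular with respect to the monomial symmetric functions. -/
def IsUnitriangular (N : ℕ) (P : n.Partition → PSumRing K) : Prop :=
  ∀ lam, IsWt (P lam) n ∧ LexBounded (P lam) (partVec N lam) ∧
    coeff (partVec N lam) (toFin K N (P lam)) = 1

/-- The lexicographically largest exponent of a symmetric function is a partition. -/
theorem exists_partVec_of_ne_zero (hn : n ≤ N) {f : PSumRing K} (hf : IsWt f n) (h0 : f ≠ 0) :
    ∃ lam : n.Partition, coeff (partVec N lam) (toFin K N f) ≠ 0 ∧
      LexBounded f (partVec N lam) := by
  have h1 : toFin K N f ≠ 0 := fun h => h0 (hf.eq_zero_of_toFin hn h)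
  set β := MonomialOrder.lex.degree (toFin K N f) with hβ
  have hmax : LexBounded f β := fun α hα =>
    MonomialOrder.le_degree (m := MonomialOrder.lex) (mem_support_iff.mpr hα)
  have hβ0 : coeff β (toFin K N f) ≠ 0 :=
    mem_support_iff.mp (MonomialOrder.degree_mem_support (m := MonomialOrder.lex) h1)
  obtain ⟨lam, σ, h2⟩ := exists_equivMapDomain_partVec hn β (hf.coeff_toFin hβ0)
  have h3 : coeff (partVec N lam) (toFin K N f) ≠ 0 := by
    rw [h2, coeff_toFin_equivMapDomain] at hβ0
    exact hβ0
  refine ⟨lam, h3, fun α hα => (hmax α hα).trans ?_⟩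
  rw [h2]
  exact toLex_equivMapDomain_le (antitone_partVec N lam) σ

/-- A symmetric function whose exponents are at most `v` is a combination of the members of a
unitriangular family whose leading exponents are at most `v`. -/
theorem IsUnitriangular.exists_expansion {P : n.Partition → PSumRing K}
    (hP : IsUnitriangular N P) (hn : n ≤ N) (v : Lex (Fin N →₀ ℕ)) {f : PSumRing K}
    (hf : IsWt f n) (hv : ∀ α, coeff α (toFin K N f) ≠ 0 → toLex α ≤ v) :
    ∃ c : n.Partition → K, f = ∑ mu, c mu • P mu ∧
      ∀ mu, c mu ≠ 0 → toLex (partVec N mu) ≤ v := by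
  classical
  induction v using WellFoundedLT.induction generalizing f with
  | _ v ih =>
    by_cases h0 : f = 0
    · exact ⟨0, by simp [h0], by simp⟩
    obtain ⟨lam, hlam, hmax⟩ := exists_partVec_of_ne_zero hn hf h0
    set a := coeff (partVec N lam) (toFin K N f) with ha
    obtain ⟨hP1, hP2, hP3⟩ := hP lam
    set f' := f - a • P lam with hf'
    have hw : IsWt f' n := hf.sub (hP1.smul a)
    have hlt : ∀ α, coeff α (toFin K N f') ≠ 0 → toLex α < toLex (partVec N lam) := by
      intro α hα
      rw [hf', map_sub, map_smul, coeff_sub, coeff_smul] at hα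
      refine lt_of_le_of_ne ?_ fun h => ?_
      · by_contra hcon
        refine hα ?_
        have h1 : coeff α (toFin K N f) = 0 := by
          by_contra h1
          exact hcon (hmax α h1)
        have h2 : coeff α (toFin K N (P lam)) = 0 := by
          by_contra h2
          exact hcon (hP2 α h2)
        rw [h1, h2, smul_zero, sub_zero]
      · rw [toLex.injective h, hP3, ← ha, smul_eq_mul, mul_one, sub_self] at hα
        exact hα rfl
    have hlv : toLex (partVec N lam) ≤ v := hv _ hlam
    obtain ⟨c, hc, hcv⟩ : ∃ c : n.Partition → K, f' = ∑ mu, c mu • P mu ∧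
        ∀ mu, c mu ≠ 0 → toLex (partVec N mu) ≤ v := by
      by_cases h0' : f' = 0
      · exact ⟨0, by simp [h0'], by simp⟩
      obtain ⟨mu, hmu, hmax'⟩ := exists_partVec_of_ne_zero hn hw h0'
      obtain ⟨c, hc, hcv⟩ := ih (toLex (partVec N mu)) ((hlt _ hmu).trans_le hlv) hw hmax'
      exact ⟨c, hc, fun nu hnu => (hcv nu hnu).trans ((hlt _ hmu).le.trans hlv)⟩
    refine ⟨c + (Pi.single lam a : n.Partition → K), ?_, ?_⟩
    · have h1 : ∀ mu, (c + (Pi.single lam a : n.Partition → K)) mu • P mu =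
          c mu • P mu + (Pi.single lam (a • P lam) : n.Partition → PSumRing K) mu := by
        intro mu
        rw [Pi.add_apply, add_smul]
        congr 1
        by_cases h : mu = lam
        · subst h
          simp
        · simp [Pi.single_eq_of_ne h]
      rw [Finset.sum_congr rfl fun mu _ => h1 mu, Finset.sum_add_distrib, ← hc]
      simp [hf']
    · intro mu hmu
      by_cases h : mu = lam
      · subst h
        exact hlv
      · refine hcv mu ?_
        simpa [Pi.single_eq_of_ne h] using hmu

theorem IsUnitriangular.exists_sum {P : n.Partition → PSumRing K}
    (hP : IsUnitriangular N P) (hn : n ≤ N) {f : PSumRing K} (hf : IsWt f n) :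
    ∃ c : n.Partition → K, f = ∑ mu, c mu • P mu := by
  by_cases h0 : f = 0
  · exact ⟨0, by simp [h0]⟩
  obtain ⟨lam, _, hmax⟩ := exists_partVec_of_ne_zero hn hf h0
  obtain ⟨c, hc, _⟩ := hP.exists_expansion hn _ hf hmax
  exact ⟨c, hc⟩

end unitriangular

/-! ### Positivity of the form over `ℚ(q, t)` -/

section positivity

theorem countable_ratFunc {k : Type*} [Field k] [Countable k] : Countable (RatFunc k) := by
  have h : Function.Injective fun x : RatFunc k => (x.num, x.denom) := by
    intro x y hxy
    rw [← RatFunc.num_div_denom x, ← RatFunc.num_div_denom y]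
    rw [Prod.mk.injEq] at hxy
    rw [hxy.1, hxy.2]
  have : Countable (Polynomial k) := by
    have h2 : Function.Injective fun p : Polynomial k => AddMonoidAlgebra.coeff p.toFinsupp :=
      fun p q hpq => Polynomial.toFinsupp_injective (AddMonoidAlgebra.coeff_injective hpq)
    exact h2.countable
  exact h.countable

/-- A real embedding of a countable field extends to the rational functions, with the variable sent
into `(0, 1)`: some number in this interval is transcendental. -/
theorem exists_ratFunc_ringHom {k : Type*} [Field k] [Countable k] (σ : k →+* ℝ) :
    ∃ φ : RatFunc k →+* ℝ, (∀ c, φ (RatFunc.C c) = σ c) ∧ 0 < φ RatFunc.X ∧ φ RatFunc.X < 1 := by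
  let _ : Algebra k ℝ := σ.toAlgebra
  have h1 : {x : ℝ | IsAlgebraic k x}.Countable := Algebraic.countable k ℝ
  obtain ⟨x, hx, hx2⟩ : ∃ x ∈ Set.Ioo (0 : ℝ) 1, ¬ IsAlgebraic k x := by
    by_contra hcon
    push Not at hcon
    have h2 : (Set.Ioo (0 : ℝ) 1).Countable := h1.mono hcon
    exact absurd (Cardinal.le_aleph0_iff_set_countable.mpr h2)
      (by rw [Cardinal.mk_Ioo_real zero_lt_one]; exact not_le.mpr Cardinal.aleph0_lt_continuum)
  have hinj : Function.Injective (Polynomial.aeval x : Polynomial k →ₐ[k] ℝ) :=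
    transcendental_iff_injective.mp hx2
  have hle : nonZeroDivisors (Polynomial k) ≤
      (nonZeroDivisors ℝ).comap (Polynomial.aeval x : Polynomial k →ₐ[k] ℝ).toRingHom :=
    nonZeroDivisors_le_comap_nonZeroDivisors_of_injective _ hinj
  refine ⟨RatFunc.liftRingHom _ hle, fun c => ?_, ?_⟩
  · rw [RatFunc.liftRingHom_C]
    exact Polynomial.aeval_C x c
  · rw [RatFunc.liftRingHom_X]
    have : (Polynomial.aeval x : Polynomial k →ₐ[k] ℝ).toRingHom Polynomial.X = x :=
      Polynomial.aeval_X x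
    rw [this]
    exact hx

theorem exists_qt_ringHom : ∃ φ : QT →+* ℝ, (0 < φ q ∧ φ q < 1) ∧ 0 < φ t ∧ φ t < 1 := by
  obtain ⟨φ₁, _, h1⟩ := exists_ratFunc_ringHom (algebraMap ℚ ℝ)
  have : Countable (RatFunc ℚ) := countable_ratFunc
  obtain ⟨φ, h2, h3⟩ := exists_ratFunc_ringHom φ₁
  exact ⟨φ, by rw [q, h2]; exact h1, h3⟩

theorem q_pow_ne_one (k : ℕ) (hk : 0 < k) : q ^ k ≠ 1 := by
  obtain ⟨φ, ⟨h1, h2⟩, _⟩ := exists_qt_ringHom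
  intro h
  have h3 := congrArg φ h
  rw [map_pow, map_one] at h3
  exact (pow_lt_one₀ h1.le h2 hk.ne').ne h3

theorem t_pow_ne_one (k : ℕ) (hk : 0 < k) : t ^ k ≠ 1 := by
  obtain ⟨φ, _, h1, h2⟩ := exists_qt_ringHom
  intro h
  have h3 := congrArg φ h
  rw [map_pow, map_one] at h3
  exact (pow_lt_one₀ h1.le h2 hk.ne').ne h3

theorem zQT_eq_macZ (m : ℕ+ →₀ ℕ) : zQT m = macZ q t m := by
  rw [zQT, macZ, zInv, Finsupp.prod, Finsupp.prod, Finsupp.prod, map_prod,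
    ← Finset.prod_mul_distrib, ← Finset.prod_inv_distrib]
  refine Finset.prod_congr rfl fun k _ => ?_
  rw [mul_inv, ← inv_pow, macRatio, inv_div, map_inv₀, inv_inv, map_mul, map_pow]
  simp

/-- The form is anisotropic: it is positive definite after a real embedding of `ℚ(q, t)` with
`0 < q, t < 1`. -/
theorem psForm_self_ne_zero {f : PSumRing QT} (hf : f ≠ 0) : psForm (macZ q t) f f ≠ 0 := by
  obtain ⟨φ, ⟨hq0, hq1⟩, ht0, ht1⟩ := exists_qt_ringHom
  have hz : ∀ m, 0 < φ (zQT m) := by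
    intro m
    rw [zQT, Finsupp.prod, map_prod]
    refine Finset.prod_pos fun k _ => ?_
    simp only [map_mul, map_pow, map_div₀, map_sub, map_one, map_natCast]
    have h1 : 0 < 1 - φ q ^ (k : ℕ) := sub_pos.mpr (pow_lt_one₀ hq0.le hq1 k.ne_zero)
    have h2 : 0 < 1 - φ t ^ (k : ℕ) := sub_pos.mpr (pow_lt_one₀ ht0.le ht1 k.ne_zero)
    have h3 : (0 : ℝ) < (k : ℕ) := by exact_mod_cast k.pos
    have h4 : (0 : ℝ) < ((m k).factorial : ℝ) := by exact_mod_cast Nat.factorial_pos _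
    positivity
  intro h
  have h1 := congrArg φ h
  rw [psForm_apply, map_sum, map_zero] at h1
  obtain ⟨m, hm⟩ := ne_zero_iff.mp hf
  refine (Finset.sum_pos (fun m hm => ?_) ⟨m, mem_support_iff.mpr hm⟩).ne' h1
  rw [map_mul, map_mul, ← zQT_eq_macZ, mul_right_comm]
  exact mul_pos (mul_self_pos.mpr ((map_ne_zero φ).mpr (mem_support_iff.mp hm))) (hz m)

end positivity

/-! ### Macdonald polynomials as eigenfunctions -/

section macP

theorem innerQT_powerSumEquiv (f g : PSumRing QT) :
    innerQT (powerSumEquiv QT f) (powerSumEquiv QT g) = psForm (macZ q t) f g := by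
  have h : ∀ (f : PSumRing QT) (m : ℕ+ →₀ ℕ),
      (powerSumBasis QT).repr (powerSumEquiv QT f) m = coeff m f := by
    intro f m
    simp only [powerSumBasis, Module.Basis.map_repr, LinearEquiv.trans_apply]
    have h2 : (powerSumEquiv QT).toLinearEquiv.symm (powerSumEquiv QT f) = f :=
      (powerSumEquiv QT).toLinearEquiv.symm_apply_apply f
    rw [h2]
    rfl
  rw [innerQT, psForm_apply, Finsupp.sum]
  have hs : ((powerSumBasis QT).repr (powerSumEquiv QT f)).support = f.support := by
    ext m
    rw [Finsupp.mem_support_iff, h, mem_support_iff]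
  rw [hs]
  refine Finset.sum_congr rfl fun m _ => ?_
  rw [h, h, zQT_eq_macZ]
  ring

variable {n N : ℕ}

/-- The Macdonald polynomial `P_λ` as a polynomial in the power sums. -/
def macP (lam : n.Partition) : PSumRing QT := (powerSumEquiv QT).symm (macdonaldP lam)

theorem powerSumEquiv_macP (lam : n.Partition) : powerSumEquiv QT (macP lam) = macdonaldP lam :=
  (powerSumEquiv QT).apply_symm_apply _

open Classical in
theorem macP_eq (hn : n ≤ N) (lam : n.Partition) :
    macP lam = schurPoly QT (partVec N lam) - ∑ mu : {mu : n.Partition // lexLT mu lam},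
      (psForm (macZ q t) (schurPoly QT (partVec N lam)) (macP mu.1) /
        psForm (macZ q t) (macP mu.1) (macP mu.1)) • macP mu.1 := by
  apply (powerSumEquiv QT).injective
  rw [powerSumEquiv_macP, macdonaldP, map_sub, map_sum, ← schur_eq hn]
  simp only [map_smul, powerSumEquiv_macP, ← innerQT_powerSumEquiv, ← schur_eq hn]

theorem isUnitriangular_macP (hn : n ≤ N) : IsUnitriangular N (macP (n := n)) := by
  classical
  intro lam
  induction lam using (lexLT_wf n).induction with
  | _ lam ih =>
    have hs := lexBounded_schurPoly (R := QT) (antitone_partVec N lam)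
    rw [macP_eq hn lam]
    refine ⟨?_, ?_, ?_⟩
    · refine IsWeightedHomogeneous.sub ?_ (IsWeightedHomogeneous.sum _ _ _ fun mu _ => ?_)
      · have h := isWt_schurPoly (R := QT) (partVec N lam)
        rwa [sum_partVec hn] at h
      · exact (ih mu.1 mu.2).1.smul _
    · intro α hα
      by_contra hcon
      refine hα ?_
      rw [map_sub, map_sum, coeff_sub, coeff_sum]
      have h1 : coeff α (toFin QT N (schurPoly QT (partVec N lam))) = 0 := by
        by_contra h
        exact hcon (hs.1 α h)
      rw [h1, Finset.sum_eq_zero, sub_zero]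
      intro mu _
      rw [map_smul, coeff_smul]
      have h2 : coeff α (toFin QT N (macP mu.1)) = 0 := by
        by_contra h
        exact hcon (((ih mu.1 mu.2).2.1 α h).trans (toLex_partVec_lt hn mu.2).le)
      rw [h2, smul_zero]
    · rw [map_sub, map_sum, coeff_sub, coeff_sum, hs.2, Finset.sum_eq_zero, sub_zero]
      intro mu _
      rw [map_smul, coeff_smul]
      have h2 : coeff (partVec N lam) (toFin QT N (macP mu.1)) = 0 := by
        by_contra h
        exact absurd ((ih mu.1 mu.2).2.1 _ h) (not_le.mpr (toLex_partVec_lt hn mu.2))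
      rw [h2, smul_zero]

theorem macP_ne_zero (lam : n.Partition) : macP lam ≠ 0 := by
  intro h
  have h1 := (isUnitriangular_macP le_rfl lam).2.2
  rw [h, map_zero, coeff_zero] at h1
  exact zero_ne_one h1

theorem psForm_macP_of_lexLT (lam mu : n.Partition) (h : lexLT mu lam) :
    psForm (macZ q t) (macP lam) (macP mu) = 0 := by
  classical
  induction lam using (lexLT_wf n).induction generalizing mu with
  | _ lam ih =>
    rw [macP_eq le_rfl lam, map_sub, LinearMap.sub_apply, map_sum, LinearMap.sum_apply,
      Finset.sum_eq_single ⟨mu, h⟩]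
    · rw [map_smul, LinearMap.smul_apply, smul_eq_mul,
        div_mul_cancel₀ _ (psForm_self_ne_zero (macP_ne_zero mu)), sub_self]
    · rintro ⟨nu, hnu⟩ _ hne
      rw [map_smul, LinearMap.smul_apply]
      have h0 : psForm (macZ q t) (macP nu) (macP mu) = 0 := by
        rcases lexLT_trichotomy nu mu with h1 | rfl | h1
        · rw [psForm_comm]
          exact ih mu h nu h1
        · exact absurd rfl hne
        · exact ih nu hnu mu h1
      rw [h0, smul_zero]
    · simp

theorem psForm_macP_of_ne {lam mu : n.Partition} (h : lam ≠ mu) :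
    psForm (macZ q t) (macP lam) (macP mu) = 0 := by
  rcases lexLT_trichotomy lam mu with h1 | rfl | h1
  · rw [psForm_comm]
    exact psForm_macP_of_lexLT _ _ h1
  · exact absurd rfl h
  · exact psForm_macP_of_lexLT _ _ h1

theorem psForm_sum_macP (c : n.Partition → QT) (mu : n.Partition) :
    psForm (macZ q t) (∑ nu, c nu • macP nu) (macP mu) =
      c mu * psForm (macZ q t) (macP mu) (macP mu) := by
  rw [map_sum, LinearMap.sum_apply, Finset.sum_eq_single mu]
  · rw [map_smul, LinearMap.smul_apply, smul_eq_mul]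
  · intro nu _ hne
    rw [map_smul, LinearMap.smul_apply, psForm_macP_of_ne hne, smul_zero]
  · simp

/-- The Macdonald polynomials are eigenfunctions: Macdonald's operator is self-adjoint and
triangular, and they are an orthogonal basis adapted to the same flag. -/
theorem macOp_macP (hn : n ≤ N) (x : QT) (lam : n.Partition) :
    macOp N q t x (macP lam) = macEig q t x (partVec N lam) • macP lam := by
  have hP := isUnitriangular_macP hn
  have hexp : ∀ lam : n.Partition, ∃ c : n.Partition → QT,
      macOp N q t x (macP lam) = ∑ mu, c mu • macP mu ∧
        ∀ mu, c mu ≠ 0 → toLex (partVec N mu) ≤ toLex (partVec N lam) := fun lam =>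
    hP.exists_expansion hn _ (isWt_macOp (hP lam).1 q t x) (lexBounded_macOp (hP lam).2.1 q t x).1
  obtain ⟨c, hc, hle⟩ := hexp lam
  have h0 : ∀ mu, mu ≠ lam → c mu = 0 := by
    intro mu hmu
    by_contra hcon
    -- `c μ ⟨P_μ, P_μ⟩ = ⟨D P_λ, P_μ⟩ = ⟨P_λ, D P_μ⟩`, and `P_λ` does not occur in `D P_μ`
    -- since `μ < λ`
    have h1 := psForm_sum_macP c mu
    rw [← hc, psForm_macOp q_pow_ne_one t_pow_ne_one x hn (hP lam).1 (hP mu).1] at h1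
    obtain ⟨c', hc', hle'⟩ := hexp mu
    rw [hc', psForm_comm, psForm_sum_macP] at h1
    have hlt : toLex (partVec N mu) < toLex (partVec N lam) :=
      lt_of_le_of_ne (hle mu hcon) fun h => hmu (partVec_injective hn (toLex.injective h))
    have h2 : c' lam = 0 := by
      by_contra h2
      exact absurd (hle' lam h2) (not_le.mpr hlt)
    rw [h2, zero_mul] at h1
    exact mul_ne_zero hcon (psForm_self_ne_zero (macP_ne_zero mu)) h1.symm
  have h1 : macOp N q t x (macP lam) = c lam • macP lam := by
    rw [hc]
    refine Finset.sum_eq_single lam (fun mu _ hmu => ?_) (by simp)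
    rw [h0 mu hmu, zero_smul]
  have h2 := (lexBounded_macOp (hP lam).2.1 q t x).2
  rw [h1, map_smul, coeff_smul, (hP lam).2.2, smul_eq_mul, mul_one, mul_one] at h2
  rw [h1, h2]

end macP

/-! ### Rational functions without pole at `t = ζ` -/

section regular

theorem eval₂_ne_zero_of_dvd {ζ : ℂ} {p p' : Polynomial (RatFunc ℚ)} (h : p ∣ p')
    (h' : Polynomial.eval₂ scalarHom (RatFunc.C ζ) p' ≠ 0) :
    Polynomial.eval₂ scalarHom (RatFunc.C ζ) p ≠ 0 :=
  fun h0 => h' (Polynomial.eval₂_eq_zero_of_dvd_of_eval₂_eq_zero _ _ h h0)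

/-- The subring of `ℚ(q, t)` of the rational functions without pole at `t = ζ`. -/
def regularRing (ζ : ℂ) : Subalgebra ℚ QT where
  carrier := {f | Polynomial.eval₂ scalarHom (RatFunc.C ζ) (RatFunc.denom f) ≠ 0}
  mul_mem' {a b} ha hb := by
    refine eval₂_ne_zero_of_dvd (RatFunc.denom_mul_dvd a b) ?_
    rw [Polynomial.eval₂_mul]
    exact mul_ne_zero ha hb
  add_mem' {a b} ha hb := by
    refine eval₂_ne_zero_of_dvd (RatFunc.denom_add_dvd a b) ?_
    rw [Polynomial.eval₂_mul]
    exact mul_ne_zero ha hb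
  algebraMap_mem' r := by
    have h : algebraMap ℚ QT r = RatFunc.C (r : RatFunc ℚ) := by
      rw [eq_ratCast, map_ratCast]
    rw [Set.mem_ofPred_eq, h, RatFunc.denom_C, Polynomial.eval₂_one]
    exact one_ne_zero

theorem mem_regularRing {ζ : ℂ} {f : QT} : f ∈ regularRing ζ ↔
    Polynomial.eval₂ scalarHom (RatFunc.C ζ) (RatFunc.denom f) ≠ 0 := Iff.rfl

/-- Evaluation at `t = ζ`. -/
def evalReg (ζ : ℂ) : regularRing ζ →+* RatFunc ℂ where
  toFun f := RatFunc.eval scalarHom (RatFunc.C ζ) (f : QT)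
  map_one' := RatFunc.eval_one _ _
  map_zero' := RatFunc.eval_zero _ _
  map_mul' a b := RatFunc.eval_mul _ _ a.2 b.2
  map_add' a b := RatFunc.eval_add _ _ a.2 b.2

theorem evalReg_apply (ζ : ℂ) (f : regularRing ζ) :
    evalReg ζ f = RatFunc.eval scalarHom (RatFunc.C ζ) (f : QT) := rfl

/-- The inclusion of the regular rational functions. -/
def regIncl (ζ : ℂ) : regularRing ζ →+* QT := (regularRing ζ).val.toRingHom

theorem regIncl_injective (ζ : ℂ) : Function.Injective (regIncl ζ) := Subtype.val_injective

theorem exists_mul_eq_one_of_evalReg_ne_zero {ζ : ℂ} {f : regularRing ζ} (h : evalReg ζ f ≠ 0) :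
    ∃ g : regularRing ζ, f * g = 1 := by
  have h0 : (f : QT) ≠ 0 := by
    intro h0
    refine h ?_
    rw [evalReg_apply, h0, RatFunc.eval_zero]
  have h1 : Polynomial.eval₂ scalarHom (RatFunc.C ζ) (RatFunc.num (f : QT)) ≠ 0 := by
    intro h1
    refine h ?_
    rw [evalReg_apply, RatFunc.eval, h1, zero_div]
  refine ⟨⟨(f : QT)⁻¹, eval₂_ne_zero_of_dvd (RatFunc.denom_inv_dvd h0) h1⟩, ?_⟩
  exact Subtype.ext (mul_inv_cancel₀ h0)

/-- `q` as a regular rational function. -/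
def qReg (ζ : ℂ) : regularRing ζ := ⟨q, by
  rw [mem_regularRing, q, RatFunc.denom_C, Polynomial.eval₂_one]
  exact one_ne_zero⟩

/-- `t` as a regular rational function. -/
def tReg (ζ : ℂ) : regularRing ζ := ⟨t, by
  rw [mem_regularRing, t, RatFunc.denom_X, Polynomial.eval₂_one]
  exact one_ne_zero⟩

theorem evalReg_qReg (ζ : ℂ) : evalReg ζ (qReg ζ) = RatFunc.X := by
  rw [evalReg_apply]
  change RatFunc.eval _ _ (RatFunc.C RatFunc.X) = _
  rw [RatFunc.eval_C, scalarHom, RatFunc.coe_mapRingHom_eq_coe_map, ← RatFunc.algebraMap_X,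
    RatFunc.map_apply, RatFunc.num_algebraMap, RatFunc.denom_algebraMap]
  simp

theorem evalReg_tReg (ζ : ℂ) : evalReg ζ (tReg ζ) = RatFunc.C ζ := by
  rw [evalReg_apply]
  exact RatFunc.eval_X _ _

end regular

/-! ### Separation of the eigenvalues at `t = ζ` -/

section separation

variable {N n : ℕ}

/-- Unique factorization for products of linear polynomials with constant coefficient one. -/
theorem map_eq_of_forall_prod_eq {K : Type*} [Field K] [CharZero K] {c d : Fin N → K}
    (h : ∀ x : ℕ, ∏ i, (1 + (x : K) * c i) = ∏ i, (1 + (x : K) * d i)) :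
    Finset.univ.val.map c = Finset.univ.val.map d := by
  -- pass to the monic polynomials `∏ (X + c_i)`, which agree at the points `1 / (x + 1)`
  have h1 : ∏ i, (Polynomial.X - Polynomial.C (-c i)) =
      ∏ i, (Polynomial.X - Polynomial.C (-d i)) := by
    refine Polynomial.eq_of_infinite_eval_eq _ _ ?_
    have hinj : Function.Injective fun x : ℕ => ((x + 1 : ℕ) : K)⁻¹ := by
      intro x y hxy
      have := inv_injective hxy
      have h2 : x + 1 = y + 1 := by exact_mod_cast this
      omega
    refine (Set.infinite_range_of_injective hinj).mono ?_
    rintro _ ⟨x, rfl⟩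
    have hx : ((x + 1 : ℕ) : K) ≠ 0 := Nat.cast_ne_zero.mpr (by omega)
    have h2 : ∀ c : Fin N → K, ∏ i, (((x + 1 : ℕ) : K)⁻¹ + c i) =
        (((x + 1 : ℕ) : K)⁻¹) ^ N * ∏ i, (1 + ((x + 1 : ℕ) : K) * c i) := by
      intro c
      have h3 : (((x + 1 : ℕ) : K)⁻¹) ^ N = ∏ _i : Fin N, ((x + 1 : ℕ) : K)⁻¹ := by simp
      rw [h3, ← Finset.prod_mul_distrib]
      refine Finset.prod_congr rfl fun i _ => ?_
      rw [mul_add, mul_one, inv_mul_cancel_left₀ hx]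
    simp only [Set.mem_ofPred_eq, Polynomial.eval_prod, Polynomial.eval_sub, Polynomial.eval_X,
      Polynomial.eval_C, sub_neg_eq_add]
    rw [h2, h2, h]
  have h2 : ∀ c : Fin N → K, (∏ i, (Polynomial.X - Polynomial.C (-c i))).roots =
      (Finset.univ.val.map c).map Neg.neg := by
    intro c
    rw [Multiset.map_map, ← Polynomial.roots_multiset_prod_X_sub_C
      (Finset.univ.val.map (Neg.neg ∘ c)), Multiset.map_map]
    rfl
  have h3 := h2 c
  rw [h1, h2 d] at h3
  exact (Multiset.map_injective neg_injective h3).symm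

theorem toNat_intDegree_C_mul_X_pow {a : ℂ} (ha : a ≠ 0) (e : ℕ) :
    (RatFunc.intDegree (RatFunc.C a * RatFunc.X ^ e)).toNat = e := by
  have h : RatFunc.C a * RatFunc.X ^ e =
      algebraMap (Polynomial ℂ) (RatFunc ℂ) (Polynomial.C a * Polynomial.X ^ e) := by
    simp
  rw [h, RatFunc.intDegree_polynomial, Polynomial.natDegree_C_mul_X_pow _ _ ha,
    Int.toNat_natCast]

/-- The products `∏ (1 + x a_i q ^ α_i)`, for `x` in `ℕ`, determine the exponents `α_i`. -/
theorem map_eq_of_forall_prod_X_pow_eq {a b : Fin N → ℂ} (ha : ∀ i, a i ≠ 0) (hb : ∀ i, b i ≠ 0)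
    {α β : Fin N → ℕ} (h : ∀ x : ℕ,
      ∏ i, (1 + (x : RatFunc ℂ) * (RatFunc.C (a i) * RatFunc.X ^ α i)) =
        ∏ i, (1 + (x : RatFunc ℂ) * (RatFunc.C (b i) * RatFunc.X ^ β i))) :
    Finset.univ.val.map α = Finset.univ.val.map β := by
  have h2 := congrArg (Multiset.map fun c => (RatFunc.intDegree c).toNat)
    (map_eq_of_forall_prod_eq h)
  have h3 : ∀ {a : Fin N → ℂ} (_ : ∀ i, a i ≠ 0) (α : Fin N → ℕ),
      ((fun c => (RatFunc.intDegree c).toNat) ∘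
        fun i => RatFunc.C (a i) * RatFunc.X ^ α i) = α :=
    fun ha α => funext fun i => toNat_intDegree_C_mul_X_pow (ha i) _
  rwa [Multiset.map_map, Multiset.map_map, h3 ha, h3 hb] at h2

theorem macEig_eq_prod (ζ : ℂ) (x : RatFunc ℂ) (α : Fin N → ℕ) :
    macEig RatFunc.X (RatFunc.C ζ) x α =
      ∏ i, (1 + x * (RatFunc.C (ζ ^ staircase N i) * RatFunc.X ^ α i)) := by
  simp only [macEig, map_pow, mul_assoc]

/-- Macdonald's operators for all natural values of `x` still separate exponent vectors, up to
rearrangement, when `t` is specialized to a nonzero number. -/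
theorem map_eq_of_forall_macEig_eq {ζ : ℂ} (hζ : ζ ≠ 0) {α β : Fin N → ℕ}
    (h : ∀ x : ℕ, macEig RatFunc.X (RatFunc.C ζ) (x : RatFunc ℂ) α =
      macEig RatFunc.X (RatFunc.C ζ) (x : RatFunc ℂ) β) :
    Finset.univ.val.map α = Finset.univ.val.map β := by
  simp only [macEig_eq_prod] at h
  exact map_eq_of_forall_prod_X_pow_eq (fun _ => pow_ne_zero _ hζ) (fun _ => pow_ne_zero _ hζ) h

theorem exists_macEig_ne {ζ : ℂ} (hζ : ζ ≠ 0) (hn : n ≤ N) {lam mu : n.Partition}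
    (h : lam ≠ mu) : ∃ x : ℕ, macEig RatFunc.X (RatFunc.C ζ) (x : RatFunc ℂ) (partVec N lam) ≠
      macEig RatFunc.X (RatFunc.C ζ) (x : RatFunc ℂ) (partVec N mu) := by
  by_contra hcon
  push Not at hcon
  refine h (Nat.Partition.ext ?_)
  rw [← filter_map_partVec hn lam, map_eq_of_forall_macEig_eq hζ hcon, filter_map_partVec hn]

end separation

/-! ### Regularity and specialization of Macdonald polynomials -/

section macPReg

variable {N n : ℕ} {ζ : ℂ}

/-- The coefficients of `P_λ` have no pole at `t = ζ`: the other Macdonald polynomials can be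
projected away from the Schur function `s_λ` by operators `(D - e_κ) / (e_λ - e_κ)`, whose
denominators do not vanish at `t = ζ`. -/
theorem exists_map_eq_macP (hζ : ζ ≠ 0) (lam : n.Partition) :
    ∃ g : PSumRing (regularRing ζ), map (regIncl ζ) g = macP lam := by
  classical
  have hP := isUnitriangular_macP (le_refl n)
  -- starting from `s_λ`, the `P_κ` with `κ ∈ S` are removed from the expansion one at a time
  have key : ∀ S : Finset n.Partition, lam ∉ S → ∃ (g : PSumRing (regularRing ζ))
      (c : n.Partition → QT), c lam = 1 ∧ (∀ mu ∈ S, c mu = 0) ∧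
        map (regIncl ζ) g = ∑ mu, c mu • macP mu := by
    intro S
    induction S using Finset.induction_on with
    | empty =>
      intro _
      have hs := lexBounded_schurPoly (R := QT) (antitone_partVec n lam)
      have hw : IsWt (schurPoly QT (partVec n lam)) n := by
        have h := isWt_schurPoly (R := QT) (partVec n lam)
        rwa [sum_partVec le_rfl] at h
      obtain ⟨c, hc, hle⟩ := hP.exists_expansion le_rfl _ hw hs.1
      refine ⟨schurPoly _ (partVec n lam), c, ?_, by simp, ?_⟩
      · have h1 := hs.2
        rw [hc, map_sum, coeff_sum, Finset.sum_eq_single lam] at h1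
        · rwa [map_smul, coeff_smul, (hP lam).2.2, smul_eq_mul, mul_one] at h1
        · intro mu _ hne
          rw [map_smul, coeff_smul]
          by_cases h0 : c mu = 0
          · rw [h0, zero_smul]
          have h2 : coeff (partVec n lam) (toFin QT n (macP mu)) = 0 := by
            by_contra h3
            exact hne (partVec_injective le_rfl (toLex.injective
              ((hle mu h0).antisymm ((hP mu).2.1 _ h3))))
          rw [h2, smul_zero]
        · simp
      · rw [map_schurPoly, hc]
    | insert kap S _ ih =>
      intro hlam
      rw [Finset.mem_insert, not_or] at hlam
      obtain ⟨g, c, hc1, hc0, hg⟩ := ih hlam.2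
      obtain ⟨x, hx⟩ := exists_macEig_ne hζ (le_refl n) hlam.1
      let e : n.Partition → regularRing ζ := fun mu =>
        macEig (qReg ζ) (tReg ζ) (x : regularRing ζ) (partVec n mu)
      have he : ∀ mu, evalReg ζ (e mu) =
          macEig RatFunc.X (RatFunc.C ζ) (x : RatFunc ℂ) (partVec n mu) := by
        intro mu
        rw [map_macEig, evalReg_qReg, evalReg_tReg, map_natCast]
      have he2 : ∀ mu, macOp n q t (x : QT) (macP mu) = regIncl ζ (e mu) • macP mu := by
        intro mu
        rw [macOp_macP le_rfl, map_macEig, map_natCast]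
        rfl
      obtain ⟨y, hy⟩ := exists_mul_eq_one_of_evalReg_ne_zero (f := e lam - e kap) (by
        rw [map_sub, he, he]
        exact sub_ne_zero.mpr hx)
      refine ⟨y • (macOp n (qReg ζ) (tReg ζ) (x : regularRing ζ) g - e kap • g),
        fun mu => regIncl ζ y * (regIncl ζ (e mu) - regIncl ζ (e kap)) * c mu, ?_, ?_, ?_⟩
      · change regIncl ζ y * (regIncl ζ (e lam) - regIncl ζ (e kap)) * c lam = 1
        rw [hc1, mul_one, ← map_sub, ← map_mul, mul_comm, hy, map_one]
      · intro mu hmu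
        change regIncl ζ y * (regIncl ζ (e mu) - regIncl ζ (e kap)) * c mu = 0
        rcases Finset.mem_insert.mp hmu with rfl | h
        · rw [sub_self, mul_zero, zero_mul]
        · rw [hc0 mu h, mul_zero]
      · have h1 : regIncl ζ (qReg ζ) = q := rfl
        have h2 : regIncl ζ (tReg ζ) = t := rfl
        have hsm : ∀ (a : regularRing ζ) (f : PSumRing (regularRing ζ)),
            map (regIncl ζ) (a • f) = regIncl ζ a • map (regIncl ζ) f := by
          intro a f
          rw [smul_eq_C_mul, map_mul, map_C, smul_eq_C_mul]
        rw [hsm, map_sub, hsm, map_macOp, h1, h2, map_natCast, hg, map_sum, Finset.smul_sum,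
          ← Finset.sum_sub_distrib, Finset.smul_sum]
        refine Finset.sum_congr rfl fun mu _ => ?_
        rw [map_smul, he2, smul_smul, smul_smul, ← sub_smul, smul_smul]
        congr 1
        ring
  obtain ⟨g, c, h1, h0, hg⟩ := key (Finset.univ.erase lam) (by simp)
  refine ⟨g, ?_⟩
  rw [hg, Finset.sum_eq_single lam (fun mu _ h => by rw [h0 mu (by simp [h]), zero_smul])
    (by simp), h1, one_smul]

/-- `P_λ` over the regular rational functions. -/
def macPReg (hζ : ζ ≠ 0) (lam : n.Partition) : PSumRing (regularRing ζ) :=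
  (exists_map_eq_macP hζ lam).choose

theorem map_macPReg (hζ : ζ ≠ 0) (lam : n.Partition) :
    map (regIncl ζ) (macPReg hζ lam) = macP lam := (exists_map_eq_macP hζ lam).choose_spec

theorem isWt_macPReg (hζ : ζ ≠ 0) (lam : n.Partition) : IsWt (macPReg hζ lam) n := by
  refine isWt_of_coeff fun m hm => ?_
  have h := (isUnitriangular_macP le_rfl lam).1.coeff_eq_zero hm
  rw [← map_macPReg hζ, coeff_map] at h
  exact regIncl_injective ζ (h.trans (map_zero _).symm)

theorem lexBounded_macPReg (hζ : ζ ≠ 0) (hn : n ≤ N) (lam : n.Partition) :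
    LexBounded (macPReg hζ lam) (partVec N lam) := by
  intro α hα
  refine (isUnitriangular_macP hn lam).2.1 α ?_
  rw [← map_macPReg hζ, toFin_map, coeff_map]
  exact fun h => hα (regIncl_injective ζ (h.trans (map_zero _).symm))

theorem coeff_partVec_macPReg (hζ : ζ ≠ 0) (hn : n ≤ N) (lam : n.Partition) :
    coeff (partVec N lam) (toFin _ N (macPReg hζ lam)) = 1 := by
  have h := (isUnitriangular_macP hn lam).2.2
  rw [← map_macPReg hζ, toFin_map, coeff_map] at h
  exact regIncl_injective ζ (h.trans (map_one _).symm)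

theorem macOp_macPReg (hζ : ζ ≠ 0) (hn : n ≤ N) (x : ℕ) (lam : n.Partition) :
    macOp N (qReg ζ) (tReg ζ) (x : regularRing ζ) (macPReg hζ lam) =
      macEig (qReg ζ) (tReg ζ) (x : regularRing ζ) (partVec N lam) • macPReg hζ lam := by
  apply map_injective _ (regIncl_injective ζ)
  have h1 : regIncl ζ (qReg ζ) = q := rfl
  have h2 : regIncl ζ (tReg ζ) = t := rfl
  rw [map_macOp, smul_eq_C_mul, map_mul, map_C, map_macPReg, map_macEig, h1, h2, map_natCast,
    macOp_macP hn, smul_eq_C_mul]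

/-- The specialization `P_λ(x; q, ζ)`. -/
def macPSpec (hζ : ζ ≠ 0) (lam : n.Partition) : PSumRing (RatFunc ℂ) :=
  map (evalReg ζ) (macPReg hζ lam)

theorem isUnitriangular_macPSpec (hζ : ζ ≠ 0) (hn : n ≤ N) :
    IsUnitriangular N (macPSpec (n := n) hζ) := by
  intro lam
  refine ⟨(isWt_macPReg hζ lam).map _,
    fun α hα => lexBounded_macPReg hζ hn lam α fun h => hα ?_, ?_⟩
  · rw [macPSpec, toFin_map, coeff_map, h, map_zero]
  · rw [macPSpec, toFin_map, coeff_map, coeff_partVec_macPReg hζ hn, map_one]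

theorem macOp_macPSpec (hζ : ζ ≠ 0) (hn : n ≤ N) (x : ℕ) (lam : n.Partition) :
    macOp N RatFunc.X (RatFunc.C ζ) (x : RatFunc ℂ) (macPSpec hζ lam) =
      macEig RatFunc.X (RatFunc.C ζ) (x : RatFunc ℂ) (partVec N lam) • macPSpec hζ lam := by
  have h := congrArg (map (evalReg ζ)) (macOp_macPReg hζ hn x lam)
  rwa [map_macOp, smul_eq_C_mul, map_mul, map_C, map_macEig, evalReg_qReg, evalReg_tReg,
    map_natCast, ← smul_eq_C_mul] at h

end macPReg

/-! ### Specialization of symmetric functions in power sum coordinates -/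

section bridge

theorem map_powerSum {R S : Type*} [CommRing R] [CommRing S] (g : R →+* S) (k : ℕ+) :
    MvPowerSeries.map g (powerSum R k : MvPowerSeries ℕ R) = powerSum S k := by
  classical
  ext d
  rw [MvPowerSeries.coeff_map]
  change g (if _ then _ else _) = if _ then _ else _
  rw [apply_ite g, map_one, map_zero]

theorem coeff_aeval_powerSum_map {R S : Type*} [CommRing R] [CommRing S] (g : R →+* S)
    (f : PSumRing R) (d : ℕ →₀ ℕ) :
    MvPowerSeries.coeff d (aeval (powerSum S) (map g f) : MvPowerSeries ℕ S) =
      g (MvPowerSeries.coeff d (aeval (powerSum R) f : MvPowerSeries ℕ R)) := by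
  rw [← MvPowerSeries.coeff_map]
  congr 1
  induction f using MvPolynomial.induction_on with
  | C a =>
    rw [map_C, aeval_C, aeval_C]
    simp [MvPowerSeries.algebraMap_apply]
  | add f g hf hg => simp only [map_add, Subalgebra.coe_add, hf, hg]
  | mul_X f k hf => simp only [map_mul, map_X, aeval_X, Subalgebra.coe_mul, hf, map_powerSum]

theorem powerSumEquiv_apply {K : Type*} [Field K] [CharZero K] (f : PSumRing K) :
    powerSumEquiv K f = aeval (powerSum K) f := rfl

variable {ζ : ℂ}

theorem regularAt_powerSumEquiv_map (f : PSumRing (regularRing ζ)) :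
    RegularAt ζ (powerSumEquiv QT (map (regIncl ζ) f)) := by
  intro d
  rw [powerSumEquiv_apply, coeff_aeval_powerSum_map]
  exact SetLike.coe_mem (p := regularRing ζ) _

theorem specialize_powerSumEquiv_map (f : PSumRing (regularRing ζ)) :
    specialize ζ (powerSumEquiv QT (map (regIncl ζ) f)) =
      powerSumEquiv (RatFunc ℂ) (map (evalReg ζ) f) := by
  apply Subtype.ext
  ext d
  rw [powerSumEquiv_apply, powerSumEquiv_apply, coeff_aeval_powerSum_map]
  change RatFunc.eval _ _ (MvPowerSeries.coeff d _) = _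
  rw [coeff_aeval_powerSum_map, evalReg_apply]
  rfl

end bridge

/-! ### The functions `Q'` as a dual basis -/

section hall

variable {R S : Type*} [CommRing R] [Algebra ℚ R] [CommRing S] [Algebra ℚ S]

/-- The Hall inner product `⟨p_λ, p_μ⟩ = δ_{λμ} z_λ`. -/
def hallForm (R : Type*) [CommRing R] [Algebra ℚ R] : PSumRing R →ₗ[R] PSumRing R →ₗ[R] R :=
  psForm fun m => algebraMap ℚ R (zInv m)⁻¹

theorem hallForm_map (g : R →+* S) (f f' : PSumRing R) :
    hallForm S (map g f) (map g f') = g (hallForm R f f') := by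
  induction f using MvPolynomial.induction_on' with
  | monomial m c =>
    rw [map_monomial, hallForm, hallForm, psForm_monomial, psForm_monomial, coeff_map, map_mul,
      map_mul]
    congr 2
    exact (congrFun (congrArg DFunLike.coe
      (Subsingleton.elim (g.comp (algebraMap ℚ R)) (algebraMap ℚ S))) _).symm
  | add f h hf hh => simp only [map_add, LinearMap.add_apply, hf, hh]

theorem coeff_eq_hallForm (f : PSumRing R) (m : ℕ+ →₀ ℕ) :
    coeff m f = hallForm R f (monomial m (algebraMap ℚ R (zInv m))) := by
  rw [hallForm, psForm_apply_monomial, mul_assoc, ← map_mul, inv_mul_cancel₀ (zInv_ne_zero m),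
    map_one, mul_one]

end hall

section macQ

variable {n : ℕ}

/-- The substitution `p_k ↦ (1 - q^k) / (1 - t^k) p_k` in power sum coordinates. -/
def scaleHom : PSumRing QT →ₐ[QT] PSumRing QT :=
  aeval fun k : ℕ+ => C ((1 - q ^ (k : ℕ)) / (1 - t ^ (k : ℕ)) : QT) * X k

theorem primeHom_powerSumEquiv (f : PSumRing QT) :
    primeHom (powerSumEquiv QT f) = powerSumEquiv QT (scaleHom f) := by
  have h : (aeval fun k : ℕ+ => ((1 - q ^ (k : ℕ)) / (1 - t ^ (k : ℕ)) : QT) • powerSum QT k) =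
      (powerSumEquiv QT).toAlgHom.comp scaleHom := by
    apply MvPolynomial.algHom_ext
    intro k
    have h2 : powerSumEquiv QT (C ((1 - q ^ (k : ℕ)) / (1 - t ^ (k : ℕ)) : QT) * X k) =
        ((1 - q ^ (k : ℕ)) / (1 - t ^ (k : ℕ)) : QT) • powerSum QT k := by
      rw [← smul_eq_C_mul, map_smul, powerSumEquiv_X]
    rw [aeval_X, AlgHom.comp_apply, scaleHom, aeval_X]
    exact h2.symm
  rw [primeHom, AlgHom.comp_apply, h]
  have h3 : (powerSumEquiv QT).symm.toAlgHom (powerSumEquiv QT f) = f :=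
    (powerSumEquiv QT).symm_apply_apply f
  rw [h3]
  rfl

/-- The substitution transforms the form `⟨·, ·⟩_{q,t}` into the Hall inner product. -/
theorem hallForm_scaleHom (f g : PSumRing QT) :
    hallForm QT (scaleHom f) g = psForm (macZ q t) f g := by
  induction f using MvPolynomial.induction_on' with
  | monomial m c =>
    have h : scaleHom (monomial m c) =
        monomial m (c * m.prod fun k e => ((1 - q ^ (k : ℕ)) / (1 - t ^ (k : ℕ)) : QT) ^ e) := by
      rw [scaleHom, aeval_monomial, algebraMap_eq, monomial_eq, C_mul, mul_assoc]
      congr 1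
      simp only [Finsupp.prod, map_prod, map_pow, mul_pow, Finset.prod_mul_distrib]
    rw [h, hallForm, psForm_monomial, psForm_monomial, macZ, mul_inv, Finsupp.prod, Finsupp.prod,
      ← Finset.prod_inv_distrib]
    have h2 : ∀ k ∈ m.support, (macRatio q t k ^ m k)⁻¹ =
        ((1 - q ^ (k : ℕ)) / (1 - t ^ (k : ℕ))) ^ m k := by
      intro k _
      rw [macRatio, ← inv_pow, inv_div]
    rw [Finset.prod_congr rfl h2, map_inv₀]
    ring
  | add f h hf hh => simp only [map_add, LinearMap.add_apply, hf, hh]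

/-- `Q'_μ` in power sum coordinates. -/
def macQ' (mu : n.Partition) : PSumRing QT :=
  (psForm (macZ q t) (macP mu) (macP mu))⁻¹ • scaleHom (macP mu)

theorem powerSumEquiv_macQ' (mu : n.Partition) : powerSumEquiv QT (macQ' mu) = macdonaldQ' mu := by
  rw [macQ', macdonaldQ', macdonaldQ, map_smul, map_smul, ← powerSumEquiv_macP,
    primeHom_powerSumEquiv, innerQT_powerSumEquiv]

/-- The `Q'_μ` are dual to the `P_λ` for the Hall inner product. -/
theorem hallForm_macQ'_sum (mu : n.Partition) (c : n.Partition → QT) :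
    hallForm QT (macQ' mu) (∑ lam, c lam • macP lam) = c mu := by
  rw [macQ', map_smul, LinearMap.smul_apply, hallForm_scaleHom,
    psForm_comm _ _ (∑ lam, c lam • macP lam), psForm_sum_macP, smul_eq_mul, mul_comm (c mu),
    inv_mul_cancel_left₀ (psForm_self_ne_zero (macP_ne_zero mu))]

theorem isWt_macQ' (mu : n.Partition) : IsWt (macQ' mu) n := by
  refine IsWt.smul (isWt_of_coeff fun m hm => ?_) _
  rw [coeff_eq_hallForm, hallForm_scaleHom, psForm_apply_monomial,
    (isUnitriangular_macP le_rfl mu).1.coeff_eq_zero hm, zero_mul, zero_mul]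

variable {ζ : ℂ}

/-- Expansion in the `P_λ` preserves regularity at `t = ζ`, since these are unitriangular. -/
theorem mem_regularRing_of_sum_macP (hζ : ζ ≠ 0) (f : PSumRing (regularRing ζ))
    (c : n.Partition → QT) (h : map (regIncl ζ) f = ∑ lam, c lam • macP lam) (lam : n.Partition) :
    c lam ∈ regularRing ζ := by
  classical
  have : IsTrans n.Partition (Function.swap lexLT) :=
    ⟨fun a b c h1 h2 => lt_trans (a := partsList c) h2 h1⟩
  have : Std.Irrefl (Function.swap (lexLT (n := n))) := ⟨fun a => lt_irrefl (partsList a)⟩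
  -- downward induction: the coefficient of the exponent `λ` only sees the `P_μ` with `μ ≥ λ`
  have hwf : WellFounded (Function.swap (lexLT (n := n))) :=
    Finite.wellFounded_of_trans_of_irrefl _
  induction lam using hwf.induction with
  | _ lam ih =>
    have h1 := congrArg (fun g => coeff (partVec n lam) (toFin QT n g)) h
    simp only [map_sum, coeff_sum, map_smul, coeff_smul, smul_eq_mul] at h1
    rw [← Finset.add_sum_erase _ _ (Finset.mem_univ lam),
      (isUnitriangular_macP le_rfl lam).2.2, mul_one] at h1
    have hreg : ∀ g : PSumRing (regularRing ζ),
        coeff (partVec n lam) (toFin QT n (map (regIncl ζ) g)) ∈ regularRing ζ := by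
      intro g
      rw [toFin_map, coeff_map]
      exact SetLike.coe_mem _
    rw [← sub_eq_iff_eq_add] at h1
    rw [← h1]
    refine sub_mem (hreg f) (sum_mem fun mu hmu => ?_)
    by_cases h2 : coeff (partVec n lam) (toFin QT n (macP mu)) = 0
    · rw [h2, mul_zero]
      exact zero_mem _
    refine mul_mem (ih mu ?_) ?_
    · rw [Function.swap, ← toLex_partVec_lt_iff le_rfl]
      refine lt_of_le_of_ne ((isUnitriangular_macP le_rfl mu).2.1 _ h2) fun h3 => ?_
      exact (Finset.ne_of_mem_erase hmu) (partVec_injective le_rfl (toLex.injective h3)).symm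
    · rw [← map_macPReg hζ]
      exact hreg _

/-- The coefficients of `Q'_μ` have no pole at `t = ζ`: they are, up to rational factors,
coefficients in the expansions of the power sum products in the `P_λ`. -/
theorem exists_map_eq_macQ' (hζ : ζ ≠ 0) (mu : n.Partition) :
    ∃ g : PSumRing (regularRing ζ), map (regIncl ζ) g = macQ' mu := by
  have h : ∀ m, coeff m (macQ' mu) ∈ regularRing ζ := by
    intro m
    by_cases hm : wt m = n
    · have hw : IsWt (monomial m (algebraMap ℚ (regularRing ζ) (zInv m))) n :=
        isWt_of_coeff fun m' hm' => by
          classical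
          rw [coeff_monomial, if_neg]
          rintro rfl
          exact hm' hm
      obtain ⟨c, hc⟩ := (isUnitriangular_macP le_rfl).exists_sum le_rfl (hw.map (regIncl ζ))
      have h1 := mem_regularRing_of_sum_macP hζ _ c hc mu
      rw [map_monomial] at hc
      rw [coeff_eq_hallForm]
      have h2 : regIncl ζ (algebraMap ℚ (regularRing ζ) (zInv m)) = algebraMap ℚ QT (zInv m) := rfl
      rw [← h2, hc, hallForm_macQ'_sum]
      exact h1
    · rw [(isWt_macQ' mu).coeff_eq_zero hm]
      exact zero_mem _
  refine ⟨∑ m ∈ wtFinset n, monomial m ⟨coeff m (macQ' mu), h m⟩, ?_⟩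
  conv_rhs => rw [(isWt_macQ' mu).as_sum]
  rw [map_sum]
  exact Finset.sum_congr rfl fun m _ => map_monomial _ _ _

/-- `Q'_μ` over the regular rational functions. -/
def macQReg (hζ : ζ ≠ 0) (mu : n.Partition) : PSumRing (regularRing ζ) :=
  (exists_map_eq_macQ' hζ mu).choose

theorem map_macQReg (hζ : ζ ≠ 0) (mu : n.Partition) :
    map (regIncl ζ) (macQReg hζ mu) = macQ' mu := (exists_map_eq_macQ' hζ mu).choose_spec

/-- The specialization `Q'_μ(x; q, ζ)` in power sum coordinates. -/
def macQSpec (hζ : ζ ≠ 0) (mu : n.Partition) : PSumRing (RatFunc ℂ) :=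
  map (evalReg ζ) (macQReg hζ mu)

theorem regularAt_macdonaldQ' (hζ : ζ ≠ 0) (mu : n.Partition) :
    RegularAt ζ (macdonaldQ' mu) := by
  rw [← powerSumEquiv_macQ', ← map_macQReg hζ]
  exact regularAt_powerSumEquiv_map _

theorem specialize_macdonaldQ' (hζ : ζ ≠ 0) (mu : n.Partition) :
    specialize ζ (macdonaldQ' mu) = powerSumEquiv (RatFunc ℂ) (macQSpec hζ mu) := by
  rw [← powerSumEquiv_macQ', ← map_macQReg hζ]
  exact specialize_powerSumEquiv_map _

theorem isWt_macQSpec (hζ : ζ ≠ 0) (mu : n.Partition) : IsWt (macQSpec hζ mu) n := by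
  refine IsWt.map (isWt_of_coeff fun m hm => ?_) _
  have h := (isWt_macQ' mu).coeff_eq_zero hm
  rw [← map_macQReg hζ, coeff_map] at h
  exact regIncl_injective ζ (h.trans (map_zero _).symm)

open Classical in
theorem hallForm_macQSpec_macPSpec (hζ : ζ ≠ 0) (mu lam : n.Partition) :
    hallForm (RatFunc ℂ) (macQSpec hζ mu) (macPSpec hζ lam) = if lam = mu then 1 else 0 := by
  have h : hallForm QT (macQ' mu) (macP lam) = if lam = mu then 1 else 0 := by
    have h1 := hallForm_macQ'_sum mu (Pi.single lam (1 : QT))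
    rw [Finset.sum_eq_single lam (fun nu _ hnu => by rw [Pi.single_eq_of_ne hnu, zero_smul])
      (by simp), Pi.single_eq_same, one_smul] at h1
    rw [h1, Pi.single_apply]
    simp only [eq_comm]
  rw [← map_macQReg hζ, ← map_macPReg hζ, hallForm_map] at h
  have h2 : hallForm (regularRing ζ) (macQReg hζ mu) (macPReg hζ lam) = if lam = mu then 1 else 0 :=
    regIncl_injective ζ (by rw [h, apply_ite (regIncl ζ), map_one, map_zero])
  rw [macQSpec, macPSpec, hallForm_map, h2, apply_ite (evalReg ζ), map_one, map_zero]

/-- An element of degree `n` is determined by its products with the `P_λ(x; q, ζ)`. -/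
theorem eq_of_hallForm_macPSpec (hζ : ζ ≠ 0) {f g : PSumRing (RatFunc ℂ)} (hf : IsWt f n)
    (hg : IsWt g n) (h : ∀ lam : n.Partition, hallForm _ f (macPSpec hζ lam) =
      hallForm _ g (macPSpec hζ lam)) : f = g := by
  ext m
  by_cases hm : wt m = n
  · have hw : IsWt (monomial m (algebraMap ℚ (RatFunc ℂ) (zInv m))) n :=
      isWt_of_coeff fun m' hm' => by
        classical
        rw [coeff_monomial, if_neg]
        rintro rfl
        exact hm' hm
    obtain ⟨c, hc⟩ := (isUnitriangular_macPSpec hζ le_rfl).exists_sum le_rfl hw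
    rw [coeff_eq_hallForm, coeff_eq_hallForm, hc, map_sum, map_sum]
    refine Finset.sum_congr rfl fun lam _ => ?_
    rw [map_smul, map_smul, h]
  · rw [hf.coeff_eq_zero hm, hg.coeff_eq_zero hm]

end macQ

/-! ### Adjoining a string of variables -/

section string

variable {R : Type*} [CommRing R]

/-- The substitution `p_k ↦ p_k + l z ^ k` for `l ∣ k`, `p_k ↦ p_k` otherwise. When `ζ` is a
primitive `l`-th root of unity, it adjoins the variables `z, ζ z, …, ζ ^ (l - 1) z`. -/
def stringHom (R : Type*) [CommRing R] (l : ℕ) : PSumRing R →ₐ[R] Polynomial (PSumRing R) :=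
  aeval fun k => Polynomial.C (X k) +
    Polynomial.monomial (k : ℕ) (C (if l ∣ k then (l : R) else 0))

/-- The coefficient of `z ^ j` after adjoining the string `z, ζ z, …, ζ ^ (l - 1) z`. -/
def stringCoeff (R : Type*) [CommRing R] (l j : ℕ) : PSumRing R →ₗ[R] PSumRing R :=
  (Polynomial.lcoeff (PSumRing R) j).restrictScalars R ∘ₗ (stringHom R l).toLinearMap

theorem stringCoeff_apply (l j : ℕ) (f : PSumRing R) :
    stringCoeff R l j f = (stringHom R l f).coeff j := rfl

theorem stringCoeff_C (l j : ℕ) (a : R) :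
    stringCoeff R l j (C a) = if j = 0 then C a else 0 := by
  rw [stringCoeff_apply, stringHom, aeval_C]
  have : algebraMap R (Polynomial (PSumRing R)) a = Polynomial.C (C a) := rfl
  rw [this, Polynomial.coeff_C]

theorem stringCoeff_mul_X (l j : ℕ) (f : PSumRing R) (k : ℕ+) :
    stringCoeff R l j (f * X k) = stringCoeff R l j f * X k +
      if (k : ℕ) ≤ j then (if l ∣ k then (l : R) else 0) • stringCoeff R l (j - k) f else 0 := by
  have h : stringHom R l (X k) = Polynomial.C (X k) +
      Polynomial.C (C (if l ∣ k then (l : R) else 0)) * Polynomial.X ^ (k : ℕ) := by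
    rw [stringHom, aeval_X, Polynomial.C_mul_X_pow_eq_monomial]
  rw [stringCoeff_apply, map_mul, h, mul_add, Polynomial.coeff_add, Polynomial.coeff_mul_C,
    ← stringCoeff_apply]
  congr 1
  rw [← mul_assoc, Polynomial.coeff_mul_X_pow']
  refine if_congr Iff.rfl ?_ rfl
  rw [Polynomial.coeff_mul_C, smul_eq_C_mul, mul_comm, stringCoeff_apply]

variable [Algebra ℚ R]

/-- Multiplication by `p_k` is adjoint to `k ∂/∂p_k` for the Hall inner product. -/
theorem hallForm_mul_X (h f : PSumRing R) (k : ℕ+) :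
    hallForm R h (f * X k) = hallForm R (((k : ℕ) : R) • pderiv k h) f := by
  classical
  induction h using MvPolynomial.induction_on' with
  | monomial m c =>
    rw [pderiv_monomial, smul_monomial, hallForm, psForm_monomial, psForm_monomial, coeff_mul_X']
    by_cases hk : k ∈ m.support
    · rw [if_pos hk]
      obtain ⟨m', rfl⟩ : ∃ m', m = m' + Finsupp.single k 1 :=
        ⟨m - Finsupp.single k 1, (Finsupp.sub_add_single_one_cancel
          (Finsupp.mem_support_iff.mp hk)).symm⟩
      have h1 : algebraMap ℚ R (zInv (m' + Finsupp.single k 1))⁻¹ =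
          ((k : ℕ) : R) * ((m' k + 1 : ℕ) : R) * algebraMap ℚ R (zInv m')⁻¹ := by
        have h2 : ((k : ℕ) : R) * ((m' k + 1 : ℕ) : R) =
            algebraMap ℚ R (((k : ℕ) : ℚ) * ((m' k + 1 : ℕ) : ℚ)) := by simp
        rw [h2, ← map_mul, ← zInv_add_single m' k]
        congr 1
        have := zInv_ne_zero (m' + Finsupp.single k 1)
        have hk0 : ((k : ℕ) : ℚ) ≠ 0 := by simp
        have : (m' k : ℚ) + 1 ≠ 0 := by positivity
        push_cast
        field_simp
      rw [add_tsub_cancel_right, h1]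
      simp only [Finsupp.add_apply, Finsupp.single_eq_same, smul_eq_mul]
      ring
    · rw [if_neg hk, Finsupp.notMem_support_iff.mp hk]
      simp
  | add f g hf hg => simp only [map_add, LinearMap.add_apply, hf, hg, smul_add]

/-- The series `exp (∑ l p_k s ^ k / k)`, summed over the multiples `k` of `l`. -/
def stringPoly (R : Type*) [CommRing R] [Algebra ℚ R] (l j : ℕ) : PSumRing R :=
  expPoly (fun k => if l ∣ k then (l : R) else 0) j

/-- Taking the coefficient of `z ^ j` is adjoint to a multiplication. -/
theorem hallForm_stringPoly_mul (l j : ℕ) (g f : PSumRing R) :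
    hallForm R (stringPoly R l j * g) f = hallForm R g (stringCoeff R l j f) := by
  induction f using MvPolynomial.induction_on generalizing j g with
  | C a =>
    have h : ∀ g : PSumRing R, hallForm R g (C a) = coeff 0 g * a := by
      intro g
      rw [← monomial_zero', hallForm, psForm_apply_monomial]
      simp [zInv]
    rw [stringCoeff_C, h]
    split_ifs with hj
    · rw [hj, stringPoly, expPoly_zero, one_mul, h]
    · rw [map_zero, ← constantCoeff_eq, map_mul, constantCoeff_eq, stringPoly, coeff_expPoly,
        if_neg (by rw [map_zero]; exact Ne.symm hj), zero_mul, zero_mul]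
  | add f h hf hh => simp only [map_add, hf, hh]
  | mul_X f k hf =>
    rw [hallForm_mul_X, stringCoeff_mul_X, map_add, Derivation.leibniz, smul_add, map_add,
      LinearMap.add_apply, smul_eq_mul, smul_eq_mul, ← mul_smul_comm, hf, ← hallForm_mul_X]
    congr 1
    by_cases hkj : (k : ℕ) ≤ j
    · rw [if_pos hkj]
      obtain ⟨i, rfl⟩ := Nat.exists_eq_add_of_le' hkj
      rw [← mul_smul_comm, stringPoly, pderiv_expPoly, Nat.add_sub_cancel, map_smul, ← hf,
        mul_smul_comm, mul_comm g, map_smul, LinearMap.smul_apply]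
      rfl
    · rw [if_neg hkj, stringPoly, pderiv_expPoly_of_lt _ _ _ (by omega), mul_zero, smul_zero,
        map_zero, LinearMap.zero_apply, map_zero]

theorem isWt_stringPoly (l j : ℕ) : IsWt (stringPoly R l j) j := isWt_expPoly _ _

theorem isWt_stringCoeff {f : PSumRing R} {l j n : ℕ} (hf : IsWt f (j + n)) :
    IsWt (stringCoeff R l j f) n := by
  classical
  refine isWt_of_coeff fun m hm => ?_
  have hw : IsWt (monomial m (algebraMap ℚ R (zInv m))) (wt m) :=
    isWt_of_coeff fun m' hm' => by
      rw [coeff_monomial, if_neg]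
      rintro rfl
      exact hm' rfl
  -- read off from the adjoint, for which the degrees are evident
  have hw2 := (isWt_stringPoly (R := R) l j).mul hw
  rw [coeff_eq_hallForm, hallForm, psForm_comm, ← hallForm, ← hallForm_stringPoly_mul, hallForm,
    psForm_apply]
  refine Finset.sum_eq_zero fun m' _ => ?_
  by_cases h : wt m' = j + n
  · rw [IsWt.coeff_eq_zero hw2 (by omega), zero_mul, zero_mul]
  · rw [hf.coeff_eq_zero h, mul_zero]

end string

/-! ### Macdonald's operator and strings of variables -/

section append

variable {R : Type*} [CommRing R] {l N : ℕ}

theorem vandermondeDet_append (a : Fin l → R) (b : Fin N → R) :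
    vandermondeDet (Fin.append a b) =
      vandermondeDet a * vandermondeDet b * ∏ j, ∏ i, (a i - b j) := by
  have h1 : ∀ (i : Fin l) (j : Fin N), Fin.castAdd N i < Fin.natAdd l j := by
    intro i j
    rw [Fin.lt_def, Fin.val_castAdd, Fin.val_natAdd]
    omega
  have h2 : ∀ (i : Fin l) (j : Fin N), ¬ Fin.natAdd l j < Fin.castAdd N i :=
    fun i j => not_lt.mpr (h1 i j).le
  have h3 : ∀ i j : Fin l, Fin.castAdd N i < Fin.castAdd N j ↔ i < j := fun i j => Iff.rfl
  have h4 : ∀ i j : Fin N, Fin.natAdd l i < Fin.natAdd l j ↔ i < j := by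
    intro i j
    rw [Fin.lt_def, Fin.lt_def, Fin.val_natAdd, Fin.val_natAdd]
    omega
  rw [vandermondeDet_eq_prod, vandermondeDet_eq_prod, vandermondeDet_eq_prod, Fin.prod_univ_add]
  simp only [Fin.prod_univ_add, Fin.append_left, Fin.append_right, h1, h2, h3, h4, if_true,
    if_false, Finset.prod_const_one, one_mul, Finset.prod_mul_distrib]
  rw [Finset.prod_comm (f := fun i j => a i - b j)]
  ring

/-- The subset of `Fin (l + N)` made of a subset of the first `l` and one of the last `N`
indices. -/
def finsetAppend (l N : ℕ) : Finset (Fin l) × Finset (Fin N) ≃ Finset (Fin (l + N)) :=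
  (Finset.sumEquiv (α := Fin l) (β := Fin N)).symm.toEquiv.trans finSumFinEquiv.finsetCongr

theorem card_finsetAppend (p : Finset (Fin l) × Finset (Fin N)) :
    (finsetAppend l N p).card = p.1.card + p.2.card := by
  simp [finsetAppend, Equiv.finsetCongr_apply]

theorem castAdd_mem_finsetAppend (p : Finset (Fin l) × Finset (Fin N)) (i : Fin l) :
    Fin.castAdd N i ∈ finsetAppend l N p ↔ i ∈ p.1 := by
  rw [← finSumFinEquiv_apply_left, finsetAppend, Equiv.trans_apply, Equiv.finsetCongr_apply,
    Finset.mem_map_equiv, Equiv.symm_apply_apply]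
  simp

theorem natAdd_mem_finsetAppend (p : Finset (Fin l) × Finset (Fin N)) (i : Fin N) :
    Fin.natAdd l i ∈ finsetAppend l N p ↔ i ∈ p.2 := by
  rw [← finSumFinEquiv_apply_right, finsetAppend, Equiv.trans_apply, Equiv.finsetCongr_apply,
    Finset.mem_map_equiv, Equiv.symm_apply_apply]
  simp

theorem scaleOn_finsetAppend (p : Finset (Fin l) × Finset (Fin N)) (c : R) (a : Fin l → R)
    (b : Fin N → R) : scaleOn (finsetAppend l N p) c (Fin.append a b) =
      Fin.append (scaleOn p.1 c a) (scaleOn p.2 c b) := by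
  ext i
  induction i using Fin.addCases with
  | left i =>
    simp only [scaleOn, castAdd_mem_finsetAppend, Fin.append_left]
  | right i =>
    simp only [scaleOn, natAdd_mem_finsetAppend, Fin.append_right]

theorem vandermondeDet_comp_perm (a : Fin N → R) (σ : Equiv.Perm (Fin N)) :
    vandermondeDet (a ∘ σ) = (Equiv.Perm.sign σ : ℤ) * vandermondeDet a := by
  rw [vandermondeDet, vandermondeDet, alternant, alternant, ← Matrix.det_permute']
  rfl

end append

section string

variable {K : Type*} [Field K] {l N : ℕ} {t : K}

/-- The string `z, t z, …, t ^ (l - 1) z`. -/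
def stringVec (l : ℕ) (t z : K) : Fin l → K := fun i => z * t ^ (i : ℕ)

/-- Multiplication by `t` shifts the string cyclically. -/
theorem mul_stringVec (ht : t ^ (l + 1) = 1) (z : K) (i : Fin (l + 1)) :
    t * stringVec (l + 1) t z i = stringVec (l + 1) t z (i + 1) := by
  have h : ((i + 1 : Fin (l + 1)) : ℕ) = ((i : ℕ) + 1) % (l + 1) := by
    rw [Fin.val_add, Fin.val_one', Nat.add_mod_mod]
  rw [stringVec, stringVec, h, ← pow_eq_pow_mod _ ht, pow_succ]
  ring

/-- When a part of a string is multiplied by `t`, two coordinates become equal. -/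
theorem vandermondeDet_scaleOn_stringVec_eq_zero (ht : IsPrimitiveRoot t l) (z : K)
    {I : Finset (Fin l)} (h0 : I ≠ ∅) (h1 : I ≠ Finset.univ) :
    vandermondeDet (scaleOn I t (stringVec l t z)) = 0 := by
  obtain ⟨i₀, hi₀⟩ := Finset.nonempty_iff_ne_empty.mpr h0
  obtain ⟨l, rfl⟩ : ∃ l', l = l' + 1 := ⟨l - 1, by have := i₀.2; omega⟩
  -- a nonempty set of indices closed under the cyclic successor would be everything
  obtain ⟨i, hi, hi2⟩ : ∃ i ∈ I, i + 1 ∉ I := by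
    by_contra hcon
    push Not at hcon
    refine h1 (Finset.eq_univ_iff_forall.mpr fun j => ?_)
    have h2 : ∀ k : ℕ, i₀ + Fin.ofNat (l + 1) k ∈ I := by
      intro k
      induction k with
      | zero =>
        have : Fin.ofNat (l + 1) 0 = 0 := rfl
        rwa [this, add_zero]
      | succ k ih =>
        have : Fin.ofNat (l + 1) (k + 1) = Fin.ofNat (l + 1) k + 1 := by
          ext
          simp [Fin.val_add]
        rw [this, ← add_assoc]
        exact hcon _ ih
    have h3 := h2 (j - i₀ : Fin (l + 1)).val
    have h4 : Fin.ofNat (l + 1) (j - i₀ : Fin (l + 1)).val = j - i₀ :=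
      Fin.ext (Nat.mod_eq_of_lt (j - i₀).2)
    rwa [h4, add_sub_cancel] at h3
  refine vandermondeDet_eq_zero (i := i) (j := i + 1) (fun h => hi2 (h ▸ hi)) ?_
  rw [scaleOn, if_pos hi, scaleOn, if_neg hi2, mul_stringVec ht.pow_eq_one]

/-- Multiplying the whole string by `t` is a cyclic permutation, of sign `(-1) ^ (l - 1)`. -/
theorem vandermondeDet_scaleOn_univ_stringVec (hl : 0 < l) (ht : IsPrimitiveRoot t l) (z : K) :
    vandermondeDet (scaleOn Finset.univ t (stringVec l t z)) =
      -(-1) ^ l * vandermondeDet (stringVec l t z) := by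
  obtain ⟨l, rfl⟩ : ∃ l', l = l' + 1 := ⟨l - 1, by omega⟩
  have h : scaleOn Finset.univ t (stringVec (l + 1) t z) =
      stringVec (l + 1) t z ∘ finRotate (l + 1) := by
    ext i
    rw [scaleOn, if_pos (Finset.mem_univ i), mul_stringVec ht.pow_eq_one, Function.comp_apply,
      finRotate_apply]
  rw [h, vandermondeDet_comp_perm, sign_finRotate]
  push_cast
  rw [pow_succ]
  ring

theorem stringVec_injective (ht : IsPrimitiveRoot t l) {z : K} (hz : z ≠ 0) :
    Function.Injective (stringVec l t z) := by
  intro i j h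
  exact Fin.ext (ht.pow_inj i.2 j.2 (mul_left_cancel₀ hz h))

theorem prod_stringVec_sub (hl : 0 < l) (ht : IsPrimitiveRoot t l) (z y : K) :
    ∏ i, (stringVec l t z i - y) = (-1) ^ l * (y ^ l - z ^ l) := by
  have h := congrArg (Polynomial.eval y) (X_pow_sub_C_eq_prod ht hl (rfl : z ^ l = z ^ l))
  rw [Polynomial.eval_prod] at h
  simp only [Polynomial.eval_sub, Polynomial.eval_pow, Polynomial.eval_X, Polynomial.eval_C] at h
  rw [h, ← Fin.prod_univ_eq_prod_range (fun i => y - t ^ i * z)]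
  have h2 : ((-1 : K)) ^ l = ∏ _i : Fin l, (-1) := by simp
  rw [h2, ← Finset.prod_mul_distrib]
  refine Finset.prod_congr rfl fun i _ => ?_
  rw [stringVec]
  ring

theorem prod_one_add_stringVec (hl : 0 < l) (ht : IsPrimitiveRoot t l) (z : K) :
    ∏ i, (1 + stringVec l t z i) = 1 - (-z) ^ l := by
  have h := prod_stringVec_sub hl ht z (-1)
  have h2 : ∏ i, (1 + stringVec l t z i) = ∏ i, (stringVec l t z i - -1) :=
    Finset.prod_congr rfl fun i _ => by ring
  rw [h2, h, mul_sub, ← mul_pow, ← mul_pow]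
  simp

/-- `stringHom` does adjoin a string of variables. -/
theorem evalAt_append_stringVec {S : Type*} [CommRing S] [Algebra K S] (ht : IsPrimitiveRoot t l)
    (z : S) (b : Fin N → S) (f : PSumRing K) :
    evalAt (Fin.append (fun i : Fin l => z * algebraMap K S t ^ (i : ℕ)) b) f =
      Polynomial.eval₂ (evalAt (R := K) b : PSumRing K →+* S) z (stringHom K l f) := by
  induction f using MvPolynomial.induction_on with
  | C a =>
    have h : stringHom K l (C a) = Polynomial.C (C a) := aeval_C _ _
    rw [h, Polynomial.eval₂_C]
    have h2 : ∀ {M : ℕ} (b : Fin M → S), evalAt (R := K) b (C a) = algebraMap K S a :=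
      fun b => aeval_C _ _
    exact (h2 _).trans (h2 _).symm
  | add f g hf hg => rw [map_add, map_add, Polynomial.eval₂_add, hf, hg]
  | mul_X f k hf =>
    have hg : ∑ i : Fin l, (t ^ (i : ℕ)) ^ (k : ℕ) = if l ∣ k then (l : K) else 0 := by
      have h1 : ∀ i : Fin l, (t ^ (i : ℕ)) ^ (k : ℕ) = (t ^ (k : ℕ)) ^ (i : ℕ) :=
        fun i => pow_right_comm _ _ _
      simp only [h1]
      split_ifs with h
      · simp [(ht.pow_eq_one_iff_dvd _).mpr h]
      · have h2 : t ^ (k : ℕ) ≠ 1 := fun h3 => h ((ht.pow_eq_one_iff_dvd _).mp h3)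
        have h3 := geom_sum_mul (t ^ (k : ℕ)) l
        rw [pow_right_comm, ht.pow_eq_one, one_pow, sub_self, mul_comm] at h3
        rw [Fin.sum_univ_eq_sum_range fun i => (t ^ (k : ℕ)) ^ i]
        exact (mul_eq_zero.mp h3).resolve_left (sub_ne_zero.mpr h2)
    have hg' := congrArg (algebraMap K S) hg
    rw [map_sum] at hg'
    simp only [map_pow] at hg'
    rw [map_mul, map_mul, Polynomial.eval₂_mul, hf, evalAt_X, Fin.sum_univ_add]
    congr 1
    simp only [Fin.append_left, Fin.append_right, mul_pow]
    rw [← Finset.mul_sum, hg', stringHom, aeval_X, Polynomial.eval₂_add, Polynomial.eval₂_C,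
      Polynomial.eval₂_monomial]
    have h4 : ∀ c : K, (evalAt (R := K) b : PSumRing K →+* S) (C c) = algebraMap K S c :=
      fun c => aeval_C _ _
    have h5 : (evalAt (R := K) b : PSumRing K →+* S) (X k) = ∑ i, b i ^ (k : ℕ) := aeval_X _ _
    rw [h4, h5]
    ring

theorem evalAt_append_stringVec_eq_eval (ht : IsPrimitiveRoot t l) (z : K) (b : Fin N → K)
    (f : PSumRing K) : evalAt (Fin.append (stringVec l t z) b) f = Polynomial.eval z
      ((stringHom K l f).map (evalAt (R := K) b : PSumRing K →+* K)) := by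
  rw [Polynomial.eval_map, ← evalAt_append_stringVec ht]
  rfl

variable [CharZero K]

/-- At a primitive `l`-th root of unity `t`, Macdonald's operator in `l + N` variables factors
along a string `z, t z, …, t ^ (l - 1) z`: in its expression as a `q`-difference operator only the
subsets survive that contain the string or are disjoint from it. -/
theorem vandermondeDet_mul_evalAt_append_macOp (hl : 0 < l) (ht : IsPrimitiveRoot t l) (q x : K)
    {z : K} {b : Fin N → K} (hz : z ≠ 0) (hzb : ∀ j, b j ^ l ≠ z ^ l) (f : PSumRing K) :
    vandermondeDet b * evalAt (Fin.append (stringVec l t z) b) (macOp (l + N) q t x f) =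
      ∑ I : Finset (Fin N), x ^ I.card * vandermondeDet (scaleOn I t b) *
        (evalAt (Fin.append (stringVec l t z) (scaleOn I q b)) f -
          (-x) ^ l * evalAt (Fin.append (stringVec l t (q * z)) (scaleOn I q b)) f) := by
  set s := stringVec l t z with hs
  -- the product of the differences between the string and `b`; it only involves `l`-th powers, so
  -- it does not change when coordinates are multiplied by `t`
  set c := ∏ j, ((-1) ^ l * (b j ^ l - z ^ l)) with hc
  have hc0 : c ≠ 0 := Finset.prod_ne_zero_iff.mpr fun j _ =>
    mul_ne_zero (pow_ne_zero _ (neg_ne_zero.mpr one_ne_zero)) (sub_ne_zero.mpr (hzb j))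
  have hs0 : vandermondeDet s ≠ 0 := vandermondeDet_ne_zero (stringVec_injective ht hz)
  have hscale : ∀ I : Finset (Fin N), ∏ j, ((-1) ^ l * (scaleOn I t b j ^ l - z ^ l)) = c := by
    intro I
    refine Finset.prod_congr rfl fun j _ => ?_
    rw [scaleOn]
    split_ifs
    · rw [mul_pow, ht.pow_eq_one, one_mul]
    · rfl
  have hempty : ∀ c : K, scaleOn ∅ c s = s := by
    intro c
    ext i
    rw [scaleOn, if_neg (Finset.notMem_empty i)]
  have huniv : ∀ c : K, scaleOn Finset.univ c s = stringVec l t (c * z) := by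
    intro c
    ext i
    rw [scaleOn, if_pos (Finset.mem_univ i), hs, stringVec, stringVec, mul_assoc]
  have hne : (∅ : Finset (Fin l)) ≠ Finset.univ := by
    have : Nonempty (Fin l) := ⟨⟨0, hl⟩⟩
    exact Finset.univ_nonempty.ne_empty.symm
  have h := vandermondeDet_mul_evalAt_macOp (Fin.append s b) q t x f
  rw [← Equiv.sum_comp (finsetAppend l N), Fintype.sum_prod_type, Finset.sum_comm] at h
  simp only [card_finsetAppend, scaleOn_finsetAppend, vandermondeDet_append] at h
  have hI : ∀ I : Finset (Fin N), ∑ J : Finset (Fin l), x ^ (J.card + I.card) *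
      (vandermondeDet (scaleOn J t s) * vandermondeDet (scaleOn I t b) *
        (∏ j, ∏ i, (scaleOn J t s i - scaleOn I t b j)) *
          evalAt (Fin.append (scaleOn J q s) (scaleOn I q b)) f) =
      vandermondeDet s * c * (x ^ I.card * vandermondeDet (scaleOn I t b) *
        (evalAt (Fin.append (stringVec l t z) (scaleOn I q b)) f -
          (-x) ^ l * evalAt (Fin.append (stringVec l t (q * z)) (scaleOn I q b)) f)) := by
    intro I
    rw [← Finset.sum_subset (Finset.subset_univ {∅, Finset.univ}), Finset.sum_pair hne, hempty,
      hempty, huniv q, vandermondeDet_scaleOn_univ_stringVec hl ht, huniv t]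
    · simp only [hs, prod_stringVec_sub hl ht, mul_pow, ht.pow_eq_one, one_mul, hscale,
        Finset.card_empty, Finset.card_univ, Fintype.card_fin]
      rw [neg_pow x, zero_add, pow_add]
      ring
    · intro J _ hJ
      rw [Finset.mem_insert, Finset.mem_singleton, not_or] at hJ
      rw [vandermondeDet_scaleOn_stringVec_eq_zero ht z hJ.1 hJ.2]
      ring
  rw [Finset.sum_congr rfl fun I _ => hI I, ← Finset.mul_sum] at h
  simp only [hs, prod_stringVec_sub hl ht] at h
  refine mul_left_cancel₀ (mul_ne_zero hs0 hc0) (Eq.trans ?_ h)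
  ring

/-- Coefficient form of the factorization of Macdonald's operator along a string. -/
theorem stringCoeff_macOp (hl : 0 < l) (ht : IsPrimitiveRoot t l) (q x : K) {n j : ℕ}
    {f : PSumRing K} (hf : IsWt f (j + n)) (hn : n ≤ N) :
    stringCoeff K l j (macOp (l + N) q t x f) =
      (1 - (-x) ^ l * q ^ j) • macOp N q t x (stringCoeff K l j f) := by
  refine sub_eq_zero.mp (IsWt.eq_zero_of_evalAt (N := N) (n := n) ?_ hn fun b hb => ?_)
  · exact (isWt_stringCoeff (isWt_macOp hf q t x)).sub
      ((isWt_macOp (isWt_stringCoeff hf) q t x).smul _)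
  let Z : (Fin N → K) → PSumRing K → Polynomial K := fun b f =>
    (stringHom K l f).map (evalAt (R := K) b : PSumRing K →+* K)
  have hZ : ∀ b f j, (Z b f).coeff j = evalAt b (stringCoeff K l j f) := fun b f j =>
    Polynomial.coeff_map _ _
  -- the factorization holds for all but finitely many `z`, hence as an identity of polynomials
  -- in `z`
  have key : Polynomial.C (vandermondeDet b) * Z b (macOp (l + N) q t x f) =
      ∑ I : Finset (Fin N), Polynomial.C (x ^ I.card * vandermondeDet (scaleOn I t b)) *
        (Z (scaleOn I q b) f - Polynomial.C ((-x) ^ l) *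
          (Z (scaleOn I q b) f).comp (Polynomial.C q * Polynomial.X)) := by
    have hp : Polynomial.X * ∏ j, (Polynomial.C (b j ^ l) - Polynomial.X ^ l) ≠ 0 := by
      refine mul_ne_zero Polynomial.X_ne_zero (Finset.prod_ne_zero_iff.mpr fun j _ => ?_)
      rw [← neg_sub, neg_ne_zero]
      exact Polynomial.X_pow_sub_C_ne_zero hl _
    refine Polynomial.eq_of_infinite_eval_eq _ _
      ((Polynomial.finite_setOfPred_isRoot hp).infinite_compl.mono fun z hz => ?_)
    have hz : ¬ Polynomial.eval z (Polynomial.X *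
      ∏ j, (Polynomial.C (b j ^ l) - Polynomial.X ^ l)) = 0 := hz
    rw [Polynomial.eval_mul, Polynomial.eval_X, Polynomial.eval_prod, mul_eq_zero, not_or,
      Finset.prod_eq_zero_iff] at hz
    have h := vandermondeDet_mul_evalAt_append_macOp hl ht q x hz.1 (b := b) (fun j hj =>
      hz.2 ⟨j, Finset.mem_univ j, by simp [hj]⟩) f
    rw [Set.mem_ofPred_eq, Polynomial.eval_mul, Polynomial.eval_C, Polynomial.eval_finsetSum]
    simp only [Polynomial.eval_mul, Polynomial.eval_C, Polynomial.eval_sub, Polynomial.eval_comp,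
      Polynomial.eval_X, Z, ← evalAt_append_stringVec_eq_eval ht]
    exact h
  have hkey := congrArg (fun p => Polynomial.coeff p j) key
  simp only [Polynomial.coeff_C_mul, Polynomial.finsetSum_coeff, Polynomial.coeff_sub,
    Polynomial.comp_C_mul_X_coeff, hZ] at hkey
  refine mul_left_cancel₀ (vandermondeDet_ne_zero hb) ?_
  rw [map_sub, map_smul, mul_sub, hkey, mul_smul_comm, vandermondeDet_mul_evalAt_macOp,
    Finset.smul_sum, ← Finset.sum_sub_distrib, mul_zero]
  refine Finset.sum_eq_zero fun I _ => ?_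
  rw [smul_eq_mul]
  ring

end string

/-! ### Strings and the specialized Macdonald polynomials -/

section vectors

variable {N : ℕ}

theorem map_append {l : ℕ} {M : Type*} (f : Fin l → M) (g : Fin N → M) :
    Finset.univ.val.map (Fin.append f g) = Finset.univ.val.map f + Finset.univ.val.map g := by
  have h : ∀ {N : ℕ} (f : Fin N → M), Finset.univ.val.map f = (List.ofFn f : Multiset M) := by
    intro N f
    rw [List.ofFn_eq_map]
    rfl
  rw [h, h, h, List.ofFn_fin_append, Multiset.coe_add]

/-- For a base `B ≥ N`, the sum `∑ B ^ α_i` is monotone for the lexicographic order. -/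
theorem sum_pow_le_of_toLex_le {α β : Fin N →₀ ℕ} (hα : Antitone α) (h : toLex α ≤ toLex β)
    {B : ℕ} (hB : N ≤ B) : ∑ i, B ^ α i ≤ ∑ i, B ^ β i := by
  rcases h.eq_or_lt with h | h
  · rw [toLex.injective h]
  obtain ⟨p, hp, hlt⟩ := toLex_lt_iff.mp h
  have hB0 : 0 < B := lt_of_lt_of_le (Fin.pos p) hB
  have h1 : ∑ i ∈ Finset.univ.filter (p ≤ ·), B ^ α i ≤ B ^ β p := by
    calc ∑ i ∈ Finset.univ.filter (p ≤ ·), B ^ α i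
        ≤ ∑ _i ∈ Finset.univ.filter (p ≤ ·), B ^ α p := by
          refine Finset.sum_le_sum fun i hi => Nat.pow_le_pow_right hB0 (hα ?_)
          exact (Finset.mem_filter.mp hi).2
      _ ≤ N * B ^ α p := by
          rw [Finset.sum_const, smul_eq_mul]
          refine Nat.mul_le_mul_right _ ((Finset.card_filter_le _ _).trans ?_)
          simp
      _ ≤ B * B ^ α p := Nat.mul_le_mul_right _ hB
      _ = B ^ (α p + 1) := by ring
      _ ≤ B ^ β p := Nat.pow_le_pow_right hB0 hlt
  have h2 : B ^ β p ≤ ∑ i ∈ Finset.univ.filter (p ≤ ·), B ^ β i :=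
    Finset.single_le_sum (f := fun i => B ^ β i) (fun _ _ => Nat.zero_le _)
      (Finset.mem_filter.mpr ⟨Finset.mem_univ p, le_rfl⟩)
  rw [← Finset.sum_filter_add_sum_filter_not Finset.univ (p ≤ ·) fun i => B ^ α i,
    ← Finset.sum_filter_add_sum_filter_not Finset.univ (p ≤ ·) fun i => B ^ β i]
  refine add_le_add (h1.trans h2) (Finset.sum_le_sum fun i hi => ?_)
  rw [hp i (not_le.mp (Finset.mem_filter.mp hi).2)]

theorem sum_pow_le_of_lexBounded {R : Type*} [CommRing R] {n : ℕ} (hn : n ≤ N)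
    {lam : n.Partition} {f : PSumRing R}
    (hf : IsWt f n) (hb : LexBounded f (partVec N lam)) {β : Fin N →₀ ℕ}
    (hβ : coeff β (toFin R N f) ≠ 0) {B : ℕ} (hB : N ≤ B) :
    ∑ i, B ^ β i ≤ ∑ i, B ^ partVec N lam i := by
  obtain ⟨kap, σ, rfl⟩ := exists_equivMapDomain_partVec hn β (hf.coeff_toFin hβ)
  rw [coeff_toFin_equivMapDomain] at hβ
  have h : ∑ i, B ^ (partVec N kap).equivMapDomain σ i = ∑ i, B ^ partVec N kap i :=
    Equiv.sum_comp σ.symm fun i => B ^ partVec N kap i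
  rw [h]
  exact sum_pow_le_of_toLex_le (antitone_partVec N kap) (hb _ hβ) hB

end vectors

section coefficient

variable {K : Type*} [Field K] {l N : ℕ} {t : K}

theorem evalAt_eq_aeval_toFin {R S : Type*} [CommRing R] [CommRing S] [Algebra R S]
    (a : Fin N → S) (f : PSumRing R) : evalAt a f = aeval a (toFin R N f) := by
  have h : (aeval a).comp (toFin R N) = evalAt (R := R) (S := S) a := by
    apply MvPolynomial.algHom_ext
    intro k
    simp [toFin]
  rw [← h, AlgHom.comp_apply]

theorem evalAt_C_X (f : PSumRing K) :
    evalAt (S := Polynomial (MvPolynomial (Fin N) K)) (fun i => Polynomial.C (X i)) f =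
      Polynomial.C (toFin K N f) := by
  induction f using MvPolynomial.induction_on with
  | C a =>
    have h : toFin K N (C a) = C a := aeval_C _ _
    rw [h]
    exact aeval_C _ _
  | add f g hf hg => rw [map_add, map_add, map_add, hf, hg]
  | mul_X f k hf =>
    have h : toFin K N (X k) = ∑ i, X i ^ (k : ℕ) := aeval_X _ _
    rw [map_mul, map_mul, map_mul, hf, h, evalAt_X, map_sum]
    simp only [map_pow]

/-- The coefficients of the string coefficient of `f`, in terms of those of `f`. -/
theorem coeff_toFin_stringCoeff (ht : IsPrimitiveRoot t l) (j : ℕ) (f : PSumRing K)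
    (v : Fin N →₀ ℕ) : coeff v (toFin K N (stringCoeff K l j f)) =
      ∑ β ∈ (toFin K (l + N) f).support, coeff β (toFin K (l + N) f) *
        if ∑ i : Fin l, β (Fin.castAdd N i) = j ∧ ∀ i : Fin N, β (Fin.natAdd l i) = v i then
          t ^ ∑ i : Fin l, (i : ℕ) * β (Fin.castAdd N i) else 0 := by
  classical
  have h := evalAt_append_stringVec (S := Polynomial (MvPolynomial (Fin N) K)) ht
     Polynomial.X (fun i : Fin N => Polynomial.C (X i)) f
  have h1 : (evalAt (R := K) (S := Polynomial (MvPolynomial (Fin N) K))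
      (fun i => Polynomial.C (X i)) : PSumRing K →+* Polynomial (MvPolynomial (Fin N) K)) =
        Polynomial.C.comp (toFin K N : PSumRing K →+* MvPolynomial (Fin N) K) :=
    RingHom.ext evalAt_C_X
  have h2 : Polynomial.eval₂ (Polynomial.C.comp
      (toFin K N : PSumRing K →+* MvPolynomial (Fin N) K)) Polynomial.X (stringHom K l f) =
        (stringHom K l f).map (toFin K N : PSumRing K →+* MvPolynomial (Fin N) K) := rfl
  rw [h1, h2, evalAt_eq_aeval_toFin, aeval_def, eval₂_eq'] at h
  have h3 := congrArg (fun p => coeff v (Polynomial.coeff p j)) h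
  simp only [Polynomial.coeff_map, Polynomial.finsetSum_coeff, coeff_sum] at h3
  refine Eq.trans h3.symm (Finset.sum_congr rfl fun β _ => ?_)
  set c := coeff β (toFin K (l + N) f)
  have h4 : algebraMap K (Polynomial (MvPolynomial (Fin N) K)) c * ∏ i, (Fin.append
      (fun i : Fin l => (Polynomial.X : Polynomial (MvPolynomial (Fin N) K)) *
        algebraMap K (Polynomial (MvPolynomial (Fin N) K)) t ^ (i : ℕ))
      (fun i : Fin N => Polynomial.C (X i)) i) ^ β i =
      Polynomial.monomial (∑ i : Fin l, β (Fin.castAdd N i))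
        (monomial (Finsupp.equivFunOnFinite.symm fun i : Fin N => β (Fin.natAdd l i))
          (c * t ^ ∑ i : Fin l, (i : ℕ) * β (Fin.castAdd N i))) := by
    rw [Fin.prod_univ_add]
    simp only [Fin.append_left, Fin.append_right, mul_pow, Finset.prod_mul_distrib, ← pow_mul]
    rw [Finset.prod_pow_eq_pow_sum, Finset.prod_pow_eq_pow_sum,
      ← Polynomial.C_mul_X_pow_eq_monomial, monomial_eq, Finsupp.prod_fintype _ _ (by simp)]
    have h5 : ∀ a : K, algebraMap K (Polynomial (MvPolynomial (Fin N) K)) a =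
        Polynomial.C (C a) := fun a => rfl
    simp only [h5, map_mul, map_pow, map_prod, Finsupp.equivFunOnFinite_symm_apply_apply]
    ring
  rw [h4, Polynomial.coeff_monomial]
  by_cases h5 : ∑ i : Fin l, β (Fin.castAdd N i) = j
  · rw [if_pos h5, coeff_monomial]
    by_cases h6 : ∀ i : Fin N, β (Fin.natAdd l i) = v i
    · rw [if_pos (Finsupp.ext h6), if_pos ⟨h5, h6⟩]
    · rw [if_neg, if_neg (fun h => h6 h.2), mul_zero]
      intro h7
      exact h6 fun i => DFunLike.congr_fun h7 i
  · rw [if_neg h5, if_neg (fun h => h5 h.1), coeff_zero, mul_zero]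

end coefficient

/-! ### Multiplicativity of `Q'` at a root of unity -/

section factorization

variable {ζ : ℂ} {l n : ℕ}

theorem isPrimitiveRoot_C (hζ : IsPrimitiveRoot ζ l) : IsPrimitiveRoot (RatFunc.C ζ) l :=
  hζ.map_of_injective RatFunc.C_injective

theorem hallForm_macQSpec_sum (hζ : ζ ≠ 0) (mu : n.Partition) (c : n.Partition → RatFunc ℂ) :
    hallForm _ (macQSpec hζ mu) (∑ lam, c lam • macPSpec hζ lam) = c mu := by
  classical
  rw [map_sum, Finset.sum_eq_single mu]
  · rw [map_smul, hallForm_macQSpec_macPSpec, if_pos rfl, smul_eq_mul, mul_one]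
  · intro lam _ h
    rw [map_smul, hallForm_macQSpec_macPSpec, if_neg h, smul_zero]
  · simp

/-- The string coefficient of `P_λ` is an eigenfunction, and the eigenvalue identifies it. -/
theorem parts_eq_of_hallForm_ne_zero (hl : 0 < l) (hp : IsPrimitiveRoot ζ l) (hζ : ζ ≠ 0) {i : ℕ}
    (hi : 0 < i) (lam : (l * i + n).Partition) (nu : n.Partition)
    (h : hallForm _ (macQSpec hζ nu) (stringCoeff _ l (l * i) (macPSpec hζ lam)) ≠ 0) :
    lam.parts = nu.parts + Multiset.replicate l i := by
  obtain ⟨N, hN⟩ : ∃ N, N = l * i + n := ⟨_, rfl⟩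
  have ht := isPrimitiveRoot_C hp
  have hnN : n ≤ N := by omega
  have hNN : l * i + n ≤ l + N := by omega
  have hP := isUnitriangular_macPSpec hζ (le_refl (l * i + n)) lam
  obtain ⟨c, hc⟩ := (isUnitriangular_macPSpec (n := n) hζ (le_refl n)).exists_sum le_rfl
    (isWt_stringCoeff (l := l) (j := l * i) hP.1)
  rw [hc, hallForm_macQSpec_sum] at h
  -- the coefficient of `P_ν` in the string coefficient scales by two eigenvalues, which must agree
  have key : ∀ x : ℕ, macEig RatFunc.X (RatFunc.C ζ) (x : RatFunc ℂ) (partVec (l + N) lam) =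
      (1 - (-(x : RatFunc ℂ)) ^ l * RatFunc.X ^ (l * i)) *
        macEig RatFunc.X (RatFunc.C ζ) (x : RatFunc ℂ) (partVec N nu) := by
    intro x
    have h1 := stringCoeff_macOp (N := N) hl ht RatFunc.X (x : RatFunc ℂ) hP.1 hnN
    rw [macOp_macPSpec hζ hNN, map_smul] at h1
    have h2 := congrArg (hallForm _ (macQSpec hζ nu)) h1
    rw [hc, map_sum] at h2
    have h3 : ∀ mu : n.Partition, macOp N RatFunc.X (RatFunc.C ζ) (x : RatFunc ℂ)
        (c mu • macPSpec hζ mu) =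
          (macEig RatFunc.X (RatFunc.C ζ) (x : RatFunc ℂ) (partVec N mu) * c mu) •
            macPSpec hζ mu := by
      intro mu
      rw [map_smul, macOp_macPSpec hζ hnN, smul_smul, mul_comm]
    rw [Finset.sum_congr rfl fun mu _ => h3 mu, map_smul, map_smul, hallForm_macQSpec_sum,
      hallForm_macQSpec_sum, smul_eq_mul, smul_eq_mul, ← mul_assoc] at h2
    exact mul_right_cancel₀ h h2
  have hmap := map_eq_of_forall_prod_X_pow_eq (N := l + N)
    (a := fun k => ζ ^ staircase (l + N) k)
    (b := Fin.append (fun k : Fin l => ζ ^ (k : ℕ)) fun k => ζ ^ staircase N k)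
    (α := partVec (l + N) lam) (β := Fin.append (fun _ : Fin l => i) (partVec N nu))
    (fun _ => pow_ne_zero _ hζ) (fun k => by
      induction k using Fin.addCases with
      | left k => rw [Fin.append_left]; exact pow_ne_zero _ hζ
      | right k => rw [Fin.append_right]; exact pow_ne_zero _ hζ) (fun x => by
      rw [← macEig_eq_prod, key, Fin.prod_univ_add]
      simp only [Fin.append_left, Fin.append_right]
      rw [← macEig_eq_prod]
      congr 1
      have h4 := prod_one_add_stringVec hl ht ((x : RatFunc ℂ) * RatFunc.X ^ i)
      rw [neg_mul_eq_neg_mul, mul_pow, ← pow_mul, mul_comm i l] at h4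
      rw [← h4]
      refine Finset.prod_congr rfl fun k _ => ?_
      rw [stringVec, map_pow]
      ring)
  rw [map_append] at hmap
  rw [← filter_map_partVec hNN lam, hmap, Multiset.filter_add,
    filter_map_partVec hnN nu, add_comm]
  congr 1
  rw [Finset.univ.val.map_const', Finset.card_val, Finset.card_univ, Fintype.card_fin,
    Multiset.filter_eq_self]
  intro a ha
  rw [Multiset.eq_of_mem_replicate ha]
  exact hi.ne'

/-- The leading coefficient of the string coefficient of `P_λ`. -/
theorem hallForm_stringCoeff_macPSpec (hl : 0 < l) (hp : IsPrimitiveRoot ζ l) (hζ : ζ ≠ 0) {i : ℕ}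
    (hi : 0 < i) (lam : (l * i + n).Partition) (nu : n.Partition)
    (h : lam.parts = nu.parts + Multiset.replicate l i) :
    hallForm _ (macQSpec hζ nu) (stringCoeff _ l (l * i) (macPSpec hζ lam)) =
      RatFunc.C ζ ^ ∑ k : Fin l, (k : ℕ) * i := by
  classical
  obtain ⟨N, hN⟩ : ∃ N, N = l * i + n := ⟨_, rfl⟩
  have ht := isPrimitiveRoot_C hp
  have hnN : n ≤ N := by omega
  have hNN : l * i + n ≤ l + N := by omega
  have hP := isUnitriangular_macPSpec hζ hNN lam
  obtain ⟨c, hc⟩ := (isUnitriangular_macPSpec (n := n) hζ (le_refl n)).exists_sum le_rfl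
    (isWt_stringCoeff (l := l) (j := l * i) hP.1)
  have hc0 : ∀ mu, mu ≠ nu → c mu = 0 := by
    intro mu hmu
    by_contra h0
    have h1 := parts_eq_of_hallForm_ne_zero hl hp hζ hi lam mu
      (by rwa [hc, hallForm_macQSpec_sum])
    rw [h] at h1
    exact hmu (Nat.Partition.ext (add_right_cancel h1).symm)
  have hL : stringCoeff _ l (l * i) (macPSpec hζ lam) = c nu • macPSpec hζ nu := by
    rw [hc]
    refine Finset.sum_eq_single nu (fun mu _ hmu => ?_) (by simp)
    rw [hc0 mu hmu, zero_smul]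
  rw [hL, map_smul, hallForm_macQSpec_macPSpec, if_pos rfl, smul_eq_mul, mul_one]
  have h1 := coeff_toFin_stringCoeff ht (l * i) (macPSpec hζ lam) (partVec N nu)
  rw [hL, map_smul, coeff_smul, (isUnitriangular_macPSpec hζ hnN nu).2.2, smul_eq_mul,
    mul_one] at h1
  rw [h1]
  set β₀ : Fin (l + N) →₀ ℕ := Finsupp.equivFunOnFinite.symm
    (Fin.append (fun _ : Fin l => i) (partVec N nu)) with hβ₀
  have hmap : Finset.univ.val.map β₀ = Finset.univ.val.map (partVec (l + N) lam) := by
    have h2 : Finset.univ.val.map β₀ =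
        Finset.univ.val.map (Fin.append (fun _ : Fin l => i) (partVec N nu)) := rfl
    have h3 : N - Multiset.card nu.parts =
        l + N - Multiset.card (nu.parts + Multiset.replicate l i) := by
      rw [Multiset.card_add, Multiset.card_replicate]
      omega
    rw [h2, map_append, map_partVec hNN, map_partVec hnN, h, Finset.univ.val.map_const',
      Finset.card_val, Finset.card_univ, Fintype.card_fin, ← h3]
    rw [← add_assoc, add_comm (Multiset.replicate l i)]
  have hcoeff : coeff β₀ (toFin _ (l + N) (macPSpec hζ lam)) = 1 := by
    obtain ⟨σ, hσ⟩ := exists_perm_of_map_eq hmap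
    have h2 : β₀ = (partVec (l + N) lam).equivMapDomain σ.symm := by
      ext k
      rw [hσ]
      rfl
    rw [h2, coeff_toFin_equivMapDomain, hP.2.2]
  have hl0 : ∀ k : Fin l, β₀ (Fin.castAdd N k) = i := fun k => by
    rw [hβ₀]
    exact Fin.append_left (fun _ : Fin l => i) (partVec N nu) k
  have hr0 : ∀ k : Fin N, β₀ (Fin.natAdd l k) = partVec N nu k := fun k => by
    rw [hβ₀]
    exact Fin.append_right (fun _ : Fin l => i) (partVec N nu) k
  rw [Finset.sum_eq_single β₀]
  · rw [hcoeff, one_mul, if_pos]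
    · simp only [hl0]
    · exact ⟨by simp [hl0], hr0⟩
  · intro β hβ hne
    rw [if_neg, mul_zero]
    rintro ⟨hsum, hr⟩
    refine hne ?_
    -- the exponents on the string are at most `i`, by lexicographic maximality of `λ`; the base is
    -- larger than `l`, so that one exponent `i + 1` would outweigh `l` exponents `i`
    have h2 := sum_pow_le_of_lexBounded hNN hP.1 hP.2.1 (mem_support_iff.mp hβ)
      (B := l + N + 1) (Nat.le_succ _)
    have h3 : ∑ k, (l + N + 1) ^ partVec (l + N) lam k = ∑ k, (l + N + 1) ^ β₀ k := by
      have h4 := congrArg (fun s => (Multiset.map (fun e => (l + N + 1) ^ e) s).sum) hmap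
      simp only [Multiset.map_map] at h4
      exact h4.symm
    rw [h3, Fin.sum_univ_add, Fin.sum_univ_add] at h2
    simp only [hl0, hr0, hr, Finset.sum_const, Finset.card_univ, Fintype.card_fin,
      smul_eq_mul] at h2
    have h5 := Nat.le_of_add_le_add_right h2
    have h6 : ∀ k : Fin l, β (Fin.castAdd N k) ≤ i := by
      intro k
      by_contra hcon
      have h7 : (l + N + 1) ^ (i + 1) ≤ l * (l + N + 1) ^ i :=
        ((Nat.pow_le_pow_right (Nat.succ_pos _) (not_le.mp hcon)).trans
          (Finset.single_le_sum (f := fun k : Fin l => (l + N + 1) ^ β (Fin.castAdd N k))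
            (fun _ _ => Nat.zero_le _) (Finset.mem_univ k))).trans h5
      rw [pow_succ, mul_comm] at h7
      have h8 := Nat.le_of_mul_le_mul_right h7 (Nat.pow_pos (Nat.succ_pos _))
      omega
    have h9 : ∀ k : Fin l, β (Fin.castAdd N k) = i := by
      have h10 := (Finset.sum_eq_sum_iff_of_le
        (f := fun k : Fin l => β (Fin.castAdd N k)) (g := fun _ => i)
          (s := Finset.univ) fun k _ => h6 k).mp (by rw [hsum]; simp)
      exact fun k => h10 k (Finset.mem_univ k)
    ext k
    induction k using Fin.addCases with
    | left k => rw [h9, hl0]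
    | right k => rw [hr, hr0]
  · intro h2
    rw [notMem_support_iff.mp h2, zero_mul]

/-- Multiplication by the string function adds `l` parts equal to `i` to the index of `Q'`. -/
theorem stringPoly_mul_macQSpec (hl : 0 < l) (hp : IsPrimitiveRoot ζ l) (hζ : ζ ≠ 0) {i : ℕ}
    (hi : 0 < i) (mu : (l * i + n).Partition) (nu : n.Partition)
    (h : mu.parts = nu.parts + Multiset.replicate l i) :
    stringPoly _ l (l * i) * macQSpec hζ nu =
      (RatFunc.C ζ ^ ∑ k : Fin l, (k : ℕ) * i) • macQSpec hζ mu := by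
  classical
  refine eq_of_hallForm_macPSpec hζ ((isWt_stringPoly l (l * i)).mul (isWt_macQSpec hζ nu))
    ((isWt_macQSpec hζ mu).smul _) fun lam => ?_
  rw [hallForm_stringPoly_mul, map_smul, LinearMap.smul_apply, hallForm_macQSpec_macPSpec]
  split_ifs with hlam
  · subst hlam
    rw [hallForm_stringCoeff_macPSpec hl hp hζ hi lam nu h, smul_eq_mul, mul_one]
  · rw [smul_zero]
    by_contra h0
    have h1 := parts_eq_of_hallForm_ne_zero hl hp hζ hi lam nu h0
    exact hlam (Nat.Partition.ext (h1.trans h.symm))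

/-- `Q'` of the empty partition is `1`. -/
theorem macQSpec_eq_one (hζ : ζ ≠ 0) (nu : Nat.Partition 0) : macQSpec hζ nu = 1 := by
  classical
  refine eq_of_hallForm_macPSpec hζ (isWt_macQSpec hζ nu) (isWeightedHomogeneous_one _ _)
    fun lam => ?_
  obtain ⟨hw, _, h1⟩ := isUnitriangular_macPSpec hζ (le_refl 0) lam
  have h2 : macPSpec hζ lam = C (coeff 0 (macPSpec hζ lam)) := by
    ext m
    rw [coeff_C]
    split_ifs with h
    · rw [h]
    · refine hw.coeff_eq_zero fun h0 => h ?_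
      by_contra hne
      obtain ⟨k, hk⟩ := Finsupp.ne_iff.mp (Ne.symm hne)
      have := le_wt_of_ne_zero hk
      have := k.pos
      omega
  have h3 : coeff 0 (macPSpec hζ lam) = 1 := by
    have h4 : toFin (RatFunc ℂ) 0 (C (coeff 0 (macPSpec hζ lam))) =
      C (coeff 0 (macPSpec hζ lam)) := aeval_C _ _
    rw [h2, h4, Subsingleton.elim (partVec 0 lam) 0, coeff_zero_C] at h1
    exact h1
  rw [hallForm_macQSpec_macPSpec, if_pos (Subsingleton.elim _ _)]
  have h5 := coeff_eq_hallForm (macPSpec hζ lam) 0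
  have h6 : monomial (0 : ℕ+ →₀ ℕ) (algebraMap ℚ (RatFunc ℂ) (zInv 0)) = 1 := by
    simp [zInv]
  rw [h6, hallForm, psForm_comm, ← hallForm, h3] at h5
  exact h5

theorem macQSpec_congr (hζ : ζ ≠ 0) {m n : ℕ} (mu : m.Partition) (nu : n.Partition)
    (h : mu.parts = nu.parts) : macQSpec hζ mu = macQSpec hζ nu := by
  obtain rfl : m = n := by rw [← mu.parts_sum, h, nu.parts_sum]
  rw [Nat.Partition.ext h]

theorem rectangle_parts {i : ℕ} (hi : 0 < i) (l : ℕ) :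
    (rectangle i l).parts = Multiset.replicate l i := by
  have h : (rectangle i l).parts = (Multiset.replicate l i).filter (· ≠ 0) := rfl
  rw [h, Multiset.filter_eq_self]
  intro a ha
  rw [Multiset.eq_of_mem_replicate ha]
  exact hi.ne'

/-- Splitting off `l` equal parts. -/
theorem macQSpec_add_replicate (hl : 0 < l) (hp : IsPrimitiveRoot ζ l) (hζ : ζ ≠ 0) {i m : ℕ}
    (hi : 0 < i) (mu : m.Partition) (nu : n.Partition)
    (h : mu.parts = nu.parts + Multiset.replicate l i) :
    macQSpec hζ mu = macQSpec hζ (rectangle i l) * macQSpec hζ nu := by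
  obtain rfl : m = l * i + n := by
    rw [← mu.parts_sum, h, Multiset.sum_add, nu.parts_sum, Multiset.sum_replicate, smul_eq_mul,
      add_comm]
  let kap : (l * i + 0).Partition := ⟨Multiset.replicate l i, fun {a} ha => by
    rw [Multiset.eq_of_mem_replicate ha]; exact hi, by simp⟩
  have h1 := stringPoly_mul_macQSpec hl hp hζ hi mu nu h
  have h2 := stringPoly_mul_macQSpec hl hp hζ hi kap (default : Nat.Partition 0) (by
    have : (default : Nat.Partition 0).parts = 0 := Multiset.eq_zero_of_forall_notMem fun a ha => by
      have h3 := Multiset.le_sum_of_mem ha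
      have h4 := (default : Nat.Partition 0).parts_pos ha
      rw [(default : Nat.Partition 0).parts_sum] at h3
      omega
    rw [this, zero_add])
  rw [macQSpec_eq_one, mul_one, macQSpec_congr hζ kap (rectangle i l)
    (rectangle_parts hi l).symm] at h2
  rw [h2, smul_mul_assoc] at h1
  have hc : RatFunc.C ζ ^ (∑ k : Fin l, (k : ℕ) * i) ≠ 0 :=
    pow_ne_zero _ ((map_ne_zero RatFunc.C).mpr hζ)
  have h5 := congrArg (fun f => (RatFunc.C ζ ^ (∑ k : Fin l, (k : ℕ) * i))⁻¹ • f) h1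
  simp only [inv_smul_smul₀ hc] at h5
  exact h5.symm

theorem macQSpec_add_replicate_mul (hl : 0 < l) (hp : IsPrimitiveRoot ζ l) (hζ : ζ ≠ 0)
    {i m : ℕ} (hi : 0 < i) (a : ℕ) (mu : m.Partition) (nu : n.Partition)
    (h : mu.parts = nu.parts + Multiset.replicate (l * a) i) :
    macQSpec hζ mu = macQSpec hζ (rectangle i l) ^ a * macQSpec hζ nu := by
  induction a generalizing m with
  | zero =>
    rw [mul_zero, Multiset.replicate_zero, add_zero] at h
    rw [pow_zero, one_mul, macQSpec_congr hζ _ _ h]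
  | succ a ih =>
    let kap : Nat.Partition (nu.parts + Multiset.replicate (l * a) i).sum :=
      ⟨nu.parts + Multiset.replicate (l * a) i, fun {b} hb => by
        rcases Multiset.mem_add.mp hb with hb | hb
        · exact nu.parts_pos hb
        · rw [Multiset.eq_of_mem_replicate hb]; exact hi, rfl⟩
    rw [macQSpec_add_replicate hl hp hζ hi mu kap (by
      rw [h, mul_add, mul_one, Multiset.replicate_add, add_assoc]), ih kap rfl, pow_succ',
      mul_assoc]

theorem macQSpec_add_sum (hl : 0 < l) (hp : IsPrimitiveRoot ζ l) (hζ : ζ ≠ 0) (S : Finset ℕ)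
    (hS : ∀ i ∈ S, 0 < i) (a : ℕ → ℕ) {m : ℕ} (mu : m.Partition) (nu : n.Partition)
    (h : mu.parts = nu.parts + ∑ i ∈ S, Multiset.replicate (l * a i) i) :
    macQSpec hζ mu = (∏ i ∈ S, macQSpec hζ (rectangle i l) ^ a i) * macQSpec hζ nu := by
  classical
  induction S using Finset.induction_on generalizing m with
  | empty =>
    rw [Finset.sum_empty, add_zero] at h
    rw [Finset.prod_empty, one_mul, macQSpec_congr hζ _ _ h]
  | insert i S hiS ih =>
    have hS' : ∀ j ∈ S, 0 < j := fun j hj => hS j (Finset.mem_insert_of_mem hj)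
    let kap : Nat.Partition (nu.parts + ∑ i ∈ S, Multiset.replicate (l * a i) i).sum :=
      ⟨nu.parts + ∑ i ∈ S, Multiset.replicate (l * a i) i, fun {b} hb => by
        rcases Multiset.mem_add.mp hb with hb | hb
        · exact nu.parts_pos hb
        · obtain ⟨j, hj, hb⟩ := Multiset.mem_sum.mp hb
          rw [Multiset.eq_of_mem_replicate hb]
          exact hS' j hj, rfl⟩
    rw [macQSpec_add_replicate_mul hl hp hζ (hS i (Finset.mem_insert_self i S)) (a i) mu kap (by
      rw [h, Finset.sum_insert hiS, add_comm (Multiset.replicate _ _), add_assoc]),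
      ih hS' kap rfl, Finset.prod_insert hiS, mul_assoc]

/-- Division with remainder of all multiplicities by `l`. -/
theorem parts_eq_reduceMod_add (l : ℕ) (mu : n.Partition) :
    mu.parts = (reduceMod l mu).parts +
      ∑ i ∈ Finset.Icc 1 n, Multiset.replicate (l * (mu.parts.count i / l)) i := by
  have h1 : (reduceMod l mu).parts =
      ∑ i ∈ Finset.Icc 1 n, Multiset.replicate (mu.parts.count i % l) i := by
    refine (Multiset.filter_eq_self (p := (· ≠ 0))).mpr fun a ha => ?_
    obtain ⟨i, hi, ha⟩ := Multiset.mem_sum.mp ha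
    rw [Multiset.eq_of_mem_replicate ha]
    exact Nat.one_le_iff_ne_zero.mp (Finset.mem_Icc.mp hi).1
  rw [h1, ← Finset.sum_add_distrib]
  ext a
  rw [Multiset.count_sum']
  simp only [← Multiset.replicate_add, Nat.mod_add_div, Multiset.count_replicate]
  rw [Finset.sum_ite_eq']
  split_ifs with h
  · rfl
  · refine Multiset.count_eq_zero.mpr fun ha => h ?_
    rw [Finset.mem_Icc]
    refine ⟨mu.parts_pos ha, ?_⟩
    rw [← mu.parts_sum]
    exact Multiset.le_sum_of_mem ha

end factorization

end Macdonald

end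

open Macdonald in
theorem mainTheorem1 (l : ℕ) (hl : 0 < l) (ζ : ℂ) (hζ : IsPrimitiveRoot ζ l)
    (n : ℕ) (mu : n.Partition) :
    RegularAt ζ (macdonaldQ' mu) ∧
    (∀ i ∈ Finset.Icc 1 n, RegularAt ζ (macdonaldQ' (rectangle i l))) ∧
    RegularAt ζ (macdonaldQ' (reduceMod l mu)) ∧
    specialize ζ (macdonaldQ' mu) =
      (∏ i ∈ Finset.Icc 1 n,
        specialize ζ (macdonaldQ' (rectangle i l)) ^ (mu.parts.count i / l)) *
      specialize ζ (macdonaldQ' (reduceMod l mu)) := by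
  have h0 : ζ ≠ 0 := hζ.ne_zero hl.ne'
  refine ⟨regularAt_macdonaldQ' h0 _, fun i _ => regularAt_macdonaldQ' h0 _,
    regularAt_macdonaldQ' h0 _, ?_⟩
  simp only [specialize_macdonaldQ' h0]
  rw [macQSpec_add_sum hl hζ h0 (Finset.Icc 1 n) (fun i hi => (Finset.mem_Icc.mp hi).1)
    (fun i => mu.parts.count i / l) mu (reduceMod l mu) (parts_eq_reduceMod_add l mu), map_mul,
    map_prod]
  simp only [map_pow]
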